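/- **Setting.** Let $\mathcal S,\mathcal A$ be measurable spaces (for instance subsets of Euclidean spaces), $\nu$ a $\sigma$-finite reference measure on $\mathcal A$ (written $da$; e.g. Lebesgue measure), $\mathbb P(\cdot\mid s,a)$ a Markov transition kernel, $R:\mathcal S\times\mathcal A\to\mathbb R$ a measurable reward and $\gamma\in[0,1)$ a discount factor. Let $\pi_\theta(a\mid s)>0$, $\theta\in\mathbb R^d$, be jointly measurable probability densities in $a$ with $\theta\mapsto\log\pi_\theta(a\mid s)$ differentiable; $\nabla\log\pi_\theta(a\mid s)$ (gradient in $\theta$) is the score function. Fix $s_0\in\mathcal S$ and put $J(\theta)=\mathbb E\big[\sum_{t\ge0}\gamma^tR(s_t,a_t)\big]$, where $a_t\sim\pi_\theta(\cdot\mid s_t)$ and $s_{t+1}\sim\mathbb P(\cdot\mid s_t,a_t)$. **Algorithm (heavy-tailed policy gradient).** Given $\theta_0\in\mathbb R^d$ and a constant step size $\eta$, at step $k$ draw $T_k$ with $\Pr(T_k=t)=(1-\gamma^{1/2})\gamma^{t/2}$, $t=0,1,2,\dots$, and, independently of it, a fresh trajectory $(s_t,a_t)_{t\ge 0}$ from $s_0$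 under $\pi_{\theta_k}$, and set $$\theta_{k+1}=\theta_k+\eta\sum_{t=0}^{T_k}\gamma^{t/2}R(s_t,a_t)\sum_{\tau=0}^{t}\nabla\log\pi_{\theta_k}(a_\tau\mid s_\tau).$$ **Assumptions.** (1) $|R|\le U_R<\infty$. (2) $\int_{\mathcal A}\|\nabla\log\pi_\theta(a\mid s)\|^2\pi_\theta(a\mid s)\,da\le B<\infty$ for all $s,\theta$. (3) For some $M>0$ and $0<\beta\le1$, $\|\nabla\log\pi_{\theta_1}(a\mid s)-\nabla\log\pi_{\theta_2}(a\mid s)\|\le M\|\theta_1-\theta_2\|^\beta$ for all $\theta_1,\theta_2,s,a$; and $\beta\in(0,\alpha-1]$, where $\alpha$ is the tail index. (4) $J\le J^*$ on $\mathbb R^d$ for a real number $J^*$. (5) $\lambda\ge0$ is an exploration tolerance parameter: with $\mathcal A(\lambda)$ the set of measurable $\mathcal C\subseteq\mathcal A$ such that $\int_{\mathcal A\setminus\mathcal C}\|\nabla\log\pi_\theta(a\mid s)\|\,\pi_\theta(a\mid s)\,da\le\lambda$ for all $s,\theta$, the number $$B(\lambda)=\inf_{\mathcal C\in\mathcal A(\lambda)}\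 \sup_{s\in\mathcal S,\,a\in\mathcal C}\ \sup_\theta\|\nabla\log\pi_\theta(a\mid s)\|$$ is finite. **Constants.** $M_\rho=\frac{\sqrt B}{1-\gamma}$, $M_Q=\frac{\gamma U_RM_\rho}{1-\gamma}$, $$M_J=\max\Big\{\tfrac{2U_RM}{(1-\gamma)^2},\ \tfrac{M_QB^{1/2}}{1-\gamma}+\tfrac{U_RB(\lambda)M_\rho}{(1-\gamma)^2},\ \tfrac{2U_R}{(1-\gamma)^2}\Big\},$$ $$L_J=\frac{2M_J}{(1-\gamma^{1/2})^4}\max\big\{U_R^2B,\ U_R^{1+\beta}B^{\frac{1+\beta}2},\ U_RB^{1/2}\big\}.$$ **Theorem.** $J$ is differentiable, for every step size $\eta$ each iterate $\theta_k$ has a well-defined law under which $\|\nabla J(\theta_k)\|^2$ is integrable, and for every integer $K\ge1$: (a) with step size $\eta=1/K^{1/(1+\beta)}$, $$\frac1K\sum_{k=0}^{K-1}\mathbb E\|\nabla J(\theta_k)\|^2\le\frac{J^*-J(\theta_0)+2L_J}{K^{\beta/(1+\beta)}}+L_J\lambda;$$ (b) with step size $\eta=c_\beta/K^{1/(1+\beta)}$,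 $c_\beta=\Big(\frac{J^*-J(\theta_0)}{2\beta L_J}\Big)^{1/(1+\beta)}$ (read as $c_\beta=0$ if $L_J=0$), $$\frac1K\sum_{k=0}^{K-1}\mathbb E\|\nabla J(\theta_k)\|^2\le\frac{a_\beta}{K^{\beta/(1+\beta)}}+L_J\lambda,\qquad a_\beta=\frac{1+\beta}{\beta^{\beta/(1+\beta)}}\,(2L_J)^{1/(1+\beta)}\,\big(J^*-J(\theta_0)\big)^{\beta/(1+\beta)}.$$ -/

import Mathlib

open MeasureTheory ProbabilityTheory
open scoped ENNReal

noncomputable section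

namespace HPG

/-- The parameter space `ℝ^d` with its Euclidean norm. -/
abbrev Param (d : ℕ) : Type := EuclideanSpace ℝ (Fin d)

/-- A discounted Markov decision problem with state space `S` and action space `A`
(arbitrary measurable spaces, in particular subsets of Euclidean spaces). -/
structure MDP (S A : Type*) [MeasurableSpace S] [MeasurableSpace A] where
  /-- the law of the next state given the present state and action -/
  trans : Kernel (S × A) S
  markov : IsMarkovKernel trans
  /-- the reward `R(s, a)` -/
  reward : S × A → ℝ
  measurable_reward : Measurable reward
  /-- the discount factor -/
  γ : ℝ
  γ_nonneg : 0 ≤ γ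
  γ_lt_one : γ < 1

/-- A family of policies `π_θ(a | s)`, `θ ∈ ℝ^d`, given by strictly positive probability densities
with respect to a reference measure `ν` on the actions (Lebesgue measure in the Euclidean case),
whose logarithms are differentiable in `θ`, so that the score function makes sense. -/
structure PolicyFamily (d : ℕ) (S : Type*) {A : Type*} [MeasurableSpace S] [MeasurableSpace A]
    (ν : Measure A) where
  dens : Param d → S → A → ℝ
  measurable_dens : Measurable fun p : Param d × S × A => dens p.1 p.2.1 p.2.2
  dens_pos : ∀ θ s a, 0 < dens θ s a
  lintegral_dens : ∀ θ s, ∫⁻ a, ENNReal.ofReal (dens θ s a) ∂ν = 1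
  differentiable_log : ∀ s a, Differentiable ℝ fun θ => Real.log (dens θ s a)

variable {d : ℕ} {S A : Type*} [MeasurableSpace S] [MeasurableSpace A] {ν : Measure A}

namespace PolicyFamily

/-- The score function `∇_θ log π_θ(a | s)`. -/
def score (π : PolicyFamily d S ν) (θ : Param d) (s : S) (a : A) : Param d :=
  gradient (fun θ' => Real.log (π.dens θ' s a)) θ

/-- The law `π_θ(· | s)` of the action, as a Markov kernel in `(θ, s)`. -/
def kernel [SigmaFinite ν] (π : PolicyFamily d S ν) : Kernel (Param d × S) A :=
  Kernel.withDensity (Kernel.const (Param d × S) ν)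
    fun p a => ENNReal.ofReal (π.dens p.1 p.2 a)

theorem measurable_kernel_dens (π : PolicyFamily d S ν) :
    Measurable (Function.uncurry fun (p : Param d × S) (a : A) =>
      ENNReal.ofReal (π.dens p.1 p.2 a)) := by
  have h : Measurable fun q : (Param d × S) × A => π.dens q.1.1 q.1.2 q.2 :=
    π.measurable_dens.comp
      ((measurable_fst.comp measurable_fst).prodMk
        ((measurable_snd.comp measurable_fst).prodMk measurable_snd))
  exact h.ennreal_ofReal

instance isMarkovKernel_kernel [SigmaFinite ν] (π : PolicyFamily d S ν) :
    IsMarkovKernel π.kernel := by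
  refine ⟨fun p => ⟨?_⟩⟩
  rw [kernel, Kernel.withDensity_apply' _ π.measurable_kernel_dens]
  simpa using π.lintegral_dens p.1 p.2

/-- The measurable sets `C` of actions outside which the score function has mean at most `lam`,
uniformly in the state and the parameter. -/
def toleranceSets (π : PolicyFamily d S ν) (lam : ℝ) : Set (Set A) :=
  {C | MeasurableSet C ∧ ∀ θ s,
    ∫⁻ a in Cᶜ, ‖π.score θ s a‖ₑ * ENNReal.ofReal (π.dens θ s a) ∂ν ≤ ENNReal.ofReal lam}

/-- `B(lam) = inf_C sup_{s, a ∈ C, θ} ‖∇ log π_θ(a | s)‖`, with values in `[0, ∞]`. -/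
def scoreBound (π : PolicyFamily d S ν) (lam : ℝ) : ℝ≥0∞ :=
  ⨅ C ∈ π.toleranceSets lam, ⨆ (s : S) (a ∈ C) (θ : Param d), ‖π.score θ s a‖ₑ

end PolicyFamily

namespace MDP

variable [SigmaFinite ν]

instance isMarkovKernel_trans (M : MDP S A) : IsMarkovKernel M.trans := M.markov

/-- One step of the state-action chain: from `(θ, s, a)` draw `s' ∼ P(· | s, a)`, then
`a' ∼ π_θ(· | s')`, and keep `θ`. -/
def step (M : MDP S A) (π : PolicyFamily d S ν) : Kernel (Param d × S × A) (Param d × S × A) :=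
  Kernel.deterministic Prod.fst measurable_fst ×ₖ
    ((M.trans.comap Prod.snd measurable_snd) ⊗ₖ
      (π.kernel.comap (fun p : (Param d × S × A) × S => (p.1.1, p.2))
        ((measurable_fst.comp measurable_fst).prodMk measurable_snd)))

instance isMarkovKernel_step (M : MDP S A) (π : PolicyFamily d S ν) :
    IsMarkovKernel (M.step π) := by
  unfold step; infer_instance

/-- The start of a trajectory: state `s`, action `a ∼ π_θ(· | s)`. -/
def start (π : PolicyFamily d S ν) (s : S) : Kernel (Param d) (Param d × S × A) :=
  Kernel.deterministic (fun θ => θ) measurable_id ×ₖ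
    (Kernel.deterministic (fun _ => s) measurable_const ×ₖ
      (π.kernel.comap (fun θ => (θ, s)) (measurable_id.prodMk measurable_const)))

/-- The law of the infinite trajectory `(s_0, a_0), (s_1, a_1), …` under `π_θ` with `s_0 = s`,
as a kernel in `θ` (the parameter is carried along by the chain and forgotten at the end). -/
def trajectory (M : MDP S A) (π : PolicyFamily d S ν) (s : S) : Kernel (Param d) (ℕ → S × A) :=
  ((Kernel.traj (X := fun _ : ℕ => Param d × S × A)
      (fun n => (M.step π).comap (fun h => h ⟨n, Finset.mem_Iic.2 le_rfl⟩)
        (measurable_pi_apply _)) 0) ∘ₖ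
    ((start π s).map fun z => fun _ : Finset.Iic 0 => z)).map fun ω n => (ω n).2

instance isMarkovKernel_start (π : PolicyFamily d S ν) (s : S) : IsMarkovKernel (start π s) := by
  unfold start; infer_instance

instance isMarkovKernel_trajectory (M : MDP S A) (π : PolicyFamily d S ν) (s : S) :
    IsMarkovKernel (M.trajectory π s) := by
  unfold trajectory
  have : IsMarkovKernel ((start π s).map fun z => fun _ : Finset.Iic 0 => z) :=
    Kernel.IsMarkovKernel.map _ (by fun_prop)
  exact Kernel.IsMarkovKernel.map _ (by fun_prop)

/-- The value `V^{π_θ}(s) = E[∑ γ^t R(s_t, a_t) | s_0 = s]`. -/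
def value (M : MDP S A) (π : PolicyFamily d S ν) (θ : Param d) (s : S) : ℝ :=
  ∫ ω, ∑' t : ℕ, M.γ ^ t * M.reward (ω t) ∂(M.trajectory π s θ)

/-- The objective `J(θ) = V^{π_θ}(s_0)`. -/
def objective (M : MDP S A) (π : PolicyFamily d S ν) (s₀ : S) (θ : Param d) : ℝ :=
  M.value π θ s₀

/-- The law of the horizon: `P(T = t) = (1 - γ^{1/2}) γ^{t/2}`, `t = 0, 1, 2, …`. -/
def horizon (M : MDP S A) : Measure ℕ :=
  geometricMeasure ⟨1 - Real.sqrt M.γ,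
    sub_nonneg.2 (Real.sqrt_le_one.2 M.γ_lt_one.le),
    sub_le_self _ (Real.sqrt_nonneg _)⟩

instance isProbabilityMeasure_horizon (M : MDP S A) : IsProbabilityMeasure M.horizon := by
  unfold horizon; infer_instance

/-- The law of a rollout: a horizon and, independently, a trajectory under `π_θ` from `s`. -/
def rollout (M : MDP S A) (π : PolicyFamily d S ν) (s : S) :
    Kernel (Param d) (ℕ × (ℕ → S × A)) :=
  Kernel.const (Param d) M.horizon ×ₖ M.trajectory π s

/-- The policy gradient estimate
`∑_{t=0}^{T} γ^{t/2} R(s_t, a_t) ∑_{τ=0}^{t} ∇ log π_θ(a_τ | s_τ)` of a rollout `(T, (s_t, a_t)_t)`. -/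
def estimate (M : MDP S A) (π : PolicyFamily d S ν) (θ : Param d) (x : ℕ × (ℕ → S × A)) :
    Param d :=
  ∑ t ∈ Finset.range (x.1 + 1), (Real.sqrt M.γ ^ t * M.reward (x.2 t)) •
    ∑ τ ∈ Finset.range (t + 1), π.score θ (x.2 τ).1 (x.2 τ).2

/-- One update `θ ↦ θ + η ĝ(θ)`, where the estimate uses a fresh rollout under `π_θ`. -/
def update (M : MDP S A) (π : PolicyFamily d S ν) (s₀ : S) (η : ℝ) :
    Kernel (Param d) (Param d) :=
  (Kernel.id ×ₖ M.rollout π s₀).map fun p => p.1 + η • M.estimate π p.1 p.2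

/-- The law of the `k`-th iterate `θ_k` of the algorithm with constant step size `η`,
started at `θ₀`. -/
def iterateLaw (M : MDP S A) (π : PolicyFamily d S ν) (s₀ : S) (η : ℝ) (θ₀ : Param d) :
    ℕ → Measure (Param d)
  | 0 => Measure.dirac θ₀
  | k + 1 => (M.iterateLaw π s₀ η θ₀ k).bind (M.update π s₀ η)

/-- `(1 / K) ∑_{k<K} E ‖∇J(θ_k)‖²`. -/
def meanSqGradNorm (M : MDP S A) (π : PolicyFamily d S ν) (s₀ : S) (η : ℝ) (θ₀ : Param d)
    (K : ℕ) : ℝ :=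
  1 / (K : ℝ) * ∑ k ∈ Finset.range K,
    ∫ θ, ‖gradient (M.objective π s₀) θ‖ ^ 2 ∂(M.iterateLaw π s₀ η θ₀ k)

end MDP

/-- `M_ρ = √B / (1 - γ)`. -/
def constMρ (γ B : ℝ) : ℝ := Real.sqrt B / (1 - γ)

/-- `M_Q = γ U M_ρ / (1 - γ)`. -/
def constMQ (γ U B : ℝ) : ℝ := γ * U * constMρ γ B / (1 - γ)

/-- The constant `M_J`; here `Blam` stands for `B(lam)`. -/
def constMJ (γ U B M Blam : ℝ) : ℝ :=
  max (2 * U * M / (1 - γ) ^ 2)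
    (max (constMQ γ U B * Real.sqrt B / (1 - γ) + U * Blam * constMρ γ B / (1 - γ) ^ 2)
      (2 * U / (1 - γ) ^ 2))

/-- The constant `L_J`; here `Blam` stands for `B(lam)`. -/
def constLJ (γ U B M Blam β : ℝ) : ℝ :=
  2 * constMJ γ U B M Blam / (1 - Real.sqrt γ) ^ 4 *
    max (U ^ 2 * B) (max (U ^ (1 + β) * B ^ ((1 + β) / 2)) (U * Real.sqrt B))

end HPG

end

noncomputable section

namespace HPG

open Filter Topology

/-! ### Discounted potentials of a Markov kernel. -/

section Resolvent

variable {X : Type*} [MeasurableSpace X]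

/-! The engine is stochastic ascent for a function with a generalized Hölder gradient. If ∇J varies
by at most M_J(r^β + r + λ) over a distance r, and ĝ is an unbiased estimate of ∇J(θ), then a step
ηĝ raises J in the mean by at least η‖∇J‖² − M_J(η^{1+β} E‖ĝ‖^{1+β} + η² E‖ĝ‖² + λη E‖ĝ‖). When the
three moments are bounded uniformly in θ, summing over k telescopes, and J ≤ J* bounds the mean of
‖∇J‖² by (J* − J(θ₀))/(Kη) + (L_J/2)(η^β + η + λ); this is `meanSqGradNorm_le`. The two rates come
from two choices of η. Three facts feed this argument.

Differentiability. Only a second moment and Hölder continuity of the score are available.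
Integrating the density along a segment of parameters expands θ ↦ π_θ(· | s) to first order in total
variation, uniformly in s (`RegularScore.lintegral_dens_sub_sub_inner_le`). The performance
difference identity `integral_occ_sub` writes J(θ₂) − J(θ₁) as an occupancy integral, under θ₁, of
the effect of changing a single action, so the expansion passes to J and gives ∇J as the integral of
Q ∇log π over the occupancy measure.

Smoothness. Between two parameters, Q is Lipschitz and the score is Hölder. The change of the
occupancy measure is harder, since it is tested against Q ∇log π, which may be unbounded. Cutting
the actions at a tolerance set C leaves a bounded integrand on C, for which the occupancy is
Lipschitz in θ, and a part off C that costs a multiple of λ (`norm_policyGradient_sub_le_of_mem`).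
This is where the term L_J λ comes from.

The estimate. Since P(T ≥ t) = γ^{t/2}, the random horizon turns the weight γ^{t/2} into γ^t, so the
estimate is unbiased (`integral_estimate`). The weight γ^{t/2} that remains in the sum bounds the
second moment uniformly in the horizon (`lintegral_estimate_sq_le`), and lower moments follow by
Jensen.

In (b) the step size may exceed 1, where the ascent bound is of no use; the pointwise bound ‖∇J‖² ≤
L_J(2 + λ) of `norm_policyGradient_sq_le` covers that range. -/

instance isMarkovKernel_pow (κ : Kernel X X) [IsMarkovKernel κ] (n : ℕ) :
    IsMarkovKernel (κ ^ n) := by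
  induction n with
  | zero => rw [pow_zero]; exact inferInstanceAs (IsMarkovKernel Kernel.id)
  | succ n ih => rw [pow_succ]; exact inferInstanceAs (IsMarkovKernel ((κ ^ n) ∘ₖ κ))

/-- The discounted potential kernel `∑ γ^t κ^t` of a kernel `κ`. -/
def resolvent (κ : Kernel X X) (γ : ℝ) : Kernel X X where
  toFun x := Measure.sum fun t : ℕ => ENNReal.ofReal (γ ^ t) • (κ ^ t) x
  measurable' := by
    refine Measure.measurable_of_measurable_coe _ fun s hs => ?_
    simp only [Measure.sum_apply _ hs, Measure.smul_apply, smul_eq_mul]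
    exact Measurable.tsum fun t => ((κ ^ t).measurable_coe hs).const_mul _

theorem resolvent_apply (κ : Kernel X X) (γ : ℝ) (x : X) :
    resolvent κ γ x = Measure.sum fun t : ℕ => ENNReal.ofReal (γ ^ t) • (κ ^ t) x := rfl

theorem lintegral_pow_zero (κ : Kernel X X) (x : X) {f : X → ℝ≥0∞} (hf : Measurable f) :
    ∫⁻ y, f y ∂(κ ^ 0) x = f x := by
  rw [pow_zero]; exact Kernel.lintegral_id' hf x

theorem lintegral_pow_succ (κ : Kernel X X) (t : ℕ) (x : X) {f : X → ℝ≥0∞} (hf : Measurable f) :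
    ∫⁻ y, f y ∂(κ ^ (t + 1)) x = ∫⁻ y, ∫⁻ z, f z ∂(κ ^ t) y ∂κ x := by
  rw [pow_succ]; exact Kernel.lintegral_comp (κ ^ t) κ x hf

theorem lintegral_pow_succ' (κ : Kernel X X) (t : ℕ) (x : X) {f : X → ℝ≥0∞} (hf : Measurable f) :
    ∫⁻ y, f y ∂(κ ^ (t + 1)) x = ∫⁻ y, ∫⁻ z, f z ∂κ y ∂(κ ^ t) x := by
  rw [pow_succ']; exact Kernel.lintegral_comp κ (κ ^ t) x hf

theorem lintegral_resolvent (κ : Kernel X X) (γ : ℝ) (x : X) (f : X → ℝ≥0∞) :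
    ∫⁻ y, f y ∂resolvent κ γ x = ∑' t : ℕ, ENNReal.ofReal (γ ^ t) * ∫⁻ y, f y ∂(κ ^ t) x := by
  rw [resolvent_apply, lintegral_sum_measure]
  simp [lintegral_smul_measure]

theorem tsum_ofReal_pow {γ : ℝ} (h0 : 0 ≤ γ) (h1 : γ < 1) :
    ∑' t : ℕ, ENNReal.ofReal (γ ^ t) = ENNReal.ofReal (1 / (1 - γ)) := by
  rw [← ENNReal.ofReal_tsum_of_nonneg (fun t => pow_nonneg h0 t)
    (summable_geometric_of_lt_one h0 h1), tsum_geometric_of_lt_one h0 h1, one_div]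

theorem resolvent_apply_univ (κ : Kernel X X) [IsMarkovKernel κ] {γ : ℝ} (h0 : 0 ≤ γ)
    (h1 : γ < 1) (x : X) : resolvent κ γ x Set.univ = ENNReal.ofReal (1 / (1 - γ)) := by
  rw [← lintegral_one, lintegral_resolvent]
  simp [tsum_ofReal_pow h0 h1]

theorem isFiniteKernel_resolvent (κ : Kernel X X) [IsMarkovKernel κ] {γ : ℝ} (h0 : 0 ≤ γ)
    (h1 : γ < 1) : IsFiniteKernel (resolvent κ γ) :=
  ⟨⟨ENNReal.ofReal (1 / (1 - γ)), ENNReal.ofReal_lt_top,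
    fun x => (resolvent_apply_univ κ h0 h1 x).le⟩⟩

/-- The first transition is peeled off, κ^{t+1} = κ^t ∘ κ. Integrated, this becomes the Bellman
equation of `qValue`. -/
theorem resolvent_apply_eq_add (κ : Kernel X X) {γ : ℝ} (h0 : 0 ≤ γ) (x : X) :
    resolvent κ γ x = Measure.dirac x + ENNReal.ofReal γ • (resolvent κ γ ∘ₖ κ) x := by
  refine Measure.ext_of_lintegral _ fun f hf => ?_
  rw [lintegral_add_measure, lintegral_smul_measure, Kernel.lintegral_comp _ _ _ hf,
    lintegral_dirac' _ hf]
  simp_rw [lintegral_resolvent]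
  rw [lintegral_tsum fun t =>
    (((hf.lintegral_kernel (κ := κ ^ t)).const_mul _).aemeasurable), tsum_eq_zero_add'
    ENNReal.summable, smul_eq_mul, ← ENNReal.tsum_mul_left, lintegral_pow_zero κ x hf, pow_zero,
    ENNReal.ofReal_one, one_mul]
  congr 1
  refine tsum_congr fun t => ?_
  rw [lintegral_const_mul _ (hf.lintegral_kernel (κ := κ ^ t)), ← mul_assoc,
    ← ENNReal.ofReal_mul h0, pow_succ' γ, lintegral_pow_succ κ t x hf]

/-- The last transition is peeled off instead, which is the flow balance of an occupancy measure.
Both forms meet in `integral_policy_qValue_sub`. -/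
theorem resolvent_apply_eq_add' (κ : Kernel X X) {γ : ℝ} (h0 : 0 ≤ γ) (x : X) :
    resolvent κ γ x = Measure.dirac x + ENNReal.ofReal γ • (κ ∘ₖ resolvent κ γ) x := by
  refine Measure.ext_of_lintegral _ fun f hf => ?_
  rw [lintegral_add_measure, lintegral_smul_measure, Kernel.lintegral_comp _ _ _ hf,
    lintegral_dirac' _ hf]
  simp_rw [lintegral_resolvent]
  rw [tsum_eq_zero_add' ENNReal.summable, smul_eq_mul, ← ENNReal.tsum_mul_left,
    lintegral_pow_zero κ x hf, pow_zero, ENNReal.ofReal_one, one_mul]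
  congr 1
  refine tsum_congr fun t => ?_
  rw [← mul_assoc, ← ENNReal.ofReal_mul h0, pow_succ' γ, lintegral_pow_succ' κ t x hf]

theorem integrable_of_abs_le {μ : Measure X} [IsFiniteMeasure μ] {f : X → ℝ} (hf : Measurable f)
    {b : ℝ} (hb : ∀ x, |f x| ≤ b) : Integrable f μ :=
  Integrable.of_bound hf.aestronglyMeasurable b (ae_of_all _ hb)

theorem measurable_integral_kernel {Y : Type*} [MeasurableSpace Y] (κ : Kernel X Y)
    {f : Y → ℝ} (hf : Measurable f) : Measurable fun x => ∫ y, f y ∂κ x :=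
  (hf.stronglyMeasurable.integral_kernel (κ := κ)).measurable

theorem abs_integral_le_of_abs_le {μ : Measure X} [IsProbabilityMeasure μ] {f : X → ℝ}
    {b : ℝ} (hb : ∀ x, |f x| ≤ b) : |∫ x, f x ∂μ| ≤ b := by
  simpa using norm_integral_le_of_norm_le_const (μ := μ) (f := f) (ae_of_all _ hb)

theorem integral_resolvent_eq_add (κ : Kernel X X) [IsMarkovKernel κ] {γ : ℝ} (h0 : 0 ≤ γ)
    (h1 : γ < 1) (x : X) {f : X → ℝ} (hf : Measurable f) {b : ℝ} (hb : ∀ x, |f x| ≤ b) :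
    ∫ y, f y ∂resolvent κ γ x = f x + γ * ∫ y, (∫ z, f z ∂resolvent κ γ y) ∂κ x := by
  have := isFiniteKernel_resolvent κ h0 h1
  have hi : Integrable f ((resolvent κ γ ∘ₖ κ) x) := integrable_of_abs_le hf hb
  rw [resolvent_apply_eq_add κ h0 x, integral_add_measure (integrable_of_abs_le hf hb)
    (hi.smul_measure ENNReal.ofReal_ne_top), integral_smul_measure, Kernel.integral_comp hi,
    integral_dirac' _ _ hf.stronglyMeasurable, ENNReal.toReal_ofReal h0, smul_eq_mul]

theorem integral_resolvent_eq_add' (κ : Kernel X X) [IsMarkovKernel κ] {γ : ℝ} (h0 : 0 ≤ γ)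
    (h1 : γ < 1) (x : X) {f : X → ℝ} (hf : Measurable f) {b : ℝ} (hb : ∀ x, |f x| ≤ b) :
    ∫ y, f y ∂resolvent κ γ x = f x + γ * ∫ y, (∫ z, f z ∂κ y) ∂resolvent κ γ x := by
  have := isFiniteKernel_resolvent κ h0 h1
  have hi : Integrable f ((κ ∘ₖ resolvent κ γ) x) := integrable_of_abs_le hf hb
  conv_lhs => rw [resolvent_apply_eq_add' κ h0 x]
  rw [integral_add_measure (integrable_of_abs_le hf hb)
    (hi.smul_measure ENNReal.ofReal_ne_top), integral_smul_measure, Kernel.integral_comp hi,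
    integral_dirac' _ _ hf.stronglyMeasurable, ENNReal.toReal_ofReal h0, smul_eq_mul]

theorem abs_integral_resolvent_le (κ : Kernel X X) [IsMarkovKernel κ] {γ : ℝ} (h0 : 0 ≤ γ)
    (h1 : γ < 1) (x : X) {f : X → ℝ} {b : ℝ} (hb : ∀ x, |f x| ≤ b) :
    |∫ y, f y ∂resolvent κ γ x| ≤ b / (1 - γ) := by
  have := isFiniteKernel_resolvent κ h0 h1
  have h := norm_integral_le_of_norm_le_const (μ := resolvent κ γ x) (f := f) (ae_of_all _ hb)
  rw [measureReal_def, resolvent_apply_univ κ h0 h1, ENNReal.toReal_ofReal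
    (one_div_nonneg.2 (sub_nonneg.2 h1.le)), mul_one_div] at h
  exact h

theorem hasSum_integral_resolvent (κ : Kernel X X) {γ : ℝ} (h0 : 0 ≤ γ) (x : X)
    {E : Type*} [NormedAddCommGroup E] [NormedSpace ℝ E] {f : X → E}
    (hf : Integrable f (resolvent κ γ x)) :
    HasSum (fun t : ℕ => γ ^ t • ∫ y, f y ∂(κ ^ t) x) (∫ y, f y ∂resolvent κ γ x) := by
  have h := hasSum_integral_measure hf
  simp only [integral_smul_measure, ENNReal.toReal_ofReal (pow_nonneg h0 _)] at h
  exact h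

end Resolvent

/-! ### The state-action chain and the one- and two-time laws of a trajectory. -/

variable {d : ℕ} {S A : Type*} [MeasurableSpace S] [MeasurableSpace A] {ν : Measure A}
  [SigmaFinite ν]

/-- The policy `π_θ` as a Markov kernel from states to actions. -/
def PolicyFamily.policy (π : PolicyFamily d S ν) (θ : Param d) : Kernel S A :=
  π.kernel.comap (fun s => (θ, s)) (by fun_prop)

instance PolicyFamily.isMarkovKernel_policy (π : PolicyFamily d S ν) (θ : Param d) :
    IsMarkovKernel (π.policy θ) := by unfold policy; infer_instance

theorem PolicyFamily.policy_apply (π : PolicyFamily d S ν) (θ : Param d) (s : S) :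
    π.policy θ s = ν.withDensity fun a => ENNReal.ofReal (π.dens θ s a) := by
  rw [policy, Kernel.comap_apply, kernel, Kernel.withDensity_apply _ π.measurable_kernel_dens]
  simp

/-- Attach an action drawn from `π_θ` to a state. -/
def PolicyFamily.act (π : PolicyFamily d S ν) (θ : Param d) : Kernel S (S × A) :=
  Kernel.id ×ₖ π.policy θ

instance PolicyFamily.isMarkovKernel_act (π : PolicyFamily d S ν) (θ : Param d) :
    IsMarkovKernel (π.act θ) := by unfold act; infer_instance

theorem PolicyFamily.lintegral_act (π : PolicyFamily d S ν) (θ : Param d) (s : S)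
    {f : S × A → ℝ≥0∞} (hf : Measurable f) :
    ∫⁻ x, f x ∂π.act θ s = ∫⁻ a, f (s, a) ∂π.policy θ s := by
  rw [act, Kernel.lintegral_id_prod hf]

theorem PolicyFamily.act_apply (π : PolicyFamily d S ν) (θ : Param d) (s : S) :
    π.act θ s = (π.policy θ s).map fun a => (s, a) := by
  refine Measure.ext_of_lintegral _ fun f hf => ?_
  rw [π.lintegral_act θ s hf, lintegral_map hf (by fun_prop)]

theorem PolicyFamily.integral_act (π : PolicyFamily d S ν) (θ : Param d) (s : S)
    {E : Type*} [NormedAddCommGroup E] [NormedSpace ℝ E]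
    {f : S × A → E} (hf : StronglyMeasurable f) :
    ∫ x, f x ∂π.act θ s = ∫ a, f (s, a) ∂π.policy θ s := by
  rw [π.act_apply, integral_map (by fun_prop) hf.aestronglyMeasurable]

namespace MDP

variable (M : MDP S A) (π : PolicyFamily d S ν) (θ : Param d)

/-- The transition kernel of the state-action chain under `π_θ`. -/
def chain : Kernel (S × A) (S × A) := π.act θ ∘ₖ M.trans

/-- The transition kernel of the state chain under `π_θ`. -/
def stateChain : Kernel S S := M.trans ∘ₖ π.act θ

instance isMarkovKernel_chain : IsMarkovKernel (M.chain π θ) := by unfold chain; infer_instance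

instance isMarkovKernel_stateChain : IsMarkovKernel (M.stateChain π θ) := by
  unfold stateChain; infer_instance

/-- Both sides are the same alternating product of `act` and `trans`. With `act` outermost, the
action at time t is drawn from π_θ given the state, so a bound valid under π_θ(· | s) for every s
holds at every time. -/
theorem chain_pow_comp_act (t : ℕ) :
    (M.chain π θ ^ t) ∘ₖ π.act θ = π.act θ ∘ₖ (M.stateChain π θ ^ t) := by
  induction t with
  | zero => exact (Kernel.id_comp _).trans (Kernel.comp_id _).symm
  | succ t ih =>
    have h1 : M.chain π θ ^ (t + 1) = (M.chain π θ) ∘ₖ (M.chain π θ ^ t) := pow_succ' _ _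
    have h2 : M.stateChain π θ ^ (t + 1) = (M.stateChain π θ) ∘ₖ (M.stateChain π θ ^ t) :=
      pow_succ' _ _
    rw [h1, h2, Kernel.comp_assoc, ih, chain, stateChain, Kernel.comp_assoc, Kernel.comp_assoc]

theorem lintegral_step (z : Param d × S × A) {f : S × A → ℝ≥0∞} (hf : Measurable f) :
    ∫⁻ y, f y.2 ∂M.step π z = ∫⁻ x, f x ∂M.chain π z.1 z.2 := by
  rw [step, Kernel.lintegral_deterministic_prod _ _ _ (by fun_prop),
    Kernel.lintegral_compProd _ _ _ (by fun_prop), chain, Kernel.lintegral_comp _ _ _ hf]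
  simp only [Kernel.comap_apply]
  refine lintegral_congr fun s => ?_
  rw [π.lintegral_act _ _ hf]
  rfl

theorem map_fst_step (z : Param d × S × A) : (M.step π z).map Prod.fst = Measure.dirac z.1 := by
  refine Measure.ext_of_lintegral _ fun f hf => ?_
  rw [lintegral_map hf measurable_fst, step,
    Kernel.lintegral_deterministic_prod _ _ _ (by fun_prop)]
  simp [lintegral_dirac' _ hf]

/-- The law of the trajectory together with the parameter that the chain carries along. -/
def paramTrajectory (s : S) : Measure (ℕ → Param d × S × A) :=
  Kernel.trajMeasure (X := fun _ : ℕ => Param d × S × A) (start π s θ)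
    fun n => (M.step π).comap (fun h => h ⟨n, Finset.mem_Iic.2 le_rfl⟩) (measurable_pi_apply _)

theorem trajectory_eq_map (s : S) :
    M.trajectory π s θ = (M.paramTrajectory π θ s).map fun ω n => (ω n).2 := by
  rw [trajectory, Kernel.map_apply _ (by fun_prop), Kernel.comp_apply,
    Kernel.map_apply _ (by fun_prop), paramTrajectory, Kernel.trajMeasure]
  rfl

/-- The Markov property of the Ionescu-Tulcea measure, for test functions that may see the whole
past. -/
theorem paramTrajectory_succ (s : S) (n : ℕ) {f : (Finset.Iic n → Param d × S × A) →
    Param d × S × A → ℝ≥0∞} (hf : Measurable (Function.uncurry f)) :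
    ∫⁻ ω, f (Preorder.frestrictLe n ω) (ω (n + 1)) ∂M.paramTrajectory π θ s =
      ∫⁻ ω, ∫⁻ y, f (Preorder.frestrictLe n ω) y ∂M.step π (ω n) ∂M.paramTrajectory π θ s := by
  have h := Kernel.map_frestrictLe_trajMeasure_compProd_eq_map_trajMeasure
    (X := fun _ : ℕ => Param d × S × A) (μ₀ := start π s θ) (a := n)
    (κ := fun n => (M.step π).comap (fun h => h ⟨n, Finset.mem_Iic.2 le_rfl⟩)
      (measurable_pi_apply _))
  have h' := congrArg (fun μ => ∫⁻ p, Function.uncurry f p ∂μ) h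
  beta_reduce at h'
  rw [lintegral_map hf (by fun_prop), Measure.lintegral_compProd hf, lintegral_map] at h'
  · exact h'.symm
  · exact hf.lintegral_kernel_prod_right
  · fun_prop

theorem map_zero_paramTrajectory (s : S) :
    (M.paramTrajectory π θ s).map (fun ω => ω 0) = start π s θ := by
  have h := Kernel.traj_map_frestrictLe (X := fun _ : ℕ => Param d × S × A)
    (κ := fun n => (M.step π).comap (fun h => h ⟨n, Finset.mem_Iic.2 le_rfl⟩)
      (measurable_pi_apply _)) 0 0
  have e : (fun ω : ℕ → Param d × S × A => ω 0) =
    (fun h : Finset.Iic 0 → Param d × S × A => h ⟨0, Finset.mem_Iic.2 le_rfl⟩) ∘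
      Preorder.frestrictLe 0 := rfl
  rw [e, ← Measure.map_map (by fun_prop) (by fun_prop), paramTrajectory, Kernel.trajMeasure,
    Measure.map_comp _ _ (by fun_prop), h, Kernel.partialTraj_self]
  rw [show ((start π s θ).map (MeasurableEquiv.piUnique _).symm).bind
      (Kernel.id : Kernel (Finset.Iic 0 → Param d × S × A) (Finset.Iic 0 → Param d × S × A)) =
      (start π s θ).map (MeasurableEquiv.piUnique _).symm from Measure.bind_dirac]
  rw [Measure.map_map (by fun_prop) (by fun_prop)]
  exact Measure.map_id

/-- Each step copies the parameter, so its law stays the Dirac mass at θ. Hence `step` may be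
replaced by `chain π θ` along almost every path. -/
theorem ae_fst_paramTrajectory (s : S) (n : ℕ) :
    ∀ᵐ ω ∂M.paramTrajectory π θ s, (ω n).1 = θ := by
  suffices h : (M.paramTrajectory π θ s).map (fun ω => (ω n).1) = Measure.dirac θ by
    have h' : ∀ᵐ x ∂(M.paramTrajectory π θ s).map (fun ω => (ω n).1), x = θ := by
      rw [h, ae_dirac_iff (measurableSet_eq)]
    exact ae_of_ae_map (Measurable.aemeasurable (by fun_prop)) h'
  induction n with
  | zero =>
    have e : (fun ω : ℕ → Param d × S × A => (ω 0).1) = Prod.fst ∘ fun ω => ω 0 := rfl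
    rw [e, ← Measure.map_map (by fun_prop) (by fun_prop), map_zero_paramTrajectory]
    refine Measure.ext_of_lintegral _ fun f hf => ?_
    rw [lintegral_map hf measurable_fst, start,
      Kernel.lintegral_deterministic_prod _ _ _ (by fun_prop)]
    simp [lintegral_dirac' _ hf]
  | succ n ih =>
    refine Measure.ext_of_lintegral _ fun f hf => ?_
    rw [lintegral_map hf (by fun_prop), ← ih, lintegral_map hf (by fun_prop)]
    rw [M.paramTrajectory_succ π θ s n (f := fun _ y => f y.1) (by fun_prop)]
    refine lintegral_congr fun ω => ?_
    rw [← lintegral_map (μ := M.step π (ω n)) hf measurable_fst, map_fst_step,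
      lintegral_dirac' _ hf]

theorem map_zero_trajectory (s : S) :
    (M.trajectory π s θ).map (fun ω => ω 0) = π.act θ s := by
  rw [trajectory_eq_map, Measure.map_map (by fun_prop) (by fun_prop)]
  have e : (fun ω : ℕ → S × A => ω 0) ∘ (fun (ω : ℕ → Param d × S × A) n => (ω n).2) =
    Prod.snd ∘ fun ω => ω 0 := rfl
  rw [e, ← Measure.map_map (by fun_prop) (by fun_prop), map_zero_paramTrajectory]
  refine Measure.ext_of_lintegral _ fun f hf => ?_
  rw [lintegral_map hf measurable_snd, start,
    Kernel.lintegral_deterministic_prod _ _ _ (by fun_prop),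
    Kernel.lintegral_deterministic_prod _ _ _ (by fun_prop), π.lintegral_act θ s hf]
  rfl

theorem measurable_lintegral_chain {f : (S × A) × (S × A) → ℝ≥0∞} (hf : Measurable f) :
    Measurable fun p : (S × A) × (S × A) => ∫⁻ y, f (p.1, y) ∂M.chain π θ p.2 := by
  exact Measurable.lintegral_kernel_prod_right' (κ := (M.chain π θ).comap Prod.snd measurable_snd)
    (f := fun q : ((S × A) × (S × A)) × (S × A) => f (q.1.1, q.2)) (by fun_prop)

theorem lintegral_trajectory (s : S) {f : (ℕ → S × A) → ℝ≥0∞} (hf : Measurable f) :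
    ∫⁻ ω, f ω ∂M.trajectory π s θ = ∫⁻ ω, f (fun n => (ω n).2) ∂M.paramTrajectory π θ s := by
  rw [trajectory_eq_map, lintegral_map hf (by fun_prop)]

theorem lintegral_trajectory_succ (s : S) {τ n : ℕ} (hτ : τ ≤ n)
    {f : (S × A) × (S × A) → ℝ≥0∞} (hf : Measurable f) :
    ∫⁻ ω, f (ω τ, ω (n + 1)) ∂M.trajectory π s θ =
      ∫⁻ ω, ∫⁻ y, f (ω τ, y) ∂M.chain π θ (ω n) ∂M.trajectory π s θ := by
  have hm : Measurable fun ω : ℕ → S × A => ∫⁻ y, f (ω τ, y) ∂M.chain π θ (ω n) :=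
    Measurable.comp (g := fun p : (S × A) × (S × A) => ∫⁻ y, f (p.1, y) ∂M.chain π θ p.2)
      (f := fun ω : ℕ → S × A => (ω τ, ω n)) (M.measurable_lintegral_chain π θ hf)
      (Measurable.prodMk (measurable_pi_apply τ) (measurable_pi_apply n))
  have hl : Measurable fun ω : ℕ → S × A => f (ω τ, ω (n + 1)) :=
    hf.comp ((measurable_pi_apply τ).prodMk (measurable_pi_apply (n + 1)))
  rw [lintegral_trajectory M π θ s hl, lintegral_trajectory M π θ s hm]
  obtain ⟨i, hi⟩ : ∃ i : Finset.Iic n, (i : ℕ) = τ := ⟨⟨τ, Finset.mem_Iic.2 hτ⟩, rfl⟩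
  subst hi
  have hg : Measurable fun h : Finset.Iic n → Param d × S × A => (h i).2 :=
    measurable_snd.comp (measurable_pi_apply i)
  have hu : Measurable (Function.uncurry
      fun (h : Finset.Iic n → Param d × S × A) (y : Param d × S × A) => f ((h i).2, y.2)) :=
    hf.comp ((hg.comp measurable_fst).prodMk (measurable_snd.comp measurable_snd))
  refine (M.paramTrajectory_succ π θ s n hu).trans (lintegral_congr_ae ?_)
  filter_upwards [M.ae_fst_paramTrajectory π θ s n] with ω hω
  have h := M.lintegral_step π (ω n) (f := fun y => f ((ω i).2, y))
    (hf.comp measurable_prodMk_left)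
  rw [hω] at h
  exact h

/-- Induction on the lag j by the one-step Markov property. Two-time laws suffice for the gradient
estimate, because each of its terms pairs one reward with one score at the same or an earlier time.
-/
theorem map_pair_trajectory (s : S) (τ j : ℕ) :
    (M.trajectory π s θ).map (fun ω => (ω τ, ω (τ + j))) =
      ((M.trajectory π s θ).map fun ω => ω τ) ⊗ₘ (M.chain π θ ^ j) := by
  induction j with
  | zero =>
    refine Measure.ext_of_lintegral _ fun f hf => ?_
    rw [Measure.lintegral_compProd hf, lintegral_map hf (by fun_prop),
      lintegral_map (hf.lintegral_kernel_prod_right') (by fun_prop)]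
    refine lintegral_congr fun ω => ?_
    exact (Kernel.lintegral_id' (f := fun y => f (ω τ, y)) (by fun_prop) (ω τ)).symm
  | succ j ih =>
    refine Measure.ext_of_lintegral _ fun f hf => ?_
    have hm := M.measurable_lintegral_chain π θ hf
    have h := congrArg (fun μ => ∫⁻ p, ∫⁻ y, f (p.1, y) ∂M.chain π θ p.2 ∂μ) ih
    beta_reduce at h
    rw [lintegral_map hm (by fun_prop), Measure.lintegral_compProd hm] at h
    rw [lintegral_map hf (by fun_prop), Measure.lintegral_compProd hf]
    rw [← add_assoc, M.lintegral_trajectory_succ π θ s (Nat.le_add_right τ j) hf, h]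
    refine lintegral_congr fun x => ?_
    rw [pow_succ']
    exact (Kernel.lintegral_comp (M.chain π θ) (M.chain π θ ^ j) x
      (by fun_prop : Measurable fun y => f (x, y))).symm

theorem map_trajectory (s : S) (t : ℕ) :
    (M.trajectory π s θ).map (fun ω => ω t) = (π.act θ ∘ₖ (M.stateChain π θ ^ t)) s := by
  have h := congrArg Measure.snd (M.map_pair_trajectory π θ s 0 t)
  rw [Measure.snd_compProd, map_zero_trajectory, Measure.snd,
    Measure.map_map (by fun_prop) (by fun_prop)] at h
  rw [← chain_pow_comp_act, Kernel.comp_apply, ← h]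
  simp [Function.comp_def]

end MDP

end HPG

/-! ### Regularity of the policies in the parameter, in total variation. -/

namespace HPG

open Filter Topology InnerProductSpace

section Moments

variable {X : Type*} [MeasurableSpace X]

theorem lintegral_enorm_le_sqrt {E : Type*} [NormedAddCommGroup E] {μ : Measure X}
    [IsProbabilityMeasure μ] {f : X → E} (hf : AEStronglyMeasurable f μ) {C : ℝ}
    (h : ∫⁻ x, ‖f x‖ₑ ^ 2 ∂μ ≤ ENNReal.ofReal C) :
    ∫⁻ x, ‖f x‖ₑ ∂μ ≤ ENNReal.ofReal (Real.sqrt C) := by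
  have h1 := eLpNorm_le_eLpNorm_of_exponent_le (μ := μ) (p := 1) (q := 2) (by norm_num) hf
  rw [eLpNorm_one_eq_lintegral_enorm] at h1
  refine h1.trans ?_
  rw [eLpNorm_eq_lintegral_rpow_enorm_toReal (by norm_num) (by norm_num)]
  simp only [ENNReal.toReal_ofNat, ENNReal.rpow_ofNat]
  rw [Real.sqrt_eq_rpow]
  by_cases hC : 0 ≤ C
  · rw [← ENNReal.ofReal_rpow_of_nonneg hC (by norm_num)]
    exact ENNReal.rpow_le_rpow h (by norm_num)
  · rw [ENNReal.ofReal_of_nonpos (not_le.1 hC).le, nonpos_iff_eq_zero] at h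
    simp [h]

theorem norm_integral_le_of_lintegral_le {E : Type*} [NormedAddCommGroup E] [NormedSpace ℝ E]
    {μ : Measure X} {f : X → E} {c : ℝ} (hc : 0 ≤ c)
    (h : ∫⁻ x, ‖f x‖ₑ ∂μ ≤ ENNReal.ofReal c) : ‖∫ x, f x ∂μ‖ ≤ c := by
  have h1 := (enorm_integral_le_lintegral_enorm (μ := μ) f).trans h
  rwa [← ofReal_norm, ENNReal.ofReal_le_ofReal_iff hc] at h1

/-- The fundamental theorem of calculus for each x, followed by Tonelli. An L¹ bound at each fixed t
is enough: no domination uniform in t is required, hence no supremum of the score along a segment.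
-/
theorem lintegral_enorm_sub_le_of_hasDerivAt {μ : Measure X} [SigmaFinite μ] {φ φ' : X → ℝ → ℝ}
    {c : X → ℝ} (hφ : ∀ x t, HasDerivAt (φ x) (φ' x t) t) (hcont : ∀ x, Continuous (φ' x))
    (hm : Measurable fun p : X × ℝ => φ' p.1 p.2) (hc : Measurable c) {w : ℝ≥0∞}
    (hw : ∀ t ∈ Set.Icc (0 : ℝ) 1, ∫⁻ x, ‖φ' x t - c x‖ₑ ∂μ ≤ w) :
    ∫⁻ x, ‖φ x 1 - φ x 0 - c x‖ₑ ∂μ ≤ w := by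
  have hpt : ∀ x, ‖φ x 1 - φ x 0 - c x‖ₑ ≤ ∫⁻ t in Set.Ioc (0 : ℝ) 1, ‖φ' x t - c x‖ₑ := by
    intro x
    have h1 : ∫ t in (0 : ℝ)..1, (φ' x t - c x) = φ x 1 - φ x 0 - c x := by
      rw [intervalIntegral.integral_sub ((hcont x).intervalIntegrable _ _) (by simp),
        intervalIntegral.integral_eq_sub_of_hasDerivAt (fun t _ => hφ x t)
          ((hcont x).intervalIntegrable _ _)]
      simp
    rw [← h1, intervalIntegral.integral_of_le zero_le_one]
    exact enorm_integral_le_lintegral_enorm _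
  have hm' : Measurable fun p : X × ℝ => ‖φ' p.1 p.2 - c p.1‖ₑ :=
    (hm.sub (hc.comp measurable_fst)).enorm
  calc ∫⁻ x, ‖φ x 1 - φ x 0 - c x‖ₑ ∂μ
      ≤ ∫⁻ x, (∫⁻ t in Set.Ioc (0 : ℝ) 1, ‖φ' x t - c x‖ₑ) ∂μ := lintegral_mono hpt
    _ = ∫⁻ t in Set.Ioc (0 : ℝ) 1, ∫⁻ x, ‖φ' x t - c x‖ₑ ∂μ :=
        lintegral_lintegral_swap hm'.aemeasurable
    _ ≤ ∫⁻ _ in Set.Ioc (0 : ℝ) 1, w :=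
        setLIntegral_mono measurable_const fun t ht => hw t ⟨ht.1.le, ht.2⟩
    _ = w := by simp

end Moments

variable {d : ℕ} {S A : Type*} [MeasurableSpace S] [MeasurableSpace A] {ν : Measure A}

namespace PolicyFamily

theorem inner_score (π : PolicyFamily d S ν) (θ v : Param d) (s : S) (a : A) :
    ⟪π.score θ s a, v⟫_ℝ = fderiv ℝ (fun θ' => Real.log (π.dens θ' s a)) θ v := by
  rw [score, gradient, toDual_symm_apply]

/-- Joint measurability is not contained in differentiability for each (s, a); it is obtained by
writing the derivative as a limit of difference quotients with increments v/n. -/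
theorem measurable_inner_score (π : PolicyFamily d S ν) (v : Param d) :
    Measurable fun p : Param d × S × A => ⟪π.score p.1 p.2.1 p.2.2, v⟫_ℝ := by
  have hlog : Measurable fun p : Param d × S × A => Real.log (π.dens p.1 p.2.1 p.2.2) :=
    Real.measurable_log.comp π.measurable_dens
  refine measurable_of_tendsto_metrizable (f := fun (n : ℕ) (p : Param d × S × A) =>
    (n : ℝ) • (Real.log (π.dens (p.1 + (n : ℝ)⁻¹ • v) p.2.1 p.2.2) -
      Real.log (π.dens p.1 p.2.1 p.2.2))) (fun n => ?_) ?_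
  · have h1 : Measurable fun p : Param d × S × A => (p.1 + (n : ℝ)⁻¹ • v, p.2) := by fun_prop
    exact ((hlog.comp h1).sub hlog).const_smul (n : ℝ)
  · rw [tendsto_pi_nhds]
    intro p
    rw [π.inner_score]
    refine HasFDerivAt.lim (c := fun n : ℕ => (n : ℝ)) (f := fun θ' => Real.log (π.dens θ' p.2.1 p.2.2))
      ((π.differentiable_log p.2.1 p.2.2).differentiableAt.hasFDerivAt) v ?_
    simpa using tendsto_natCast_atTop_atTop (R := ℝ)

theorem measurable_score (π : PolicyFamily d S ν) :
    Measurable fun p : Param d × S × A => π.score p.1 p.2.1 p.2.2 := by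
  let b := EuclideanSpace.basisFun (Fin d) ℝ
  have h : (fun p : Param d × S × A => π.score p.1 p.2.1 p.2.2) =
      fun p => ∑ i, ⟪π.score p.1 p.2.1 p.2.2, b i⟫_ℝ • b i := by
    funext p
    conv_lhs => rw [← b.sum_repr' (π.score p.1 p.2.1 p.2.2)]
    exact Finset.sum_congr rfl fun i _ => by rw [real_inner_comm]
  rw [h]
  exact Finset.measurable_sum _ fun i _ => (π.measurable_inner_score (b i)).smul_const (b i)

theorem measurable_score_apply (π : PolicyFamily d S ν) (θ : Param d) :
    Measurable fun x : S × A => π.score θ x.1 x.2 :=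
  π.measurable_score.comp (measurable_const.prodMk measurable_id)

theorem measurable_score_action (π : PolicyFamily d S ν) (θ : Param d) (s : S) :
    Measurable fun a : A => π.score θ s a :=
  (π.measurable_score_apply θ).comp measurable_prodMk_left

theorem measurable_dens_action (π : PolicyFamily d S ν) (θ : Param d) (s : S) :
    Measurable fun a : A => π.dens θ s a :=
  π.measurable_dens.comp (measurable_const.prodMk measurable_prodMk_left)

/-- The log-derivative trick: differentiate exp(log π), legitimate since π > 0. -/
theorem hasDerivAt_dens (π : PolicyFamily d S ν) (θ δ : Param d) (s : S) (a : A) (t : ℝ) :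
    HasDerivAt (fun t : ℝ => π.dens (θ + t • δ) s a)
      (π.dens (θ + t • δ) s a * ⟪π.score (θ + t • δ) s a, δ⟫_ℝ) t := by
  have h1 : HasDerivAt (fun t : ℝ => θ + t • δ) δ t := by
    simpa using ((hasDerivAt_id t).smul_const δ).const_add θ
  have h2 := ((π.differentiable_log s a).differentiableAt
    (x := θ + t • δ)).hasFDerivAt.comp_hasDerivAt t h1
  have h3 := h2.exp
  rw [π.inner_score]
  simpa only [Function.comp_def, Real.exp_log (π.dens_pos _ s a)] using h3

theorem continuous_dens (π : PolicyFamily d S ν) (s : S) (a : A) :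
    Continuous fun θ => π.dens θ s a := by
  have h := Real.continuous_exp.comp (π.differentiable_log s a).continuous
  simpa only [Function.comp_def, Real.exp_log (π.dens_pos _ s a)] using h

/-- The assumptions on the score function: a bound for its second moments and Hölder continuity
in the parameter. -/
structure RegularScore (π : PolicyFamily d S ν) (B Mh β : ℝ) : Prop where
  B_nonneg : 0 ≤ B
  second_moment : ∀ θ s, ∫⁻ a, ‖π.score θ s a‖ₑ ^ 2 * ENNReal.ofReal (π.dens θ s a) ∂ν
      ≤ ENNReal.ofReal B
  Mh_pos : 0 < Mh
  β_pos : 0 < β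
  β_le_one : β ≤ 1
  holder : ∀ θ₁ θ₂ s a, ‖π.score θ₁ s a - π.score θ₂ s a‖ ≤ Mh * ‖θ₁ - θ₂‖ ^ β

variable {π : PolicyFamily d S ν} {B Mh β : ℝ}

theorem RegularScore.continuous_score (h : π.RegularScore B Mh β) (s : S) (a : A) :
    Continuous fun θ => π.score θ s a := by
  rw [continuous_iff_continuousAt]
  intro θ
  rw [ContinuousAt, tendsto_iff_norm_sub_tendsto_zero]
  refine squeeze_zero (fun _ => norm_nonneg _) (fun θ' => h.holder θ' θ s a) ?_
  have h1 : Continuous fun θ' => Mh * ‖θ' - θ‖ ^ β :=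
    continuous_const.mul ((continuous_id.sub continuous_const).norm.rpow_const
      fun _ => Or.inr h.β_pos.le)
  simpa [Real.zero_rpow h.β_pos.ne'] using h1.tendsto θ

theorem lintegral_ofReal_dens_mul (π : PolicyFamily d S ν) (θ : Param d) (s : S) (c : ℝ≥0∞) :
    ∫⁻ a, c * ENNReal.ofReal (π.dens θ s a) ∂ν = c := by
  rw [lintegral_const_mul _ (π.measurable_dens_action θ s).ennreal_ofReal, π.lintegral_dens,
    mul_one]

theorem RegularScore.norm_score_sub_le (h : π.RegularScore B Mh β) {θ₁ θ₂ : Param d} {r : ℝ}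
    (hr : ‖θ₂ - θ₁‖ ≤ r) (s : S) (a : A) :
    ‖π.score θ₂ s a - π.score θ₁ s a‖ ≤ Mh * r ^ β :=
  (h.holder θ₂ θ₁ s a).trans (mul_le_mul_of_nonneg_left
    (Real.rpow_le_rpow (norm_nonneg _) hr h.β_pos.le) h.Mh_pos.le)

/-- A modulus of continuity of `θ ↦ π_θ(· | s) ∇ log π_θ(· | s)` in `L¹`. -/
def scoreModulus (B Mh β r : ℝ) : ℝ :=
  Mh * r ^ β + Real.sqrt r * (Real.sqrt B + 3 * B + 2 * Mh ^ 2)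

theorem RegularScore.scoreModulus_nonneg (h : π.RegularScore B Mh β) {r : ℝ} (hr : 0 ≤ r) :
    0 ≤ scoreModulus B Mh β r := by
  have := h.B_nonneg
  have := h.Mh_pos
  unfold scoreModulus
  positivity

theorem enorm_inner_le (x y : Param d) : ‖⟪x, y⟫_ℝ‖ₑ ≤ ‖x‖ₑ * ‖y‖ₑ := by
  rw [← ofReal_norm, ← ofReal_norm, ← ofReal_norm,
    ← ENNReal.ofReal_mul (norm_nonneg _)]
  exact ENNReal.ofReal_le_ofReal (norm_inner_le_norm x y)

theorem nonempty_action (π : PolicyFamily d S ν) (s : S) : Nonempty A := by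
  by_contra hne
  rw [not_nonempty_iff] at hne
  simpa using π.lintegral_dens 0 s

variable [SigmaFinite ν]

theorem lintegral_policy (π : PolicyFamily d S ν) (θ : Param d) (s : S) {f : A → ℝ≥0∞}
    (hf : Measurable f) :
    ∫⁻ a, f a ∂π.policy θ s = ∫⁻ a, f a * ENNReal.ofReal (π.dens θ s a) ∂ν := by
  rw [policy_apply, lintegral_withDensity_eq_lintegral_mul _
    (π.measurable_dens_action θ s).ennreal_ofReal hf]
  simp [mul_comm]

theorem integral_policy (π : PolicyFamily d S ν) (θ : Param d) (s : S)
    {E : Type*} [NormedAddCommGroup E] [NormedSpace ℝ E] (f : A → E) :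
    ∫ a, f a ∂π.policy θ s = ∫ a, π.dens θ s a • f a ∂ν := by
  rw [policy_apply, integral_withDensity_eq_integral_toReal_smul
    (π.measurable_dens_action θ s).ennreal_ofReal (by simp)]
  simp [ENNReal.toReal_ofReal (π.dens_pos θ s _).le]

theorem integrable_policy_iff (π : PolicyFamily d S ν) (θ : Param d) (s : S)
    {E : Type*} [NormedAddCommGroup E] [NormedSpace ℝ E] (f : A → E) :
    Integrable f (π.policy θ s) ↔ Integrable (fun a => π.dens θ s a • f a) ν := by
  rw [policy_apply, integrable_withDensity_iff_integrable_smul'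
    (π.measurable_dens_action θ s).ennreal_ofReal (by simp)]
  simp [ENNReal.toReal_ofReal (π.dens_pos θ s _).le]

theorem RegularScore.lintegral_score_sq_le (h : π.RegularScore B Mh β) (θ : Param d) (s : S) :
    ∫⁻ a, ‖π.score θ s a‖ₑ ^ 2 ∂π.policy θ s ≤ ENNReal.ofReal B := by
  rw [π.lintegral_policy θ s ((π.measurable_score_action θ s).enorm.pow_const 2)]
  exact h.second_moment θ s

theorem RegularScore.lintegral_score_le (h : π.RegularScore B Mh β) (θ : Param d) (s : S) :
    ∫⁻ a, ‖π.score θ s a‖ₑ ∂π.policy θ s ≤ ENNReal.ofReal (Real.sqrt B) :=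
  lintegral_enorm_le_sqrt (π.measurable_score_action θ s).aestronglyMeasurable
    (h.lintegral_score_sq_le θ s)

/-- The function c is a candidate for the increment. Taking c = 0 yields the Lipschitz bound in
total variation, and c = π_θ ⟨score, δ⟩ the first order expansion. -/
theorem RegularScore.lintegral_dens_add_sub_sub_le (h : π.RegularScore B Mh β) (θ δ : Param d)
    (s : S) {c : A → ℝ} (hc : Measurable c) {w : ℝ≥0∞}
    (hw : ∀ t ∈ Set.Icc (0 : ℝ) 1,
      ∫⁻ a, ‖π.dens (θ + t • δ) s a * ⟪π.score (θ + t • δ) s a, δ⟫_ℝ - c a‖ₑ ∂ν ≤ w) :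
    ∫⁻ a, ‖π.dens (θ + δ) s a - π.dens θ s a - c a‖ₑ ∂ν ≤ w := by
  have hline : Continuous fun t : ℝ => θ + t • δ := by fun_prop
  have hp : Measurable fun p : A × ℝ => (θ + p.2 • δ, s, p.1) :=
    (hline.measurable.comp measurable_snd).prodMk (measurable_const.prodMk measurable_fst)
  have hcont : ∀ a, Continuous fun t : ℝ => π.dens (θ + t • δ) s a *
      ⟪π.score (θ + t • δ) s a, δ⟫_ℝ := fun a => by
    have h1 := (π.continuous_dens s a).comp hline
    have h2 := (h.continuous_score s a).comp hline
    exact h1.mul (h2.inner continuous_const)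
  have hmeas : Measurable fun p : A × ℝ => π.dens (θ + p.2 • δ) s p.1 *
      ⟪π.score (θ + p.2 • δ) s p.1, δ⟫_ℝ := by
    have h1 := π.measurable_dens.comp hp
    have h2 := (π.measurable_inner_score δ).comp hp
    exact h1.mul h2
  have := lintegral_enorm_sub_le_of_hasDerivAt (μ := ν)
    (φ := fun a t => π.dens (θ + t • δ) s a)
    (φ' := fun a t => π.dens (θ + t • δ) s a * ⟪π.score (θ + t • δ) s a, δ⟫_ℝ) (c := c)
    (fun a t => π.hasDerivAt_dens θ δ s a t) hcont hmeas hc hw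
  simpa only [one_smul, zero_smul, add_zero] using this

theorem RegularScore.lintegral_dens_sub_sub_le (h : π.RegularScore B Mh β) (θ₁ θ₂ : Param d)
    (s : S) {c : A → ℝ} (hc : Measurable c) {w : ℝ≥0∞}
    (hw : ∀ t ∈ Set.Icc (0 : ℝ) 1, ∫⁻ a, ‖π.dens (θ₁ + t • (θ₂ - θ₁)) s a *
      ⟪π.score (θ₁ + t • (θ₂ - θ₁)) s a, θ₂ - θ₁⟫_ℝ - c a‖ₑ ∂ν ≤ w) :
    ∫⁻ a, ‖π.dens θ₂ s a - π.dens θ₁ s a - c a‖ₑ ∂ν ≤ w := by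
  have := h.lintegral_dens_add_sub_sub_le θ₁ (θ₂ - θ₁) s hc hw
  rwa [add_sub_cancel] at this

/-- The policies are Lipschitz in total variation. -/
theorem RegularScore.lintegral_dens_sub_le (h : π.RegularScore B Mh β) (θ₁ θ₂ : Param d) (s : S) :
    ∫⁻ a, ‖π.dens θ₂ s a - π.dens θ₁ s a‖ₑ ∂ν ≤
      ENNReal.ofReal (Real.sqrt B * ‖θ₂ - θ₁‖) := by
  have := h.lintegral_dens_sub_sub_le θ₁ θ₂ s (c := fun _ => 0) measurable_const
    (w := ENNReal.ofReal (Real.sqrt B * ‖θ₂ - θ₁‖)) fun t _ => ?_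
  · simpa using this
  set θ := θ₁ + t • (θ₂ - θ₁)
  calc ∫⁻ a, ‖π.dens θ s a * ⟪π.score θ s a, θ₂ - θ₁⟫_ℝ - 0‖ₑ ∂ν
      ≤ ∫⁻ a, (‖π.score θ s a‖ₑ * ENNReal.ofReal (π.dens θ s a)) * ‖θ₂ - θ₁‖ₑ ∂ν := by
        refine lintegral_mono fun a => ?_
        rw [sub_zero, enorm_mul, Real.enorm_of_nonneg (π.dens_pos θ s a).le, mul_comm, mul_right_comm]
        gcongr
        exact enorm_inner_le _ _
    _ = (∫⁻ a, ‖π.score θ s a‖ₑ ∂π.policy θ s) * ‖θ₂ - θ₁‖ₑ := by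
        rw [π.lintegral_policy θ s (π.measurable_score_action θ s).enorm, lintegral_mul_const]
        exact (π.measurable_score_action θ s).enorm.mul
          (π.measurable_dens_action θ s).ennreal_ofReal
    _ ≤ _ := by
        rw [ENNReal.ofReal_mul (Real.sqrt_nonneg _), ofReal_norm]
        gcongr
        exact h.lintegral_score_le θ s

/-- The score is not bounded, so the total variation bound cannot be multiplied by a supremum.
Instead x ≤ 1/q + q x² with q = √r: the part 1/q meets a total variation of at most √B r and leaves
√B √r, while q x² is integrated against π₁ + π₂. Under π₂ the score of θ₁ is first replaced by that
of θ₂, through x² ≤ 2y² + 2 Mh²; this uses r ≤ 1 and accounts for 3B + 2 Mh². -/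
theorem RegularScore.lintegral_score_mul_dens_sub_le (h : π.RegularScore B Mh β)
    {θ₁ θ₂ : Param d} {r : ℝ} (hr0 : 0 < r) (hr1 : r ≤ 1) (hr : ‖θ₂ - θ₁‖ ≤ r) (s : S) :
    ∫⁻ a, ‖π.score θ₁ s a‖ₑ * ‖π.dens θ₂ s a - π.dens θ₁ s a‖ₑ ∂ν ≤
      ENNReal.ofReal (Real.sqrt r * (Real.sqrt B + 3 * B + 2 * Mh ^ 2)) := by
  have hB := h.B_nonneg
  have hM := h.Mh_pos
  set q := Real.sqrt r
  have hq : 0 < q := Real.sqrt_pos.2 hr0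
  have hqr : q * q = r := Real.mul_self_sqrt hr0.le
  have hpt : ∀ a, ‖π.score θ₁ s a‖ₑ * ‖π.dens θ₂ s a - π.dens θ₁ s a‖ₑ ≤
      ENNReal.ofReal q⁻¹ * ‖π.dens θ₂ s a - π.dens θ₁ s a‖ₑ +
      (ENNReal.ofReal q * (‖π.score θ₁ s a‖ₑ ^ 2 * ENNReal.ofReal (π.dens θ₁ s a)) +
      (ENNReal.ofReal (2 * q) * (‖π.score θ₂ s a‖ₑ ^ 2 * ENNReal.ofReal (π.dens θ₂ s a)) +
        ENNReal.ofReal (2 * q * Mh ^ 2) * ENNReal.ofReal (π.dens θ₂ s a))) := by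
    intro a
    have h1 := π.dens_pos θ₁ s a
    have h2 := π.dens_pos θ₂ s a
    set p₁ := π.dens θ₁ s a
    set p₂ := π.dens θ₂ s a
    have hs : ‖π.score θ₁ s a‖ ≤ ‖π.score θ₂ s a‖ + Mh := by
      have e1 := h.norm_score_sub_le (hr.trans hr1) s a
      rw [Real.one_rpow, mul_one] at e1
      have e2 := norm_sub_norm_le (π.score θ₁ s a) (π.score θ₂ s a)
      rw [norm_sub_rev] at e2
      linarith
    simp only [← ofReal_norm]
    have n1 := norm_nonneg (π.score θ₁ s a)
    have n2 := norm_nonneg (π.score θ₂ s a)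
    set x := ‖π.score θ₁ s a‖
    set y := ‖π.score θ₂ s a‖
    rw [Real.norm_eq_abs]
    have hd0 := abs_nonneg (p₂ - p₁)
    have hd : |p₂ - p₁| ≤ p₁ + p₂ := by rw [abs_le]; constructor <;> linarith
    set D := |p₂ - p₁|
    rw [← ENNReal.ofReal_pow n1, ← ENNReal.ofReal_pow n2, ← ENNReal.ofReal_mul n1,
      ← ENNReal.ofReal_mul (by positivity), ← ENNReal.ofReal_mul (by positivity),
      ← ENNReal.ofReal_mul (by positivity), ← ENNReal.ofReal_mul (by positivity),
      ← ENNReal.ofReal_mul (by positivity), ← ENNReal.ofReal_mul (by positivity),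
      ← ENNReal.ofReal_add (by positivity) (by positivity),
      ← ENNReal.ofReal_add (by positivity) (by positivity),
      ← ENNReal.ofReal_add (by positivity) (by positivity)]
    refine ENNReal.ofReal_le_ofReal ?_
    have hx : x ≤ q⁻¹ + q * x ^ 2 := by
      have : 0 ≤ q⁻¹ * ((q * x - 1) ^ 2 + q * x) := by positivity
      have e : q⁻¹ * ((q * x - 1) ^ 2 + q * x) = q⁻¹ + q * x ^ 2 - x := by field_simp; ring
      linarith
    have hx2 : x ^ 2 ≤ 2 * y ^ 2 + 2 * Mh ^ 2 := by nlinarith [sq_nonneg (y - Mh)]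
    calc x * D ≤ (q⁻¹ + q * x ^ 2) * D := by gcongr
      _ ≤ q⁻¹ * D + q * x ^ 2 * (p₁ + p₂) := by rw [add_mul]; gcongr
      _ = q⁻¹ * D + (q * (x ^ 2 * p₁) + q * x ^ 2 * p₂) := by ring
      _ ≤ q⁻¹ * D + (q * (x ^ 2 * p₁) + q * (2 * y ^ 2 + 2 * Mh ^ 2) * p₂) := by gcongr
      _ = _ := by ring
  have m1 := (π.measurable_score_action θ₁ s).enorm.pow_const 2
  have m2 := (π.measurable_score_action θ₂ s).enorm.pow_const 2
  have p1 := (π.measurable_dens_action θ₁ s).ennreal_ofReal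
  have p2 := (π.measurable_dens_action θ₂ s).ennreal_ofReal
  have pd : Measurable fun a => ‖π.dens θ₂ s a - π.dens θ₁ s a‖ₑ :=
    ((π.measurable_dens_action θ₂ s).sub (π.measurable_dens_action θ₁ s)).enorm
  have mp1 : Measurable fun a => ‖π.score θ₁ s a‖ₑ ^ 2 * ENNReal.ofReal (π.dens θ₁ s a) :=
    m1.mul p1
  have mp2 : Measurable fun a => ‖π.score θ₂ s a‖ₑ ^ 2 * ENNReal.ofReal (π.dens θ₂ s a) :=
    m2.mul p2
  refine (lintegral_mono hpt).trans ?_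
  rw [lintegral_add_left (pd.const_mul _), lintegral_add_left (mp1.const_mul _),
    lintegral_add_left (mp2.const_mul _), lintegral_const_mul _ pd,
    lintegral_const_mul _ mp1, lintegral_const_mul _ mp2,
    lintegral_const_mul _ p2, π.lintegral_dens, mul_one]
  calc _ ≤ ENNReal.ofReal q⁻¹ * ENNReal.ofReal (Real.sqrt B * r) +
      (ENNReal.ofReal q * ENNReal.ofReal B + (ENNReal.ofReal (2 * q) * ENNReal.ofReal B +
        ENNReal.ofReal (2 * q * Mh ^ 2))) := by
        gcongr
        · exact (h.lintegral_dens_sub_le θ₁ θ₂ s).trans (ENNReal.ofReal_le_ofReal (by gcongr))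
        · exact h.second_moment θ₁ s
        · exact h.second_moment θ₂ s
    _ = _ := by
        rw [← ENNReal.ofReal_mul (by positivity), ← ENNReal.ofReal_mul (by positivity),
          ← ENNReal.ofReal_mul (by positivity), ← ENNReal.ofReal_add (by positivity) (by positivity),
          ← ENNReal.ofReal_add (by positivity) (by positivity),
          ← ENNReal.ofReal_add (by positivity) (by positivity), ← hqr]
        congr 1
        field_simp
        ring

/-- Split into π₂(score₂ − score₁), which is Hölder, and (π₂ − π₁) score₁, treated in
`lintegral_score_mul_dens_sub_le`. -/
theorem RegularScore.lintegral_dens_smul_score_sub_le (h : π.RegularScore B Mh β)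
    {θ₁ θ₂ : Param d} {r : ℝ} (hr0 : 0 < r) (hr1 : r ≤ 1) (hr : ‖θ₂ - θ₁‖ ≤ r) (s : S) :
    ∫⁻ a, ‖π.dens θ₂ s a • π.score θ₂ s a - π.dens θ₁ s a • π.score θ₁ s a‖ₑ ∂ν ≤
      ENNReal.ofReal (scoreModulus B Mh β r) := by
  have hB := h.B_nonneg
  have hM := h.Mh_pos
  have hpt : ∀ a, ‖π.dens θ₂ s a • π.score θ₂ s a - π.dens θ₁ s a • π.score θ₁ s a‖ₑ ≤
      ENNReal.ofReal (Mh * r ^ β) * ENNReal.ofReal (π.dens θ₂ s a) +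
        ‖π.score θ₁ s a‖ₑ * ‖π.dens θ₂ s a - π.dens θ₁ s a‖ₑ := by
    intro a
    have e : π.dens θ₂ s a • π.score θ₂ s a - π.dens θ₁ s a • π.score θ₁ s a =
        π.dens θ₂ s a • (π.score θ₂ s a - π.score θ₁ s a) +
          (π.dens θ₂ s a - π.dens θ₁ s a) • π.score θ₁ s a := by
      rw [smul_sub, sub_smul]; abel
    rw [e]
    refine (enorm_add_le _ _).trans ?_
    rw [enorm_smul, enorm_smul, Real.enorm_of_nonneg (π.dens_pos θ₂ s a).le, mul_comm,
      mul_comm ‖π.score θ₁ s a‖ₑ]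
    gcongr
    rw [← ofReal_norm]
    exact ENNReal.ofReal_le_ofReal (h.norm_score_sub_le hr s a)
  refine (lintegral_mono hpt).trans ?_
  rw [lintegral_add_left ((π.measurable_dens_action θ₂ s).ennreal_ofReal.const_mul _),
    π.lintegral_ofReal_dens_mul, scoreModulus, ENNReal.ofReal_add (by positivity) (by positivity)]
  gcongr
  exact h.lintegral_score_mul_dens_sub_le hr0 hr1 hr s

/-- The first order expansion of the policies in total variation. -/
theorem RegularScore.lintegral_dens_sub_sub_inner_le (h : π.RegularScore B Mh β)
    {θ₁ θ₂ : Param d} {r : ℝ} (hr0 : 0 < r) (hr1 : r ≤ 1) (hr : ‖θ₂ - θ₁‖ ≤ r) (s : S) :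
    ∫⁻ a, ‖π.dens θ₂ s a - π.dens θ₁ s a - π.dens θ₁ s a * ⟪π.score θ₁ s a, θ₂ - θ₁⟫_ℝ‖ₑ ∂ν ≤
      ENNReal.ofReal (scoreModulus B Mh β r * r) := by
  have hc : Measurable fun a => π.dens θ₁ s a * ⟪π.score θ₁ s a, θ₂ - θ₁⟫_ℝ :=
    (π.measurable_dens_action θ₁ s).mul ((π.measurable_score_action θ₁ s).inner measurable_const)
  refine h.lintegral_dens_sub_sub_le θ₁ θ₂ s hc fun t ht => ?_
  have hr' : ‖θ₁ + t • (θ₂ - θ₁) - θ₁‖ ≤ r := by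
    rw [add_sub_cancel_left, norm_smul, Real.norm_of_nonneg ht.1]
    exact (mul_le_of_le_one_left (norm_nonneg _) ht.2).trans hr
  set θ := θ₁ + t • (θ₂ - θ₁)
  calc _ ≤ ∫⁻ a, ‖π.dens θ s a • π.score θ s a - π.dens θ₁ s a • π.score θ₁ s a‖ₑ *
        ENNReal.ofReal r ∂ν := by
        refine lintegral_mono fun a => ?_
        rw [← real_inner_smul_left, ← real_inner_smul_left, ← inner_sub_left]
        refine (enorm_inner_le _ _).trans ?_
        gcongr
        rw [← ofReal_norm]
        exact ENNReal.ofReal_le_ofReal hr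
    _ ≤ _ := by
        rw [lintegral_mul_const' _ _ ENNReal.ofReal_ne_top,
          ENNReal.ofReal_mul (h.scoreModulus_nonneg hr0.le)]
        gcongr
        exact h.lintegral_dens_smul_score_sub_le hr0 hr1 hr' s

theorem RegularScore.abs_integral_policy_sub_le (h : π.RegularScore B Mh β) (θ₁ θ₂ : Param d)
    (s : S) {f : A → ℝ} (hf : Measurable f) {b : ℝ} (hb : ∀ a, |f a| ≤ b) :
    |∫ a, f a ∂π.policy θ₂ s - ∫ a, f a ∂π.policy θ₁ s| ≤ b * (Real.sqrt B * ‖θ₂ - θ₁‖) := by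
  have i1 := (π.integrable_policy_iff θ₁ s f).1 (integrable_of_abs_le hf hb)
  have i2 := (π.integrable_policy_iff θ₂ s f).1 (integrable_of_abs_le hf hb)
  rw [π.integral_policy, π.integral_policy, ← integral_sub i2 i1, ← Real.norm_eq_abs]
  have := π.nonempty_action s
  have hb0 : 0 ≤ b := (abs_nonneg _).trans (hb (Classical.arbitrary A))
  refine norm_integral_le_of_lintegral_le (by positivity) ?_
  rw [ENNReal.ofReal_mul hb0]
  calc _ ≤ ∫⁻ a, ENNReal.ofReal b * ‖π.dens θ₂ s a - π.dens θ₁ s a‖ₑ ∂ν := by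
        refine lintegral_mono fun a => ?_
        rw [← sub_smul, smul_eq_mul, enorm_mul, mul_comm, ← ofReal_norm (f a)]
        gcongr
        exact hb a
    _ ≤ _ := by
        rw [lintegral_const_mul' _ _ ENNReal.ofReal_ne_top]
        gcongr
        exact h.lintegral_dens_sub_le θ₁ θ₂ s

theorem RegularScore.integrable_score (h : π.RegularScore B Mh β) (θ : Param d) (s : S) :
    Integrable (fun a => π.score θ s a) (π.policy θ s) :=
  ⟨(π.measurable_score_action θ s).aestronglyMeasurable,
    (h.lintegral_score_le θ s).trans_lt ENNReal.ofReal_lt_top⟩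

theorem RegularScore.abs_integral_policy_sub_sub_le (h : π.RegularScore B Mh β)
    {θ₁ θ₂ : Param d} {r : ℝ} (hr0 : 0 < r) (hr1 : r ≤ 1) (hr : ‖θ₂ - θ₁‖ ≤ r) (s : S)
    {f : A → ℝ} (hf : Measurable f) {b : ℝ} (hb : ∀ a, |f a| ≤ b) :
    |∫ a, f a ∂π.policy θ₂ s - ∫ a, f a ∂π.policy θ₁ s -
      ∫ a, f a * ⟪π.score θ₁ s a, θ₂ - θ₁⟫_ℝ ∂π.policy θ₁ s| ≤
        b * (scoreModulus B Mh β r * r) := by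
  have i1 := (π.integrable_policy_iff θ₁ s f).1 (integrable_of_abs_le hf hb)
  have i2 := (π.integrable_policy_iff θ₂ s f).1 (integrable_of_abs_le hf hb)
  have i3' : Integrable (fun a => f a * ⟪π.score θ₁ s a, θ₂ - θ₁⟫_ℝ) (π.policy θ₁ s) :=
    ((h.integrable_score θ₁ s).inner_const (𝕜 := ℝ) (θ₂ - θ₁)).bdd_mul (c := b)
      hf.aestronglyMeasurable (ae_of_all _ hb)
  have i3 := (π.integrable_policy_iff θ₁ s _).1 i3'
  have i21 : Integrable (fun a => π.dens θ₂ s a • f a - π.dens θ₁ s a • f a) ν := i2.sub i1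
  rw [π.integral_policy, π.integral_policy, π.integral_policy, ← integral_sub i2 i1,
    ← integral_sub i21 i3, ← Real.norm_eq_abs]
  have := π.nonempty_action s
  have hb0 : 0 ≤ b := (abs_nonneg _).trans (hb (Classical.arbitrary A))
  have hmod := h.scoreModulus_nonneg hr0.le
  refine norm_integral_le_of_lintegral_le (by positivity) ?_
  rw [ENNReal.ofReal_mul hb0]
  calc _ ≤ ∫⁻ a, ENNReal.ofReal b * ‖π.dens θ₂ s a - π.dens θ₁ s a -
          π.dens θ₁ s a * ⟪π.score θ₁ s a, θ₂ - θ₁⟫_ℝ‖ₑ ∂ν := by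
        refine lintegral_mono fun a => ?_
        simp only [smul_eq_mul]
        rw [show π.dens θ₂ s a * f a - π.dens θ₁ s a * f a -
          π.dens θ₁ s a * (f a * ⟪π.score θ₁ s a, θ₂ - θ₁⟫_ℝ) = f a * (π.dens θ₂ s a -
          π.dens θ₁ s a - π.dens θ₁ s a * ⟪π.score θ₁ s a, θ₂ - θ₁⟫_ℝ) by ring, enorm_mul,
          ← ofReal_norm (f a)]
        gcongr
        exact hb a
    _ ≤ _ := by
        rw [lintegral_const_mul' _ _ ENNReal.ofReal_ne_top]
        gcongr
        exact h.lintegral_dens_sub_sub_inner_le hr0 hr1 hr s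

end PolicyFamily

end HPG

/-! ### Occupancy measures, the performance difference identity and the policy gradient theorem. -/

namespace HPG

open Filter Topology InnerProductSpace

variable {d : ℕ} {S A : Type*} [MeasurableSpace S] [MeasurableSpace A] {ν : Measure A}

theorem MDP.nonneg_of_abs_reward_le {M : MDP S A} {U : ℝ} (π : PolicyFamily d S ν) (s : S)
    (hU : ∀ x, |M.reward x| ≤ U) : 0 ≤ U := by
  have := π.nonempty_action s
  exact (abs_nonneg _).trans (hU (s, Classical.arbitrary A))

variable [SigmaFinite ν]

namespace MDP

variable (M : MDP S A) (π : PolicyFamily d S ν)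

theorem one_sub_γ_pos : 0 < 1 - M.γ := sub_pos.2 M.γ_lt_one

/-- The discounted occupancy measure of the states under `π_θ`, of total mass `1 / (1 - γ)`. -/
def stateOcc (θ : Param d) (s : S) : Measure S := resolvent (M.stateChain π θ) M.γ s

/-- The discounted occupancy measure of the state-action pairs under `π_θ`. -/
def occ (θ : Param d) (s : S) : Measure (S × A) :=
  (π.act θ ∘ₖ resolvent (M.stateChain π θ) M.γ) s

/-- The action value of the reward `F` under `π_θ`. -/
def qValue (F : S × A → ℝ) (θ : Param d) (x : S × A) : ℝ :=
  ∫ y, F y ∂resolvent (M.chain π θ) M.γ x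

instance isFiniteMeasure_stateOcc (θ : Param d) (s : S) : IsFiniteMeasure (M.stateOcc π θ s) := by
  have := isFiniteKernel_resolvent (M.stateChain π θ) M.γ_nonneg M.γ_lt_one
  unfold stateOcc; infer_instance

instance isFiniteMeasure_occ (θ : Param d) (s : S) : IsFiniteMeasure (M.occ π θ s) := by
  have := isFiniteKernel_resolvent (M.stateChain π θ) M.γ_nonneg M.γ_lt_one
  unfold occ; infer_instance

theorem norm_integral_stateOcc_le (θ : Param d) (s : S) {f : S → ℝ} {b : ℝ}
    (hb : ∀ s, |f s| ≤ b) : |∫ s', f s' ∂M.stateOcc π θ s| ≤ b / (1 - M.γ) :=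
  abs_integral_resolvent_le _ M.γ_nonneg M.γ_lt_one s hb

theorem lintegral_act_comp_le {Y : Type*} [MeasurableSpace Y] (η : Kernel Y S) (θ : Param d)
    (y : Y) {f : S × A → ℝ≥0∞} (hf : Measurable f) {c : ℝ≥0∞}
    (hc : ∀ s, ∫⁻ a, f (s, a) ∂π.policy θ s ≤ c) :
    ∫⁻ x, f x ∂(π.act θ ∘ₖ η) y ≤ c * η y Set.univ := by
  rw [Kernel.lintegral_comp _ _ _ hf, ← lintegral_const]
  exact lintegral_mono fun s => (π.lintegral_act θ s hf).trans_le (hc s)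

theorem lintegral_occ_le (θ : Param d) (s₀ : S) {f : S × A → ℝ≥0∞} (hf : Measurable f) {c : ℝ}
    (hc0 : 0 ≤ c) (hc : ∀ s, ∫⁻ a, f (s, a) ∂π.policy θ s ≤ ENNReal.ofReal c) :
    ∫⁻ x, f x ∂M.occ π θ s₀ ≤ ENNReal.ofReal (c / (1 - M.γ)) := by
  have h := lintegral_act_comp_le π (resolvent (M.stateChain π θ) M.γ) θ s₀ hf hc
  rw [resolvent_apply_univ _ M.γ_nonneg M.γ_lt_one, ← ENNReal.ofReal_mul hc0, mul_one_div] at h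
  exact h

theorem integral_occ (θ : Param d) (s₀ : S) {E : Type*} [NormedAddCommGroup E] [NormedSpace ℝ E]
    {f : S × A → E} (hm : StronglyMeasurable f) (hf : Integrable f (M.occ π θ s₀)) :
    ∫ x, f x ∂M.occ π θ s₀ = ∫ s, ∫ a, f (s, a) ∂π.policy θ s ∂M.stateOcc π θ s₀ := by
  rw [occ, Kernel.integral_comp hf]
  exact integral_congr_ae (ae_of_all _ fun s => π.integral_act θ s hm)

section Bounded

variable {F : S × A → ℝ} (hF : Measurable F) {b : ℝ} (hb : ∀ x, |F x| ≤ b)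

include hb in
theorem abs_qValue_le (θ : Param d) (x : S × A) : |M.qValue π F θ x| ≤ b / (1 - M.γ) :=
  abs_integral_resolvent_le _ M.γ_nonneg M.γ_lt_one x hb
include hF in
theorem measurable_qValue (θ : Param d) : Measurable (M.qValue π F θ) :=
  measurable_integral_kernel _ hF

include hF in
theorem measurable_qValue_action (θ : Param d) (s : S) :
    Measurable fun a => M.qValue π F θ (s, a) :=
  (M.measurable_qValue π hF θ).comp measurable_prodMk_left

include hF hb in
theorem qValue_eq (θ : Param d) (x : S × A) :
    M.qValue π F θ x = F x +
      M.γ * ∫ s, ∫ a, M.qValue π F θ (s, a) ∂π.policy θ s ∂M.trans x := by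
  have hm := M.measurable_qValue π hF θ
  have hi : Integrable (M.qValue π F θ) ((π.act θ ∘ₖ M.trans) x) :=
    integrable_of_abs_le hm (M.abs_qValue_le π hb θ)
  have h := integral_resolvent_eq_add (M.chain π θ) M.γ_nonneg M.γ_lt_one x hF hb
  have e : ∫ y, M.qValue π F θ y ∂M.chain π θ x =
      ∫ s, ∫ a, M.qValue π F θ (s, a) ∂π.policy θ s ∂M.trans x := by
    rw [chain, Kernel.integral_comp hi]
    exact integral_congr_ae (ae_of_all _ fun s => π.integral_act θ s hm.stronglyMeasurable)
  rw [← e]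
  exact h

include hF in
theorem measurable_integral_policy (θ : Param d) :
    Measurable fun s => ∫ a, F (s, a) ∂π.policy θ s := by
  have h := measurable_integral_kernel (π.act θ) hF
  simpa only [π.integral_act θ _ hF.stronglyMeasurable] using h

include hF hb in
-- Let V be the mean of Q_{θ₂} under π_{θ₂} and T the state transition under π_{θ₁}. The flow
-- balance gives ∫ V = V(s₀) + γ ∫ TV over the occupancy of θ₁, and by Bellman the mean of Q_{θ₂}
-- under π_{θ₁} is the mean reward plus γ TV. On subtraction the terms γ ∫ TV cancel. Equal
-- parameters then identify the occupancy integral with V(s₀), which is why the left side is stated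
-- with V(s₀) for now.
theorem integral_policy_qValue_sub (θ₁ θ₂ : Param d) (s₀ : S) :
    ∫ a, M.qValue π F θ₂ (s₀, a) ∂π.policy θ₂ s₀ - ∫ x, F x ∂M.occ π θ₁ s₀ =
      ∫ s, (∫ a, M.qValue π F θ₂ (s, a) ∂π.policy θ₂ s -
        ∫ a, M.qValue π F θ₂ (s, a) ∂π.policy θ₁ s) ∂M.stateOcc π θ₁ s₀ := by
  have hQm := M.measurable_qValue π hF θ₂
  have hQb := M.abs_qValue_le π hb θ₂
  set V : S → ℝ := fun s => ∫ a, M.qValue π F θ₂ (s, a) ∂π.policy θ₂ s with hV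
  have hVm : Measurable V := measurable_integral_policy π hQm θ₂
  have hVb : ∀ s, |V s| ≤ b / (1 - M.γ) := fun s => abs_integral_le_of_abs_le fun a => hQb (s, a)
  have hWm : Measurable fun s => ∫ a, M.qValue π F θ₂ (s, a) ∂π.policy θ₁ s :=
    measurable_integral_policy π hQm θ₁
  have hWb : ∀ s, |∫ a, M.qValue π F θ₂ (s, a) ∂π.policy θ₁ s| ≤ b / (1 - M.γ) :=
    fun s => abs_integral_le_of_abs_le fun a => hQb (s, a)
  have hPm : Measurable fun x => ∫ s, V s ∂M.trans x := measurable_integral_kernel M.trans hVm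
  have hPb : ∀ x, |∫ s, V s ∂M.trans x| ≤ b / (1 - M.γ) := fun x => abs_integral_le_of_abs_le hVb
  have hPm' : ∀ s, Measurable fun a => ∫ s', V s' ∂M.trans (s, a) :=
    fun s => hPm.comp measurable_prodMk_left
  have hFm' : ∀ s, Measurable fun a => F (s, a) := fun s => hF.comp measurable_prodMk_left
  have hflow := integral_resolvent_eq_add' (M.stateChain π θ₁) M.γ_nonneg M.γ_lt_one s₀ hVm hVb
  have hT : ∀ s, ∫ s', V s' ∂M.stateChain π θ₁ s =
      ∫ a, ∫ s', V s' ∂M.trans (s, a) ∂π.policy θ₁ s := by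
    intro s
    have hi : Integrable V ((M.trans ∘ₖ π.act θ₁) s) := integrable_of_abs_le hVm hVb
    rw [stateChain, Kernel.integral_comp hi]
    exact π.integral_act θ₁ s hPm.stronglyMeasurable
  have hQ : ∀ s, ∫ a, M.qValue π F θ₂ (s, a) ∂π.policy θ₁ s =
      ∫ a, F (s, a) ∂π.policy θ₁ s + M.γ * ∫ s', V s' ∂M.stateChain π θ₁ s := by
    intro s
    rw [hT, ← integral_const_mul, ← integral_add
      (integrable_of_abs_le (hFm' s) fun a => hb (s, a))
      ((integrable_of_abs_le (hPm' s) fun a => hPb (s, a)).const_mul _)]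
    exact integral_congr_ae (ae_of_all _ fun a => M.qValue_eq π hF hb θ₂ (s, a))
  have hTm : Measurable fun s => ∫ s', V s' ∂M.stateChain π θ₁ s :=
    measurable_integral_kernel _ hVm
  have hTi : Integrable (fun s => ∫ s', V s' ∂M.stateChain π θ₁ s) (M.stateOcc π θ₁ s₀) :=
    integrable_of_abs_le hTm fun s => abs_integral_le_of_abs_le hVb
  have hRi : Integrable (fun s => ∫ a, F (s, a) ∂π.policy θ₁ s) (M.stateOcc π θ₁ s₀) :=
    integrable_of_abs_le (measurable_integral_policy π hF θ₁)
      fun s => abs_integral_le_of_abs_le fun a => hb (s, a)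
  rw [integral_sub (integrable_of_abs_le hVm hVb) (integrable_of_abs_le hWm hWb),
    M.integral_occ π θ₁ s₀ hF.stronglyMeasurable (integrable_of_abs_le hF hb)]
  simp_rw [hQ]
  rw [integral_add hRi (hTi.const_mul _), integral_const_mul]
  change V s₀ - _ = ∫ s, V s ∂resolvent (M.stateChain π θ₁) M.γ s₀ - _
  rw [hflow, stateOcc]
  ring

include hF hb in
theorem integral_occ_eq (θ : Param d) (s₀ : S) :
    ∫ x, F x ∂M.occ π θ s₀ = ∫ a, M.qValue π F θ (s₀, a) ∂π.policy θ s₀ := by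
  have h := M.integral_policy_qValue_sub π hF hb θ θ s₀
  simp only [sub_self, integral_zero] at h
  linarith

include hF hb in
/-- The performance difference identity. -/
theorem integral_occ_sub (θ₁ θ₂ : Param d) (s₀ : S) :
    ∫ x, F x ∂M.occ π θ₂ s₀ - ∫ x, F x ∂M.occ π θ₁ s₀ =
      ∫ s, (∫ a, M.qValue π F θ₂ (s, a) ∂π.policy θ₂ s -
        ∫ a, M.qValue π F θ₂ (s, a) ∂π.policy θ₁ s) ∂M.stateOcc π θ₁ s₀ := by
  rw [M.integral_occ_eq π hF hb θ₂, M.integral_policy_qValue_sub π hF hb]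

variable {π} {B Mh β : ℝ} (h : π.RegularScore B Mh β)

include hF hb h in
-- In the performance difference identity, Q is bounded by b/(1 − γ) and the occupancy measure has
-- mass 1/(1 − γ); the rest is the total variation bound for the policies.
theorem abs_integral_occ_sub_le (θ₁ θ₂ : Param d) (s₀ : S) :
    |∫ x, F x ∂M.occ π θ₂ s₀ - ∫ x, F x ∂M.occ π θ₁ s₀| ≤
      b * Real.sqrt B * ‖θ₂ - θ₁‖ / (1 - M.γ) ^ 2 := by
  rw [M.integral_occ_sub π hF hb]
  refine (M.norm_integral_stateOcc_le π θ₁ s₀ fun s => h.abs_integral_policy_sub_le θ₁ θ₂ s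
    (M.measurable_qValue_action π hF θ₂ s) fun a => M.abs_qValue_le π hb θ₂ (s, a)).trans_eq ?_
  have := M.one_sub_γ_pos.ne'
  field_simp

include hF hb h in
-- In the Bellman equations the immediate rewards cancel, and the values at the next state are
-- occupancy integrals, so `abs_integral_occ_sub_le` applies.
theorem abs_qValue_sub_le (θ₁ θ₂ : Param d) (x : S × A) :
    |M.qValue π F θ₂ x - M.qValue π F θ₁ x| ≤
      M.γ * (b * Real.sqrt B * ‖θ₂ - θ₁‖ / (1 - M.γ) ^ 2) := by
  have hi : ∀ θ, Integrable (fun s => ∫ a, M.qValue π F θ (s, a) ∂π.policy θ s) (M.trans x) :=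
    fun θ => integrable_of_abs_le (measurable_integral_policy π (M.measurable_qValue π hF θ) θ)
      fun s => abs_integral_le_of_abs_le fun a => M.abs_qValue_le π hb θ (s, a)
  rw [M.qValue_eq π hF hb, M.qValue_eq π hF hb, add_sub_add_left_eq_sub, ← mul_sub,
    ← integral_sub (hi θ₂) (hi θ₁), abs_mul, abs_of_nonneg M.γ_nonneg]
  refine mul_le_mul_of_nonneg_left (abs_integral_le_of_abs_le fun s => ?_) M.γ_nonneg
  rw [← M.integral_occ_eq π hF hb, ← M.integral_occ_eq π hF hb]
  exact M.abs_integral_occ_sub_le hF hb h θ₁ θ₂ s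

end Bounded

variable {M π} {B Mh β U : ℝ}

theorem norm_le_of_inner_le {x : Param d} {c : ℝ} (hc : 0 ≤ c)
    (hx : ∀ v : Param d, ⟪x, v⟫_ℝ ≤ c * ‖v‖) : ‖x‖ ≤ c := by
  rcases (norm_nonneg x).eq_or_lt with h | h
  · rwa [← h]
  · have := hx x
    rw [real_inner_self_eq_norm_mul_norm] at this
    exact le_of_mul_le_mul_right this h

/-- Pairing with an arbitrary direction reduces to real functions and costs no dimensional constant.
-/
theorem norm_integral_occ_sub_le (h : π.RegularScore B Mh β) (θ₁ θ₂ : Param d) (s₀ : S)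
    {F : S × A → Param d} (hF : Measurable F) {b : ℝ} (hb0 : 0 ≤ b) (hb : ∀ x, ‖F x‖ ≤ b) :
    ‖∫ x, F x ∂M.occ π θ₂ s₀ - ∫ x, F x ∂M.occ π θ₁ s₀‖ ≤
      b * Real.sqrt B * ‖θ₂ - θ₁‖ / (1 - M.γ) ^ 2 := by
  refine norm_le_of_inner_le (by have := M.one_sub_γ_pos; positivity) fun v => ?_
  have hi : ∀ θ, Integrable F (M.occ π θ s₀) := fun θ =>
    Integrable.of_bound hF.aestronglyMeasurable b (ae_of_all _ hb)
  have e : ∀ θ, ⟪∫ x, F x ∂M.occ π θ s₀, v⟫_ℝ = ∫ x, ⟪F x, v⟫_ℝ ∂M.occ π θ s₀ := fun θ => by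
    rw [real_inner_comm, ← integral_inner (hi θ)]
    exact integral_congr_ae (ae_of_all _ fun x => real_inner_comm _ _)
  rw [inner_sub_left, e, e]
  refine (le_abs_self _).trans ((M.abs_integral_occ_sub_le (b := b * ‖v‖)
    (hF.inner measurable_const) (fun x => ?_) h θ₁ θ₂ s₀).trans_eq (by ring))
  exact (abs_real_inner_le_norm _ _).trans (by gcongr; exact hb x)

theorem lintegral_occ_score_le (h : π.RegularScore B Mh β) (θ : Param d) (s₀ : S) :
    ∫⁻ x, ‖π.score θ x.1 x.2‖ₑ ∂M.occ π θ s₀ ≤ ENNReal.ofReal (Real.sqrt B / (1 - M.γ)) :=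
  M.lintegral_occ_le π θ s₀ (π.measurable_score_apply θ).enorm (Real.sqrt_nonneg _)
    (h.lintegral_score_le θ)

theorem integrable_occ_score (h : π.RegularScore B Mh β) (θ : Param d) (s₀ : S) :
    Integrable (fun x => π.score θ x.1 x.2) (M.occ π θ s₀) :=
  ⟨(π.measurable_score_apply θ).aestronglyMeasurable,
    (lintegral_occ_score_le h θ s₀).trans_lt ENNReal.ofReal_lt_top⟩

/-- The moment bound concerns the score at the sampling parameter only; Hölder continuity keeps any
other score within a constant of it. -/
theorem integrable_occ_score' (h : π.RegularScore B Mh β) (θ θ' : Param d) (s₀ : S) :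
    Integrable (fun x => π.score θ' x.1 x.2) (M.occ π θ s₀) := by
  refine Integrable.mono' ((integrable_occ_score h θ s₀).norm.add
    (integrable_const (Mh * ‖θ' - θ‖ ^ β))) (π.measurable_score_apply θ').aestronglyMeasurable
    (ae_of_all _ fun x => ?_)
  have h1 := h.holder θ' θ x.1 x.2
  have h2 := norm_sub_norm_le (π.score θ' x.1 x.2) (π.score θ x.1 x.2)
  simp only [Pi.add_apply]
  linarith

theorem integrable_smul_score (h : π.RegularScore B Mh β) (θ θ' : Param d) (s₀ : S)
    {f : S × A → ℝ} (hf : Measurable f) {b : ℝ} (hb : ∀ x, |f x| ≤ b) :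
    Integrable (fun x => f x • π.score θ' x.1 x.2) (M.occ π θ s₀) := by
  refine Integrable.mono' ((integrable_occ_score' h θ θ' s₀).norm.const_mul b)
    (hf.smul (π.measurable_score_apply θ')).aestronglyMeasurable (ae_of_all _ fun x => ?_)
  rw [norm_smul]
  exact mul_le_mul_of_nonneg_right (hb x) (norm_nonneg _)

variable (M π) in
/-- The policy gradient `∑ γ^t E[Q(s_t, a_t) ∇ log π_θ(a_t | s_t)]`. -/
def policyGradient (s₀ : S) (θ : Param d) : Param d :=
  ∫ x, M.qValue π M.reward θ x • π.score θ x.1 x.2 ∂M.occ π θ s₀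

theorem norm_integral_smul_occ_le (θ : Param d) (s₀ : S) {f : S × A → ℝ} {g : S × A → Param d}
    (hg : Measurable g) {b c : ℝ} (hb0 : 0 ≤ b) (hb : ∀ x, |f x| ≤ b) (hc0 : 0 ≤ c)
    (hc : ∀ s, ∫⁻ a, ‖g (s, a)‖ₑ ∂π.policy θ s ≤ ENNReal.ofReal c) :
    ‖∫ x, f x • g x ∂M.occ π θ s₀‖ ≤ b * c / (1 - M.γ) := by
  have hγ := M.one_sub_γ_pos
  refine norm_integral_le_of_lintegral_le (by positivity) ?_
  calc _ ≤ ∫⁻ x, ENNReal.ofReal b * ‖g x‖ₑ ∂M.occ π θ s₀ := by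
        refine lintegral_mono fun x => ?_
        rw [enorm_smul, ← ofReal_norm (f x)]
        gcongr
        exact hb x
    _ ≤ ENNReal.ofReal b * ENNReal.ofReal (c / (1 - M.γ)) := by
        rw [lintegral_const_mul' _ _ ENNReal.ofReal_ne_top]
        gcongr
        exact M.lintegral_occ_le π θ s₀ hg.enorm hc0 hc
    _ = _ := by
        rw [← ENNReal.ofReal_mul hb0, mul_div_assoc]

theorem norm_policyGradient_le (h : π.RegularScore B Mh β) (hU0 : 0 ≤ U)
    (hU : ∀ x, |M.reward x| ≤ U) (s₀ : S) (θ : Param d) :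
    ‖M.policyGradient π s₀ θ‖ ≤ U * Real.sqrt B / (1 - M.γ) ^ 2 := by
  have hγ := M.one_sub_γ_pos
  refine (norm_integral_smul_occ_le θ s₀ (π.measurable_score_apply θ) (by positivity)
    (M.abs_qValue_le π hU θ) (Real.sqrt_nonneg B) (h.lintegral_score_le θ)).trans_eq ?_
  field_simp

/-- Dominated convergence exchanges the discounted sum with the expectation, and the one-time
marginals sum to the occupancy measure. -/
theorem objective_eq (π : PolicyFamily d S ν) (hU : ∀ x, |M.reward x| ≤ U) (s₀ : S)
    (θ : Param d) : M.objective π s₀ θ = ∫ x, M.reward x ∂M.occ π θ s₀ := by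
  have hR := M.measurable_reward
  have hsum : ∀ ω : ℕ → S × A, HasSum (fun t : ℕ => M.γ ^ t * M.reward (ω t))
      (∑' t : ℕ, M.γ ^ t * M.reward (ω t)) := fun ω => by
    refine Summable.hasSum (Summable.of_norm_bounded (g := fun t => M.γ ^ t * U)
      ((summable_geometric_of_lt_one M.γ_nonneg M.γ_lt_one).mul_right U) fun t => ?_)
    rw [norm_mul, norm_pow, Real.norm_of_nonneg M.γ_nonneg]
    exact mul_le_mul_of_nonneg_left (hU _) (pow_nonneg M.γ_nonneg t)
  have h1 : HasSum (fun t : ℕ => ∫ ω, M.γ ^ t * M.reward (ω t) ∂M.trajectory π s₀ θ)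
      (M.objective π s₀ θ) := by
    refine hasSum_integral_of_dominated_convergence (fun t _ => M.γ ^ t * U) (fun t => ?_)
      (fun t => ae_of_all _ fun ω => ?_) (ae_of_all _ fun ω => ?_) (integrable_const _)
      (ae_of_all _ hsum)
    · exact ((hR.comp (measurable_pi_apply t)).const_mul _).aestronglyMeasurable
    · rw [norm_mul, norm_pow, Real.norm_of_nonneg M.γ_nonneg]
      exact mul_le_mul_of_nonneg_left (hU _) (pow_nonneg M.γ_nonneg t)
    · exact (summable_geometric_of_lt_one M.γ_nonneg M.γ_lt_one).mul_right U
  have hi : Integrable M.reward (M.occ π θ s₀) := integrable_of_abs_le hR hU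
  have h2 := hasSum_integral_resolvent (M.stateChain π θ) M.γ_nonneg s₀
    (f := fun s => ∫ x, M.reward x ∂π.act θ s)
    (integrable_of_abs_le (μ := M.stateOcc π θ s₀) (measurable_integral_kernel _ hR)
      fun s => abs_integral_le_of_abs_le hU)
  rw [occ, Kernel.integral_comp hi]
  refine h1.unique (h2.congr_fun fun t => ?_)
  have hit : Integrable M.reward ((π.act θ ∘ₖ (M.stateChain π θ ^ t)) s₀) :=
    integrable_of_abs_le hR hU
  rw [integral_const_mul, smul_eq_mul, ← Kernel.integral_comp hit, ← map_trajectory,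
    integral_map (measurable_pi_apply t).aemeasurable hR.aestronglyMeasurable]

/-- The policy gradient theorem, as a first order expansion with an explicit remainder. -/
theorem abs_objective_sub_sub_inner_le (h : π.RegularScore B Mh β) (hU0 : 0 ≤ U)
    (hU : ∀ x, |M.reward x| ≤ U) (s₀ : S) {θ₁ θ₂ : Param d} {r : ℝ} (hr0 : 0 < r) (hr1 : r ≤ 1)
    (hr : ‖θ₂ - θ₁‖ ≤ r) :
    |M.objective π s₀ θ₂ - M.objective π s₀ θ₁ - ⟪M.policyGradient π s₀ θ₁, θ₂ - θ₁⟫_ℝ| ≤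
      (M.γ * (U * Real.sqrt B * r / (1 - M.γ) ^ 2) * (Real.sqrt B * r) +
        U / (1 - M.γ) * (PolicyFamily.scoreModulus B Mh β r * r)) / (1 - M.γ) := by
  have hγ := M.one_sub_γ_pos
  have hγ0 := M.γ_nonneg
  have hR := M.measurable_reward
  have hQm := M.measurable_qValue π hR
  have hQb := M.abs_qValue_le π hU
  have hQma := M.measurable_qValue_action π hR
  have hinner : ⟪M.policyGradient π s₀ θ₁, θ₂ - θ₁⟫_ℝ =
      ∫ s, ∫ a, M.qValue π M.reward θ₁ (s, a) * ⟪π.score θ₁ s a, θ₂ - θ₁⟫_ℝ ∂π.policy θ₁ s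
        ∂M.stateOcc π θ₁ s₀ := by
    have hi := integrable_smul_score (M := M) h θ₁ θ₁ s₀ (hQm θ₁) (hQb θ₁)
    have hm : Measurable fun x : S × A =>
        M.qValue π M.reward θ₁ x * ⟪π.score θ₁ x.1 x.2, θ₂ - θ₁⟫_ℝ :=
      (hQm θ₁).mul ((π.measurable_score_apply θ₁).inner measurable_const)
    rw [policyGradient, real_inner_comm, ← integral_inner hi]
    rw [← M.integral_occ π θ₁ s₀ hm.stronglyMeasurable]
    · refine integral_congr_ae (ae_of_all _ fun x => ?_)
      simp only [real_inner_smul_right]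
      rw [real_inner_comm]
    · refine (hi.inner_const (𝕜 := ℝ) (θ₂ - θ₁)).congr (ae_of_all _ fun x => ?_)
      simp only [real_inner_smul_left]
  have hkm : Measurable fun s =>
      ∫ a, M.qValue π M.reward θ₁ (s, a) * ⟪π.score θ₁ s a, θ₂ - θ₁⟫_ℝ ∂π.policy θ₁ s :=
    measurable_integral_policy π (F := fun x =>
      M.qValue π M.reward θ₁ x * ⟪π.score θ₁ x.1 x.2, θ₂ - θ₁⟫_ℝ)
      ((hQm θ₁).mul ((π.measurable_score_apply θ₁).inner measurable_const)) θ₁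
  have hhm : ∀ θ θ', Measurable fun s => ∫ a, M.qValue π M.reward θ (s, a) ∂π.policy θ' s :=
    fun θ θ' => measurable_integral_policy π (hQm θ) θ'
  have hhi : ∀ θ θ', Integrable (fun s => ∫ a, M.qValue π M.reward θ (s, a) ∂π.policy θ' s)
      (M.stateOcc π θ₁ s₀) := fun θ θ' =>
    integrable_of_abs_le (hhm θ θ') fun s => abs_integral_le_of_abs_le fun a => hQb θ (s, a)
  -- The remainder at s is (Q₂ − Q₁)(π₂ − π₁), a product of two Lipschitz factors and so of order
  -- r², plus Q₁ tested against the first order remainder of the policy. Lipschitz continuity of Q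
  -- is therefore enough; no derivative of Q in θ enters.
  have hpt : ∀ s, |∫ a, M.qValue π M.reward θ₂ (s, a) ∂π.policy θ₂ s -
        ∫ a, M.qValue π M.reward θ₂ (s, a) ∂π.policy θ₁ s -
        ∫ a, M.qValue π M.reward θ₁ (s, a) * ⟪π.score θ₁ s a, θ₂ - θ₁⟫_ℝ ∂π.policy θ₁ s| ≤
      M.γ * (U * Real.sqrt B * r / (1 - M.γ) ^ 2) * (Real.sqrt B * r) +
        U / (1 - M.γ) * (PolicyFamily.scoreModulus B Mh β r * r) := by
    intro s
    have e1 := h.abs_integral_policy_sub_sub_le hr0 hr1 hr s (hQma θ₁ s)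
      (fun a => hQb θ₁ (s, a))
    have e2 := h.abs_integral_policy_sub_le θ₁ θ₂ s
      (f := fun a => M.qValue π M.reward θ₂ (s, a) - M.qValue π M.reward θ₁ (s, a))
      ((hQma θ₂ s).sub (hQma θ₁ s)) (fun a => M.abs_qValue_sub_le hR hU h θ₁ θ₂ (s, a))
    have hia : ∀ θ θ', Integrable (fun a => M.qValue π M.reward θ (s, a)) (π.policy θ' s) :=
      fun θ θ' => integrable_of_abs_le (hQma θ s) fun a => hQb θ (s, a)
    rw [integral_sub (hia _ _) (hia _ _), integral_sub (hia _ _) (hia _ _)] at e2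
    have e3 : M.γ * (U * Real.sqrt B * ‖θ₂ - θ₁‖ / (1 - M.γ) ^ 2) * (Real.sqrt B * ‖θ₂ - θ₁‖) ≤
        M.γ * (U * Real.sqrt B * r / (1 - M.γ) ^ 2) * (Real.sqrt B * r) := by gcongr
    refine le_trans (le_of_eq_of_le ?_ (abs_add_le _ _)) (add_le_add (e2.trans e3) e1)
    congr 1
    ring
  -- The linear term is integrable as the difference of two bounded functions, the full difference
  -- and the remainder just estimated.
  have hki : Integrable (fun s =>
      ∫ a, M.qValue π M.reward θ₁ (s, a) * ⟪π.score θ₁ s a, θ₂ - θ₁⟫_ℝ ∂π.policy θ₁ s)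
      (M.stateOcc π θ₁ s₀) := by
    have hsub : Integrable (fun s => ∫ a, M.qValue π M.reward θ₂ (s, a) ∂π.policy θ₂ s -
        ∫ a, M.qValue π M.reward θ₂ (s, a) ∂π.policy θ₁ s -
        ∫ a, M.qValue π M.reward θ₁ (s, a) * ⟪π.score θ₁ s a, θ₂ - θ₁⟫_ℝ ∂π.policy θ₁ s)
        (M.stateOcc π θ₁ s₀) :=
      integrable_of_abs_le (((hhm θ₂ θ₂).sub (hhm θ₂ θ₁)).sub hkm) hpt
    refine (((hhi θ₂ θ₂).sub (hhi θ₂ θ₁)).sub hsub).congr (ae_of_all _ fun s => ?_)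
    simp
  have hdi : Integrable (fun s => ∫ a, M.qValue π M.reward θ₂ (s, a) ∂π.policy θ₂ s -
      ∫ a, M.qValue π M.reward θ₂ (s, a) ∂π.policy θ₁ s) (M.stateOcc π θ₁ s₀) :=
    (hhi θ₂ θ₂).sub (hhi θ₂ θ₁)
  rw [objective_eq π hU, objective_eq π hU, M.integral_occ_sub π hR hU, hinner,
    ← integral_sub hdi hki]
  exact M.norm_integral_stateOcc_le π θ₁ s₀ hpt

/-- The explicit remainder is e(r) r with e continuous at 0 and e(0) = 0. -/
theorem hasGradientAt_objective (h : π.RegularScore B Mh β) (hU0 : 0 ≤ U)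
    (hU : ∀ x, |M.reward x| ≤ U) (s₀ : S) (θ : Param d) :
    HasGradientAt (M.objective π s₀) (M.policyGradient π s₀ θ) θ := by
  have hγ := M.one_sub_γ_pos
  rw [hasGradientAt_iff_isLittleO, Asymptotics.isLittleO_iff]
  intro c hc
  let e : ℝ → ℝ := fun r => (M.γ * (U * Real.sqrt B * r / (1 - M.γ) ^ 2) * Real.sqrt B +
    U / (1 - M.γ) * PolicyFamily.scoreModulus B Mh β r) / (1 - M.γ)
  have he : Tendsto (fun θ' : Param d => e ‖θ' - θ‖) (𝓝 θ) (𝓝 0) := by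
    have hcont : Continuous fun θ' : Param d => e ‖θ' - θ‖ := by
      have h1 : Continuous fun θ' : Param d => ‖θ' - θ‖ := by fun_prop
      have h2 : Continuous fun θ' : Param d => ‖θ' - θ‖ ^ β :=
        h1.rpow_const fun _ => Or.inr h.β_pos.le
      have h3 : Continuous fun θ' : Param d => Real.sqrt ‖θ' - θ‖ := h1.sqrt
      simp only [e, PolicyFamily.scoreModulus]
      fun_prop
    have := hcont.tendsto θ
    simpa [e, PolicyFamily.scoreModulus, Real.zero_rpow h.β_pos.ne'] using this
  have hball : ∀ᶠ θ' in 𝓝 θ, ‖θ' - θ‖ ≤ 1 := by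
    filter_upwards [Metric.closedBall_mem_nhds θ one_pos] with θ' hθ'
    rwa [← dist_eq_norm]
  filter_upwards [hball, he.eventually_lt_const hc] with θ' h1 h2
  rcases (norm_nonneg (θ' - θ)).eq_or_lt with h0 | h0
  · have : θ' = θ := by rw [← sub_eq_zero, ← norm_eq_zero, ← h0]
    simp [this]
  · refine (abs_objective_sub_sub_inner_le h hU0 hU s₀ h0 h1 le_rfl).trans ?_
    calc _ = e ‖θ' - θ‖ * ‖θ' - θ‖ := by simp only [e]; ring
      _ ≤ c * ‖θ' - θ‖ := by gcongr

end MDP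

end HPG

/-! ### Generalized Hölder continuity of the policy gradient. -/

namespace HPG

open Filter Topology InnerProductSpace

variable {d : ℕ} {S A : Type*} [MeasurableSpace S] [MeasurableSpace A] {ν : Measure A}

namespace MDP

variable {M : MDP S A} {π : PolicyFamily d S ν} {B Mh β U : ℝ}

/-- The infimum defining B(λ) need not be attained, hence the margin ε, which is removed in
`norm_policyGradient_sub_le`. -/
theorem exists_tolerance_set {lam : ℝ} (hlam : π.scoreBound lam ≠ ∞) {ε : ℝ} (hε : 0 < ε) :
    ∃ C ∈ π.toleranceSets lam, ∀ s, ∀ a ∈ C, ∀ θ,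
      ‖π.score θ s a‖ ≤ (π.scoreBound lam).toReal + ε := by
  have hlt : π.scoreBound lam < ENNReal.ofReal ((π.scoreBound lam).toReal + ε) := by
    rw [ENNReal.lt_ofReal_iff_toReal_lt hlam]
    linarith
  rw [PolicyFamily.scoreBound] at hlt
  simp only [iInf_lt_iff] at hlt
  obtain ⟨C, hC, hlt⟩ := hlt
  refine ⟨C, hC, fun s a ha θ => ?_⟩
  rw [← ENNReal.ofReal_le_ofReal_iff (by positivity), ofReal_norm]
  exact (le_iSup_of_le s (le_iSup₂_of_le a ha (le_iSup (fun θ => ‖π.score θ s a‖ₑ) θ))).trans hlt.le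

variable [SigmaFinite ν]

/-- Smoothness of the policy gradient, for a set `C` of actions on which the scores are bounded
by `c` and outside which they have mean at most `lam`. -/
theorem norm_policyGradient_sub_le_of_mem (h : π.RegularScore B Mh β) (hU0 : 0 ≤ U)
    (hU : ∀ x, |M.reward x| ≤ U) {lam c : ℝ} (hlam : 0 ≤ lam) (hc0 : 0 ≤ c) {C : Set A}
    (hC : C ∈ π.toleranceSets lam) (hc : ∀ s, ∀ a ∈ C, ∀ θ, ‖π.score θ s a‖ ≤ c)
    (s₀ : S) (θ₁ θ₂ : Param d) :
    ‖M.policyGradient π s₀ θ₂ - M.policyGradient π s₀ θ₁‖ ≤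
      2 * U * Mh / (1 - M.γ) ^ 2 * ‖θ₂ - θ₁‖ ^ β +
      (constMQ M.γ U B * Real.sqrt B / (1 - M.γ) + U * c * constMρ M.γ B / (1 - M.γ) ^ 2) *
        ‖θ₂ - θ₁‖ + 2 * U / (1 - M.γ) ^ 2 * lam := by
  have hγ := M.one_sub_γ_pos
  have hγ0 := M.γ_nonneg
  have hMh := h.Mh_pos
  have hR := M.measurable_reward
  have hQm := M.measurable_qValue π hR
  have hQb := M.abs_qValue_le π hU
  have hQs := M.abs_qValue_sub_le hR hU h θ₁ θ₂
  have hsm := π.measurable_score_apply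
  set Q₁ := M.qValue π M.reward θ₁
  set Q₂ := M.qValue π M.reward θ₂
  set r := ‖θ₂ - θ₁‖
  let T : Set (S × A) := Prod.snd ⁻¹' C
  have hT : MeasurableSet T := measurable_snd hC.1
  let g : S × A → Param d := fun x => π.score θ₁ x.1 x.2
  let gi : S × A → Param d := T.indicator g
  let go : S × A → Param d := Tᶜ.indicator g
  have hgi : Measurable gi := (hsm θ₁).indicator hT
  have hgo : Measurable go := (hsm θ₁).indicator hT.compl
  have hsum : ∀ x, g x = gi x + go x := fun x => (Set.indicator_self_add_compl_apply T g x).symm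
  have hi : ∀ {f : S × A → ℝ} {b : ℝ} (θ θ' : Param d), Measurable f → (∀ x, |f x| ≤ b) →
      Integrable (fun x => f x • π.score θ' x.1 x.2) (M.occ π θ s₀) :=
    fun θ θ' hf hb => integrable_smul_score h θ θ' s₀ hf hb
  have hgib : ∀ x, ‖Q₁ x • gi x‖ ≤ U / (1 - M.γ) * c := by
    intro x
    rw [norm_smul]
    refine mul_le_mul (hQb θ₁ x) ?_ (norm_nonneg _) (by positivity)
    by_cases hx : x ∈ T
    · rw [show gi x = g x from Set.indicator_of_mem hx g]
      exact hc x.1 x.2 hx θ₁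
    · rw [show gi x = 0 from Set.indicator_of_notMem hx g, norm_zero]
      exact hc0
  have hii : ∀ θ, Integrable (fun x => Q₁ x • gi x) (M.occ π θ s₀) := fun θ =>
    Integrable.of_bound ((hQm θ₁).smul hgi).aestronglyMeasurable _ (ae_of_all _ hgib)
  have hio : ∀ θ, Integrable (fun x => Q₁ x • go x) (M.occ π θ s₀) := fun θ => by
    refine ((hi θ θ₁ (hQm θ₁) (hQb θ₁)).sub (hii θ)).congr (ae_of_all _ fun x => ?_)
    change Q₁ x • g x - Q₁ x • gi x = _
    rw [hsum x, smul_add, add_sub_cancel_left]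
  have hsplit : ∀ θ, ∫ x, Q₁ x • g x ∂M.occ π θ s₀ =
      ∫ x, Q₁ x • gi x ∂M.occ π θ s₀ + ∫ x, Q₁ x • go x ∂M.occ π θ s₀ := fun θ => by
    rw [← integral_add (hii θ) (hio θ)]
    exact integral_congr_ae (ae_of_all _ fun x => by simp only [hsum x, smul_add])
  -- One quantity changes at a time: Q, then the score, then the occupancy measure. For the last,
  -- only the part on C is compared between the two measures; off C the two integrals are bounded
  -- separately. The first and third terms make up the coefficient of r. The second gives U Mh
  -- r^β/(1 − γ)², and the fourth gives it once more, whence the factor 2; the factor 2 in front of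
  -- λ comes from the fourth and fifth.
  have hdecomp : M.policyGradient π s₀ θ₂ - M.policyGradient π s₀ θ₁ =
      ∫ x, (Q₂ x - Q₁ x) • π.score θ₂ x.1 x.2 ∂M.occ π θ₂ s₀ +
      ∫ x, Q₁ x • (π.score θ₂ x.1 x.2 - g x) ∂M.occ π θ₂ s₀ +
      (∫ x, Q₁ x • gi x ∂M.occ π θ₂ s₀ - ∫ x, Q₁ x • gi x ∂M.occ π θ₁ s₀) +
      ∫ x, Q₁ x • go x ∂M.occ π θ₂ s₀ - ∫ x, Q₁ x • go x ∂M.occ π θ₁ s₀ := by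
    have e1 : ∫ x, (Q₂ x - Q₁ x) • π.score θ₂ x.1 x.2 ∂M.occ π θ₂ s₀ =
        M.policyGradient π s₀ θ₂ - ∫ x, Q₁ x • π.score θ₂ x.1 x.2 ∂M.occ π θ₂ s₀ := by
      rw [policyGradient, ← integral_sub (hi θ₂ θ₂ (hQm θ₂) (hQb θ₂))
        (hi θ₂ θ₂ (hQm θ₁) (hQb θ₁))]
      exact integral_congr_ae (ae_of_all _ fun x => sub_smul _ _ _)
    have e2 : ∫ x, Q₁ x • (π.score θ₂ x.1 x.2 - g x) ∂M.occ π θ₂ s₀ =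
        ∫ x, Q₁ x • π.score θ₂ x.1 x.2 ∂M.occ π θ₂ s₀ - ∫ x, Q₁ x • g x ∂M.occ π θ₂ s₀ := by
      rw [← integral_sub (hi θ₂ θ₂ (hQm θ₁) (hQb θ₁)) (hi θ₂ θ₁ (hQm θ₁) (hQb θ₁))]
      exact integral_congr_ae (ae_of_all _ fun x => smul_sub _ _ _)
    have e3 : M.policyGradient π s₀ θ₁ = ∫ x, Q₁ x • g x ∂M.occ π θ₁ s₀ := rfl
    rw [e1, e2, e3, hsplit θ₁, hsplit θ₂]
    abel
  have hgo1 : ∀ s, ∫⁻ a, ‖go (s, a)‖ₑ ∂π.policy θ₁ s ≤ ENNReal.ofReal lam := by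
    intro s
    have e : ∀ a, ‖go (s, a)‖ₑ = Cᶜ.indicator (fun a => ‖π.score θ₁ s a‖ₑ) a := fun a => by
      by_cases ha : a ∈ C <;> simp [go, T, g, ha]
    simp_rw [e]
    rw [π.lintegral_policy θ₁ s ((π.measurable_score_action θ₁ s).enorm.indicator hC.1.compl)]
    refine le_of_eq_of_le ?_ (hC.2 θ₁ s)
    rw [← lintegral_indicator hC.1.compl]
    refine lintegral_congr fun a => ?_
    by_cases ha : a ∈ C <;> simp [ha]
  -- The tolerance controls a score only under its own policy, so here score₁ is first replaced by
  -- score₂ at a Hölder cost.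
  have hgo2 : ∀ s, ∫⁻ a, ‖go (s, a)‖ₑ ∂π.policy θ₂ s ≤ ENNReal.ofReal (lam + Mh * r ^ β) := by
    intro s
    have e : ∀ a, ‖go (s, a)‖ₑ ≤ Cᶜ.indicator (fun a => ‖π.score θ₂ s a‖ₑ) a +
        ENNReal.ofReal (Mh * r ^ β) := fun a => by
      by_cases ha : a ∈ C
      · simp [go, T, g, ha]
      · have e1 : ‖π.score θ₁ s a - π.score θ₂ s a‖ₑ ≤ ENNReal.ofReal (Mh * r ^ β) := by
          rw [← ofReal_norm, norm_sub_rev]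
          exact ENNReal.ofReal_le_ofReal (h.norm_score_sub_le le_rfl s a)
        have e2 : ‖π.score θ₁ s a‖ₑ ≤ ‖π.score θ₂ s a‖ₑ + ENNReal.ofReal (Mh * r ^ β) := by
          calc ‖π.score θ₁ s a‖ₑ = ‖π.score θ₂ s a + (π.score θ₁ s a - π.score θ₂ s a)‖ₑ := by
                rw [add_sub_cancel]
            _ ≤ _ := (enorm_add_le _ _).trans (by gcongr)
        simpa [go, T, g, ha] using e2
    refine (lintegral_mono e).trans ?_
    have hm := (π.measurable_score_action θ₂ s).enorm.indicator hC.1.compl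
    rw [lintegral_add_right _ measurable_const, lintegral_const, measure_univ, mul_one,
      ENNReal.ofReal_add hlam (by positivity), π.lintegral_policy θ₂ s hm]
    gcongr
    refine le_of_eq_of_le ?_ (hC.2 θ₂ s)
    rw [← lintegral_indicator hC.1.compl]
    refine lintegral_congr fun a => ?_
    by_cases ha : a ∈ C <;> simp [ha]
  have b1 := norm_integral_smul_occ_le (M := M) θ₂ s₀ (hsm θ₂) (by positivity) hQs
    (Real.sqrt_nonneg B) (h.lintegral_score_le θ₂)
  have b2 := norm_integral_smul_occ_le (M := M) (f := Q₁)
    (g := fun x => π.score θ₂ x.1 x.2 - g x) (c := Mh * r ^ β) θ₂ s₀ ((hsm θ₂).sub (hsm θ₁))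
    (by positivity) (hQb θ₁) (by positivity) fun s => by
      refine (lintegral_mono fun a => ?_).trans (by simp : ∫⁻ _, ENNReal.ofReal (Mh * r ^ β)
        ∂π.policy θ₂ s ≤ ENNReal.ofReal (Mh * r ^ β))
      rw [← ofReal_norm]
      exact ENNReal.ofReal_le_ofReal (h.norm_score_sub_le le_rfl s a)
  have b3 := norm_integral_occ_sub_le (M := M) h θ₁ θ₂ s₀ ((hQm θ₁).smul hgi) (by positivity) hgib
  have b4 := norm_integral_smul_occ_le (M := M) (f := Q₁) θ₂ s₀ hgo (by positivity) (hQb θ₁)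
    (by positivity) hgo2
  have b5 := norm_integral_smul_occ_le (M := M) (f := Q₁) θ₁ s₀ hgo (by positivity) (hQb θ₁)
    hlam hgo1
  rw [hdecomp]
  refine ((norm_sub_le _ _).trans (add_le_add ((norm_add_le _ _).trans (add_le_add
    ((norm_add_le _ _).trans (add_le_add ((norm_add_le _ _).trans (add_le_add b1 b2)) b3)) b4))
    b5)).trans_eq ?_
  unfold constMQ constMρ
  field_simp
  ring

theorem norm_policyGradient_sub_le (h : π.RegularScore B Mh β) (hU0 : 0 ≤ U)
    (hU : ∀ x, |M.reward x| ≤ U) {lam : ℝ} (hlam : 0 ≤ lam) (hBlam : π.scoreBound lam ≠ ∞)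
    (s₀ : S) (θ₁ θ₂ : Param d) :
    ‖M.policyGradient π s₀ θ₂ - M.policyGradient π s₀ θ₁‖ ≤
      constMJ M.γ U B Mh (π.scoreBound lam).toReal *
        (‖θ₂ - θ₁‖ ^ β + ‖θ₂ - θ₁‖ + lam) := by
  have hγ := M.one_sub_γ_pos
  have hγ0 := M.γ_nonneg
  set b := (π.scoreBound lam).toReal
  have hb0 : 0 ≤ b := ENNReal.toReal_nonneg
  have hρ : 0 ≤ constMρ M.γ B := div_nonneg (Real.sqrt_nonneg _) hγ.le
  have key : ‖M.policyGradient π s₀ θ₂ - M.policyGradient π s₀ θ₁‖ ≤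
      2 * U * Mh / (1 - M.γ) ^ 2 * ‖θ₂ - θ₁‖ ^ β +
      (constMQ M.γ U B * Real.sqrt B / (1 - M.γ) + U * b * constMρ M.γ B / (1 - M.γ) ^ 2) *
        ‖θ₂ - θ₁‖ + 2 * U / (1 - M.γ) ^ 2 * lam := by
    refine le_of_forall_pos_le_add fun ε hε => ?_
    set k := U * constMρ M.γ B / (1 - M.γ) ^ 2 * ‖θ₂ - θ₁‖
    have hk : 0 ≤ k := by positivity
    -- The excess over B(λ) is multiplied by k in the estimate; k + 1 avoids dividing by zero when k
    -- = 0.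
    have hpos : 0 < ε / (k + 1) := by positivity
    obtain ⟨C, hC, hc⟩ := exists_tolerance_set hBlam hpos
    have h1 := norm_policyGradient_sub_le_of_mem h hU0 hU hlam (by positivity) hC hc s₀ θ₁ θ₂
    have h2 : k * (ε / (k + 1)) ≤ ε := by
      rw [mul_div_assoc', div_le_iff₀ (by positivity)]
      nlinarith
    refine h1.trans (le_of_eq_of_le ?_ (add_le_add_right h2 _))
    simp only [k]
    ring
  have e1 : 2 * U * Mh / (1 - M.γ) ^ 2 ≤ constMJ M.γ U B Mh b := le_max_left _ _
  have e2 : constMQ M.γ U B * Real.sqrt B / (1 - M.γ) + U * b * constMρ M.γ B / (1 - M.γ) ^ 2 ≤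
      constMJ M.γ U B Mh b := (le_max_left _ _).trans (le_max_right _ _)
  have e3 : 2 * U / (1 - M.γ) ^ 2 ≤ constMJ M.γ U B Mh b :=
    (le_max_right _ _).trans (le_max_right _ _)
  have hr : 0 ≤ ‖θ₂ - θ₁‖ ^ β := by positivity
  rw [mul_add, mul_add]
  exact key.trans (add_le_add (add_le_add (mul_le_mul_of_nonneg_right e1 hr)
    (mul_le_mul_of_nonneg_right e2 (norm_nonneg _))) (mul_le_mul_of_nonneg_right e3 hlam))

end MDP

end HPG

/-! ### The gradient estimate: second moment and unbiasedness. -/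

namespace HPG

open Filter Topology InnerProductSpace

section Series

/-- Summability of the double family allows it to be summed by rows or by diagonals. It is used with
t = τ + j for a score at time τ and a reward at time t, and with T = t + j for the horizon. -/
theorem hasSum_sum_antidiagonal {E : Type*} [NormedAddCommGroup E] {f : ℕ × ℕ → E} {g : ℕ → E}
    {a : E} (hf : Summable f) (hg : ∀ i, HasSum (fun j => f (i, j)) (g i)) (ha : HasSum g a) :
    HasSum (fun n => ∑ k ∈ Finset.range (n + 1), f (k, n - k)) a := by
  obtain ⟨s, hs⟩ := hf
  have hsa : s = a := (hs.prod_fiberwise hg).unique ha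
  rw [hsa] at hs
  have h1 := (Finset.HasAntidiagonal.sigmaAntidiagonalEquivProd (A := ℕ)).hasSum_iff.2 hs
  have h2 := h1.sigma fun n => hasSum_fintype _
  refine h2.congr_fun fun n => ?_
  rw [← Finset.Nat.sum_antidiagonal_eq_sum_range_succ_mk, ← Finset.sum_coe_sort]
  rfl

theorem sum_range_succ_mul_pow_le {q : ℝ} (h0 : 0 ≤ q) (h1 : q < 1) (n : ℕ) :
    ∑ t ∈ Finset.range n, ((t : ℝ) + 1) * q ^ t ≤ 1 / (1 - q) ^ 2 := by
  have key : (∑ t ∈ Finset.range n, ((t : ℝ) + 1) * q ^ t) * (1 - q) ^ 2 =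
      1 - ((n : ℝ) + 1) * q ^ n + n * q ^ (n + 1) := by
    induction n with
    | zero => simp
    | succ n ih =>
      rw [Finset.sum_range_succ, add_mul, ih]
      push_cast
      ring
  have hq : 0 < 1 - q := sub_pos.2 h1
  rw [le_div_iff₀ (by positivity), key]
  have : (n : ℝ) * q ^ (n + 1) ≤ ((n : ℝ) + 1) * q ^ n := by
    rw [pow_succ]
    have hn : 0 ≤ q ^ n := pow_nonneg h0 n
    have : q ^ n * q ≤ q ^ n := mul_le_of_le_one_right hn h1.le
    nlinarith [(Nat.cast_nonneg n : (0 : ℝ) ≤ n)]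
  linarith

theorem summable_succ_mul_pow {q : ℝ} (h0 : 0 ≤ q) (h1 : q < 1) :
    Summable fun t : ℕ => ((t : ℝ) + 1) * q ^ t :=
  summable_of_sum_range_le (fun t => by positivity) (sum_range_succ_mul_pow_le h0 h1)

theorem lintegral_enorm_rpow_le {X E : Type*} [MeasurableSpace X] [NormedAddCommGroup E]
    {μ : Measure X} [IsProbabilityMeasure μ] {f : X → E} (hf : AEStronglyMeasurable f μ)
    {C p : ℝ} (hC : 0 ≤ C) (hp0 : 0 < p) (hp2 : p ≤ 2)
    (h : ∫⁻ x, ‖f x‖ₑ ^ 2 ∂μ ≤ ENNReal.ofReal C) :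
    ∫⁻ x, ‖f x‖ₑ ^ p ∂μ ≤ ENNReal.ofReal (C ^ (p / 2)) := by
  have hp : ENNReal.ofReal p ≠ 0 := by simpa using hp0
  have h1 := eLpNorm_le_eLpNorm_of_exponent_le (μ := μ) (p := ENNReal.ofReal p) (q := 2)
    (by simpa using ENNReal.ofReal_le_ofReal hp2) hf
  rw [eLpNorm_eq_lintegral_rpow_enorm_toReal hp ENNReal.ofReal_ne_top,
    eLpNorm_eq_lintegral_rpow_enorm_toReal (by norm_num) (by norm_num),
    ENNReal.toReal_ofReal hp0.le] at h1
  simp only [ENNReal.toReal_ofNat, ENNReal.rpow_ofNat] at h1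
  have h2 := ENNReal.rpow_le_rpow h1 hp0.le
  rw [← ENNReal.rpow_mul, one_div_mul_cancel hp0.ne', ENNReal.rpow_one, ← ENNReal.rpow_mul] at h2
  refine h2.trans ?_
  rw [← ENNReal.ofReal_rpow_of_nonneg hC (by positivity), one_div_mul_eq_div]
  exact ENNReal.rpow_le_rpow h (by positivity)

end Series

variable {d : ℕ} {S A : Type*} [MeasurableSpace S] [MeasurableSpace A] {ν : Measure A}

namespace MDP

variable {M : MDP S A} {π : PolicyFamily d S ν} {B Mh β U : ℝ}

theorem sqrt_γ_lt_one (M : MDP S A) : Real.sqrt M.γ < 1 := by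
  rw [Real.sqrt_lt' one_pos]; simpa using M.γ_lt_one

theorem measurable_score_trajectory (π : PolicyFamily d S ν) (θ : Param d) (t : ℕ) :
    Measurable fun ω : ℕ → S × A => π.score θ (ω t).1 (ω t).2 :=
  (π.measurable_score_apply θ).comp (measurable_pi_apply t)

/-- Cauchy–Schwarz over the pairs τ ≤ t ≤ T with weights q^t, q = √γ. The total weight ∑ (t + 1) q^t
is at most 1/(1 − q)², whatever T is. -/
theorem norm_estimate_sq_le (hU0 : 0 ≤ U) (hU : ∀ x, |M.reward x| ≤ U) (θ : Param d) (T : ℕ)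
    (ω : ℕ → S × A) :
    ‖M.estimate π θ (T, ω)‖ ^ 2 ≤ U ^ 2 * (1 / (1 - Real.sqrt M.γ) ^ 2) *
      ∑ t ∈ Finset.range (T + 1), Real.sqrt M.γ ^ t *
        ∑ τ ∈ Finset.range (t + 1), ‖π.score θ (ω τ).1 (ω τ).2‖ ^ 2 := by
  set q := Real.sqrt M.γ
  have hq0 : 0 ≤ q := Real.sqrt_nonneg _
  have hq1 : q < 1 := M.sqrt_γ_lt_one
  set y : ℕ → ℝ := fun τ => ‖π.score θ (ω τ).1 (ω τ).2‖
  have hy : ∀ τ, 0 ≤ y τ := fun τ => norm_nonneg _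
  let I : Finset (Σ _ : ℕ, ℕ) := (Finset.range (T + 1)).sigma fun t => Finset.range (t + 1)
  have h1 : ‖M.estimate π θ (T, ω)‖ ≤ U * ∑ i ∈ I, q ^ i.1 * y i.2 := by
    rw [Finset.sum_sigma, Finset.mul_sum]
    refine (norm_sum_le _ _).trans (Finset.sum_le_sum fun t _ => ?_)
    rw [norm_smul, norm_mul, norm_pow, Real.norm_of_nonneg hq0]
    calc q ^ t * ‖M.reward (ω t)‖ * ‖∑ τ ∈ Finset.range (t + 1), π.score θ (ω τ).1 (ω τ).2‖
        ≤ q ^ t * U * ∑ τ ∈ Finset.range (t + 1), y τ := by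
          gcongr
          · exact hU _
          · exact norm_sum_le _ _
      _ = U * ∑ τ ∈ Finset.range (t + 1), q ^ t * y τ := by rw [← Finset.mul_sum]; ring
  have h2 : (∑ i ∈ I, q ^ i.1 * y i.2) ^ 2 ≤
      (∑ i ∈ I, q ^ i.1) * ∑ i ∈ I, q ^ i.1 * y i.2 ^ 2 :=
    Finset.sum_sq_le_sum_mul_sum_of_sq_le_mul I (fun i _ => pow_nonneg hq0 _)
      (fun i _ => mul_nonneg (pow_nonneg hq0 _) (sq_nonneg _)) fun i _ => le_of_eq (by ring)
  have h3 : ∑ i ∈ I, q ^ i.1 ≤ 1 / (1 - q) ^ 2 := by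
    rw [Finset.sum_sigma]
    simpa using sum_range_succ_mul_pow_le hq0 hq1 (T + 1)
  have h4 : ∑ i ∈ I, q ^ i.1 * y i.2 ^ 2 =
      ∑ t ∈ Finset.range (T + 1), q ^ t * ∑ τ ∈ Finset.range (t + 1), y τ ^ 2 := by
    rw [Finset.sum_sigma]
    exact Finset.sum_congr rfl fun t _ => by rw [Finset.mul_sum]
  have h5 : 0 ≤ ∑ i ∈ I, q ^ i.1 * y i.2 ^ 2 :=
    Finset.sum_nonneg fun i _ => mul_nonneg (pow_nonneg hq0 _) (sq_nonneg _)
  calc ‖M.estimate π θ (T, ω)‖ ^ 2 ≤ (U * ∑ i ∈ I, q ^ i.1 * y i.2) ^ 2 := by gcongr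
    _ = U ^ 2 * (∑ i ∈ I, q ^ i.1 * y i.2) ^ 2 := by ring
    _ ≤ U ^ 2 * (1 / (1 - q) ^ 2 * ∑ i ∈ I, q ^ i.1 * y i.2 ^ 2) := by
        gcongr
        exact h2.trans (mul_le_mul_of_nonneg_right h3 h5)
    _ = _ := by rw [h4]; ring

theorem measurable_estimate (M : MDP S A) (π : PolicyFamily d S ν) :
    Measurable fun p : Param d × ℕ × (ℕ → S × A) => M.estimate π p.1 p.2 := by
  have h : ∀ T : ℕ, Measurable fun p : Param d × (ℕ → S × A) => M.estimate π p.1 (T, p.2) := by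
    intro T
    have h1 : ∀ t : ℕ, Measurable fun p : Param d × (ℕ → S × A) =>
        Real.sqrt M.γ ^ t * M.reward (p.2 t) := fun t =>
      (M.measurable_reward.comp ((measurable_pi_apply t).comp measurable_snd)).const_mul _
    have h2 : ∀ τ : ℕ, Measurable fun p : Param d × (ℕ → S × A) =>
        π.score p.1 (p.2 τ).1 (p.2 τ).2 := fun τ => π.measurable_score.comp
        (measurable_fst.prodMk ((measurable_pi_apply τ).comp measurable_snd))
    have h3 : ∀ t : ℕ, Measurable fun p : Param d × (ℕ → S × A) =>
        (Real.sqrt M.γ ^ t * M.reward (p.2 t)) •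
          ∑ τ ∈ Finset.range (t + 1), π.score p.1 (p.2 τ).1 (p.2 τ).2 := fun t =>
      (h1 t).smul (Finset.measurable_sum (Finset.range (t + 1)) fun τ _ => h2 τ)
    exact Finset.measurable_sum (Finset.range (T + 1)) fun t _ => h3 t
  have h2 : Measurable fun q : ℕ × Param d × (ℕ → S × A) => M.estimate π q.2.1 (q.1, q.2.2) :=
    measurable_from_prod_countable_right h
  have h3 : Measurable fun p : Param d × ℕ × (ℕ → S × A) => (p.2.1, p.1, p.2.2) := by fun_prop
  exact h2.comp h3

theorem measurable_estimate_apply (M : MDP S A) (π : PolicyFamily d S ν) (θ : Param d) :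
    Measurable fun x : ℕ × (ℕ → S × A) => M.estimate π θ x :=
  (M.measurable_estimate π).comp measurable_prodMk_left

theorem measurable_update_map (M : MDP S A) (π : PolicyFamily d S ν) (η : ℝ) :
    Measurable fun p : Param d × ℕ × (ℕ → S × A) => p.1 + η • M.estimate π p.1 p.2 :=
  measurable_fst.add ((M.measurable_estimate π).const_smul η)

variable [SigmaFinite ν]

theorem rollout_apply (M : MDP S A) (π : PolicyFamily d S ν) (s : S) (θ : Param d) :
    M.rollout π s θ = M.horizon.prod (M.trajectory π s θ) := by
  rw [rollout, Kernel.prod_apply, Kernel.const_apply]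

instance isMarkovKernel_rollout (M : MDP S A) (π : PolicyFamily d S ν) (s : S) :
    IsMarkovKernel (M.rollout π s) := by
  unfold rollout; infer_instance

theorem lintegral_trajectory_apply_le (M : MDP S A) (π : PolicyFamily d S ν) (s : S)
    (θ : Param d) (t : ℕ) {f : S × A → ℝ≥0∞} (hf : Measurable f) {c : ℝ≥0∞}
    (hc : ∀ s, ∫⁻ a, f (s, a) ∂π.policy θ s ≤ c) :
    ∫⁻ ω, f (ω t) ∂M.trajectory π s θ ≤ c := by
  rw [← lintegral_map hf (measurable_pi_apply t), map_trajectory]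
  simpa using lintegral_act_comp_le π (M.stateChain π θ ^ t) θ s hf hc

theorem lintegral_score_trajectory_sq_le (h : π.RegularScore B Mh β) (s : S) (θ : Param d)
    (t : ℕ) : ∫⁻ ω, ‖π.score θ (ω t).1 (ω t).2‖ₑ ^ 2 ∂M.trajectory π s θ ≤ ENNReal.ofReal B :=
  M.lintegral_trajectory_apply_le π s θ t ((π.measurable_score_apply θ).enorm.pow_const 2)
    (h.lintegral_score_sq_le θ)

theorem integrable_score_trajectory_sq (h : π.RegularScore B Mh β) (s : S) (θ : Param d) (t : ℕ) :
    Integrable (fun ω => ‖π.score θ (ω t).1 (ω t).2‖ ^ 2) (M.trajectory π s θ) := by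
  refine ⟨((measurable_score_trajectory π θ t).norm.pow_const 2).aestronglyMeasurable, ?_⟩
  refine lt_of_eq_of_lt ?_ ((lintegral_score_trajectory_sq_le (M := M) h s θ t).trans_lt
    ENNReal.ofReal_lt_top)
  simp [enorm_pow]

theorem integral_score_trajectory_sq_le (h : π.RegularScore B Mh β) (s : S) (θ : Param d) (t : ℕ) :
    ∫ ω, ‖π.score θ (ω t).1 (ω t).2‖ ^ 2 ∂M.trajectory π s θ ≤ B := by
  have := norm_integral_le_of_lintegral_le (μ := M.trajectory π s θ)
    (f := fun ω => ‖π.score θ (ω t).1 (ω t).2‖ ^ 2) h.B_nonneg (by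
      simpa [enorm_pow] using lintegral_score_trajectory_sq_le (M := M) h s θ t)
  exact (le_abs_self _).trans this

/-- In expectation every squared score is at most B, so the same weighted sum appears a second time
and produces (1 − q)^4. The bound holds for each fixed horizon, hence also after averaging over T.
-/
theorem lintegral_estimate_sq_le (h : π.RegularScore B Mh β) (hU0 : 0 ≤ U)
    (hU : ∀ x, |M.reward x| ≤ U) (s : S) (θ : Param d) :
    ∫⁻ x, ‖M.estimate π θ x‖ₑ ^ 2 ∂M.rollout π s θ ≤
      ENNReal.ofReal (U ^ 2 * B / (1 - Real.sqrt M.γ) ^ 4) := by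
  set q := Real.sqrt M.γ with hq
  have hq0 : 0 ≤ q := Real.sqrt_nonneg _
  have hq1 : q < 1 := M.sqrt_γ_lt_one
  have hq2 : 0 < 1 - q := sub_pos.2 hq1
  have hB := h.B_nonneg
  have key : ∀ T : ℕ, ∫⁻ ω, ‖M.estimate π θ (T, ω)‖ₑ ^ 2 ∂M.trajectory π s θ ≤
      ENNReal.ofReal (U ^ 2 * B / (1 - q) ^ 4) := by
    intro T
    set Y : (ℕ → S × A) → ℝ := fun ω => U ^ 2 * (1 / (1 - q) ^ 2) *
      ∑ t ∈ Finset.range (T + 1), q ^ t *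
        ∑ τ ∈ Finset.range (t + 1), ‖π.score θ (ω τ).1 (ω τ).2‖ ^ 2 with hY
    have hsq := integrable_score_trajectory_sq (M := M) h s θ
    have hYi : Integrable Y (M.trajectory π s θ) :=
      (integrable_finsetSum _ fun t _ => (integrable_finsetSum _
        fun τ _ => hsq τ).const_mul _).const_mul _
    have hYint : ∫ ω, Y ω ∂M.trajectory π s θ ≤ U ^ 2 * B / (1 - q) ^ 4 := by
      rw [hY, integral_const_mul, integral_finsetSum _ fun t _ => (integrable_finsetSum _
        fun τ _ => hsq τ).const_mul _]
      have e : ∀ t ∈ Finset.range (T + 1), ∫ ω, q ^ t * ∑ τ ∈ Finset.range (t + 1),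
          ‖π.score θ (ω τ).1 (ω τ).2‖ ^ 2 ∂M.trajectory π s θ ≤ (((t : ℝ) + 1) * q ^ t) * B := by
        intro t _
        rw [integral_const_mul, integral_finsetSum _ fun τ _ => hsq τ]
        have e2 : ∑ τ ∈ Finset.range (t + 1),
            ∫ ω, ‖π.score θ (ω τ).1 (ω τ).2‖ ^ 2 ∂M.trajectory π s θ ≤ ((t : ℝ) + 1) * B := by
          refine (Finset.sum_le_card_nsmul _ _ B fun τ _ =>
            integral_score_trajectory_sq_le h s θ τ).trans_eq ?_
          simp
        calc _ ≤ q ^ t * (((t : ℝ) + 1) * B) := by gcongr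
          _ = _ := by ring
      calc _ ≤ U ^ 2 * (1 / (1 - q) ^ 2) *
            ∑ t ∈ Finset.range (T + 1), (((t : ℝ) + 1) * q ^ t) * B := by
            gcongr with t ht
            exact e t ht
        _ ≤ U ^ 2 * (1 / (1 - q) ^ 2) * ((1 / (1 - q) ^ 2) * B) := by
            rw [← Finset.sum_mul]
            gcongr
            exact sum_range_succ_mul_pow_le hq0 hq1 (T + 1)
        _ = _ := by field_simp
    calc _ ≤ ∫⁻ ω, ENNReal.ofReal (Y ω) ∂M.trajectory π s θ := by
          refine lintegral_mono fun ω => ?_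
          rw [← ofReal_norm, ← ENNReal.ofReal_pow (norm_nonneg _)]
          exact ENNReal.ofReal_le_ofReal (norm_estimate_sq_le hU0 hU θ T ω)
      _ = ENNReal.ofReal (∫ ω, Y ω ∂M.trajectory π s θ) := by
          refine (ofReal_integral_eq_lintegral_ofReal hYi (ae_of_all _ fun ω => ?_)).symm
          exact (sq_nonneg _).trans (norm_estimate_sq_le hU0 hU θ T ω)
      _ ≤ _ := ENNReal.ofReal_le_ofReal hYint
  rw [rollout_apply, lintegral_prod _
    ((M.measurable_estimate_apply π θ).enorm.pow_const 2).aemeasurable]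
  refine (lintegral_mono key).trans ?_
  simp

theorem integrable_estimate (h : π.RegularScore B Mh β) (hU0 : 0 ≤ U)
    (hU : ∀ x, |M.reward x| ≤ U) (s : S) (θ : Param d) :
    Integrable (fun x => M.estimate π θ x) (M.rollout π s θ) :=
  ⟨(M.measurable_estimate_apply π θ).aestronglyMeasurable,
    (lintegral_enorm_le_sqrt (M.measurable_estimate_apply π θ).aestronglyMeasurable
      (lintegral_estimate_sq_le h hU0 hU s θ)).trans_lt ENNReal.ofReal_lt_top⟩

theorem lintegral_score_trajectory_le (h : π.RegularScore B Mh β) (s : S) (θ : Param d)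
    (t : ℕ) : ∫⁻ ω, ‖π.score θ (ω t).1 (ω t).2‖ₑ ∂M.trajectory π s θ ≤
      ENNReal.ofReal (Real.sqrt B) :=
  M.lintegral_trajectory_apply_le π s θ t (π.measurable_score_apply θ).enorm
    (h.lintegral_score_le θ)

theorem norm_integral_smul_trajectory_le (h : π.RegularScore B Mh β) (hU0 : 0 ≤ U) (s : S)
    (θ : Param d) (τ : ℕ) {f : (ℕ → S × A) → ℝ} (hf : ∀ ω, |f ω| ≤ U) :
    ‖∫ ω, f ω • π.score θ (ω τ).1 (ω τ).2 ∂M.trajectory π s θ‖ ≤ U * Real.sqrt B := by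
  refine norm_integral_le_of_lintegral_le (by positivity) ?_
  rw [ENNReal.ofReal_mul hU0]
  calc _ ≤ ∫⁻ ω, ENNReal.ofReal U * ‖π.score θ (ω τ).1 (ω τ).2‖ₑ ∂M.trajectory π s θ := by
        refine lintegral_mono fun ω => ?_
        rw [enorm_smul, ← ofReal_norm (f ω)]
        gcongr
        exact hf ω
    _ ≤ _ := by
        rw [lintegral_const_mul' _ _ ENNReal.ofReal_ne_top]
        gcongr
        exact lintegral_score_trajectory_le h s θ τ

theorem integrable_smul_score_trajectory (h : π.RegularScore B Mh β) (s : S)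
    (θ : Param d) (τ : ℕ) {f : (ℕ → S × A) → ℝ} (hfm : Measurable f) (hf : ∀ ω, |f ω| ≤ U) :
    Integrable (fun ω => f ω • π.score θ (ω τ).1 (ω τ).2) (M.trajectory π s θ) := by
  have hi : Integrable (fun ω => π.score θ (ω τ).1 (ω τ).2) (M.trajectory π s θ) :=
    ⟨(measurable_score_trajectory π θ τ).aestronglyMeasurable,
      (lintegral_score_trajectory_le h s θ τ).trans_lt ENNReal.ofReal_lt_top⟩
  refine Integrable.mono' (hi.norm.const_mul U)
    (hfm.smul (measurable_score_trajectory π θ τ)).aestronglyMeasurable (ae_of_all _ fun ω => ?_)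
  rw [norm_smul]
  exact mul_le_mul_of_nonneg_right (hf ω) (norm_nonneg _)

/-- Conditioning on the pair at time τ replaces a later reward by its conditional mean. Summed over
the lag j with weights γ^j, these means build up Q. -/
theorem integral_reward_smul_score (h : π.RegularScore B Mh β)
    (hU : ∀ x, |M.reward x| ≤ U) (s : S) (θ : Param d) (τ j : ℕ) :
    ∫ ω, M.reward (ω (τ + j)) • π.score θ (ω τ).1 (ω τ).2 ∂M.trajectory π s θ =
      ∫ ω, (∫ y, M.reward y ∂(M.chain π θ ^ j) (ω τ)) • π.score θ (ω τ).1 (ω τ).2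
        ∂M.trajectory π s θ := by
  have hR := M.measurable_reward
  have hg : Measurable fun p : (S × A) × (S × A) => M.reward p.2 • π.score θ p.1.1 p.1.2 :=
    (hR.comp measurable_snd).smul ((π.measurable_score_apply θ).comp measurable_fst)
  have hp : Measurable fun ω : ℕ → S × A => (ω τ, ω (τ + j)) :=
    (measurable_pi_apply τ).prodMk (measurable_pi_apply (τ + j))
  have hi := integrable_smul_score_trajectory (M := M) h s θ τ
    (f := fun ω => M.reward (ω (τ + j))) (hR.comp (measurable_pi_apply _)) (fun ω => hU _)
  have hi2 : Integrable (fun p : (S × A) × (S × A) => M.reward p.2 • π.score θ p.1.1 p.1.2)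
      ((M.trajectory π s θ).map fun ω => (ω τ, ω (τ + j))) :=
    (integrable_map_measure hg.aestronglyMeasurable hp.aemeasurable).2 hi
  have e1 := integral_map hp.aemeasurable
    (hg.aestronglyMeasurable (μ := (M.trajectory π s θ).map fun ω => (ω τ, ω (τ + j))))
  rw [map_pair_trajectory] at e1 hi2
  rw [← e1, Measure.integral_compProd hi2]
  simp only [integral_smul_const]
  have hm : Measurable fun x : S × A =>
      (∫ y, M.reward y ∂(M.chain π θ ^ j) x) • π.score θ x.1 x.2 :=
    (measurable_integral_kernel _ hR).smul (π.measurable_score_apply θ)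
  exact integral_map (measurable_pi_apply τ).aemeasurable hm.aestronglyMeasurable

theorem hasSum_integral_pow_smul_score (h : π.RegularScore B Mh β)
    (hU : ∀ x, |M.reward x| ≤ U) (s : S) (θ : Param d) (τ : ℕ) :
    HasSum (fun j : ℕ => M.γ ^ j •
      ∫ ω, M.reward (ω (τ + j)) • π.score θ (ω τ).1 (ω τ).2 ∂M.trajectory π s θ)
      (∫ ω, M.qValue π M.reward θ (ω τ) • π.score θ (ω τ).1 (ω τ).2 ∂M.trajectory π s θ) := by
  have hR := M.measurable_reward
  have hKm : ∀ j, Measurable fun ω : ℕ → S × A => ∫ y, M.reward y ∂(M.chain π θ ^ j) (ω τ) :=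
    fun j => (measurable_integral_kernel _ hR).comp (measurable_pi_apply τ)
  have hKb : ∀ j x, |∫ y, M.reward y ∂(M.chain π θ ^ j) x| ≤ U :=
    fun j x => abs_integral_le_of_abs_le hU
  have hgeo := summable_geometric_of_lt_one M.γ_nonneg M.γ_lt_one
  simp_rw [integral_reward_smul_score h hU s θ τ, ← integral_smul]
  have hi : Integrable (fun ω => π.score θ (ω τ).1 (ω τ).2) (M.trajectory π s θ) :=
    ⟨(measurable_score_trajectory π θ τ).aestronglyMeasurable,
      (lintegral_score_trajectory_le h s θ τ).trans_lt ENNReal.ofReal_lt_top⟩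
  refine hasSum_integral_of_dominated_convergence
    (fun j ω => M.γ ^ j * (U * ‖π.score θ (ω τ).1 (ω τ).2‖)) (fun j => ?_)
    (fun j => ae_of_all _ fun ω => ?_) (ae_of_all _ fun ω => hgeo.mul_right _) ?_
    (ae_of_all _ fun ω => ?_)
  · exact (((hKm j).smul (measurable_score_trajectory π θ τ)).const_smul
      (M.γ ^ j)).aestronglyMeasurable
  · rw [norm_smul, norm_smul, Real.norm_of_nonneg (pow_nonneg M.γ_nonneg j)]
    gcongr
    · exact pow_nonneg M.γ_nonneg j
    · exact hKb j _
  · simp_rw [tsum_mul_right]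
    exact (hi.norm.const_mul U).const_mul _
  · have := isFiniteKernel_resolvent (M.chain π θ) M.γ_nonneg M.γ_lt_one
    have h1 := hasSum_integral_resolvent (M.chain π θ) M.γ_nonneg (ω τ)
      (integrable_of_abs_le hR hU)
    have h2 := h1.smul_const (π.score θ (ω τ).1 (ω τ).2)
    simp only [smul_assoc] at h2
    exact h2

theorem hasSum_pow_smul_integral_qValue (h : π.RegularScore B Mh β)
    (hU : ∀ x, |M.reward x| ≤ U) (s : S) (θ : Param d) :
    HasSum (fun τ : ℕ => M.γ ^ τ •
      ∫ ω, M.qValue π M.reward θ (ω τ) • π.score θ (ω τ).1 (ω τ).2 ∂M.trajectory π s θ)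
      (M.policyGradient π s θ) := by
  have hQm := M.measurable_qValue π M.measurable_reward θ
  have hQb := M.abs_qValue_le π hU θ
  have hgm : Measurable fun x : S × A => M.qValue π M.reward θ x • π.score θ x.1 x.2 :=
    hQm.smul (π.measurable_score_apply θ)
  have hi := integrable_smul_score (M := M) h θ θ s hQm hQb
  have hi' : Integrable (fun s' => ∫ x, M.qValue π M.reward θ x • π.score θ x.1 x.2 ∂π.act θ s')
      (resolvent (M.stateChain π θ) M.γ s) := hi.integral_comp
  rw [policyGradient, occ, Kernel.integral_comp hi]
  refine (hasSum_integral_resolvent (M.stateChain π θ) M.γ_nonneg s hi').congr_fun fun t => ?_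
  have hit : Integrable (fun x => M.qValue π M.reward θ x • π.score θ x.1 x.2)
      ((π.act θ ∘ₖ (M.stateChain π θ ^ t)) s) := by
    rw [← map_trajectory, integrable_map_measure hgm.aestronglyMeasurable
      (measurable_pi_apply t).aemeasurable]
    exact integrable_smul_score_trajectory h s θ t (hQm.comp (measurable_pi_apply t))
      fun ω => hQb _
  rw [← Kernel.integral_comp hit, ← map_trajectory,
    integral_map (measurable_pi_apply t).aemeasurable hgm.aestronglyMeasurable]

/-- The policy gradient as the series
`∑ γ^t E[R(s_t, a_t) ∑_{τ ≤ t} ∇ log π_θ(a_τ | s_τ)]`. -/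
theorem hasSum_policyGradient (h : π.RegularScore B Mh β) (hU0 : 0 ≤ U)
    (hU : ∀ x, |M.reward x| ≤ U) (s : S) (θ : Param d) :
    HasSum (fun t : ℕ => M.γ ^ t • ∑ τ ∈ Finset.range (t + 1),
      ∫ ω, M.reward (ω t) • π.score θ (ω τ).1 (ω τ).2 ∂M.trajectory π s θ)
      (M.policyGradient π s θ) := by
  have hgeo := summable_geometric_of_lt_one M.γ_nonneg M.γ_lt_one
  have hγ := M.γ_nonneg
  -- Here p = (τ, j). Rows sum over the lag j to γ^τ E[Q(x_τ) score(x_τ)], and then over τ to the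
  -- policy gradient; diagonals collect the reward at t = τ + j.
  have hsum : Summable fun p : ℕ × ℕ => M.γ ^ (p.1 + p.2) •
      ∫ ω, M.reward (ω (p.1 + p.2)) • π.score θ (ω p.1).1 (ω p.1).2 ∂M.trajectory π s θ := by
    refine Summable.of_norm_bounded (g := fun p : ℕ × ℕ =>
      (M.γ ^ p.1 * M.γ ^ p.2) * (U * Real.sqrt B)) ((hgeo.mul_of_nonneg hgeo
        (fun _ => pow_nonneg hγ _) fun _ => pow_nonneg hγ _).mul_right _) fun p => ?_
    rw [norm_smul, Real.norm_of_nonneg (pow_nonneg hγ _), pow_add]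
    gcongr
    exact norm_integral_smul_trajectory_le h hU0 s θ p.1 fun ω => hU _
  have h1 := hasSum_sum_antidiagonal hsum (fun τ => by
    have := (hasSum_integral_pow_smul_score h hU s θ τ).const_smul (M.γ ^ τ)
    simpa only [smul_smul, ← pow_add] using this) (hasSum_pow_smul_integral_qValue h hU s θ)
  refine h1.congr_fun fun t => ?_
  rw [Finset.smul_sum]
  refine Finset.sum_congr rfl fun τ hτ => ?_
  rw [Nat.add_sub_cancel' (Nat.lt_succ_iff.1 (Finset.mem_range.1 hτ))]

/-- The gradient estimate is unbiased. -/
theorem integral_estimate (h : π.RegularScore B Mh β) (hU0 : 0 ≤ U)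
    (hU : ∀ x, |M.reward x| ≤ U) (s : S) (θ : Param d) :
    ∫ x, M.estimate π θ x ∂M.rollout π s θ = M.policyGradient π s θ := by
  have hR := M.measurable_reward
  have hi := integrable_estimate h hU0 hU s θ
  set q := Real.sqrt M.γ with hq
  have hq0 : 0 ≤ q := Real.sqrt_nonneg _
  have hq1 : q < 1 := M.sqrt_γ_lt_one
  have hqq : q * q = M.γ := Real.mul_self_sqrt M.γ_nonneg
  set c : ℕ → Param d := fun t => ∑ τ ∈ Finset.range (t + 1),
    ∫ ω, M.reward (ω t) • π.score θ (ω τ).1 (ω τ).2 ∂M.trajectory π s θ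
  have hc : ∀ t, ‖c t‖ ≤ ((t : ℝ) + 1) * (U * Real.sqrt B) := by
    intro t
    refine (norm_sum_le_of_le _ fun τ _ => norm_integral_smul_trajectory_le h hU0 s θ τ
      fun ω => hU (ω t)).trans_eq ?_
    simp
  have hinner : ∀ T : ℕ, ∫ ω, M.estimate π θ (T, ω) ∂M.trajectory π s θ =
      ∑ t ∈ Finset.range (T + 1), q ^ t • c t := by
    intro T
    have hit : ∀ t τ : ℕ, Integrable (fun ω => M.reward (ω t) • π.score θ (ω τ).1 (ω τ).2)
        (M.trajectory π s θ) := fun t τ => integrable_smul_score_trajectory h s θ τ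
          (f := fun ω => M.reward (ω t)) (hR.comp (measurable_pi_apply t)) fun ω => hU _
    have e : ∀ ω : ℕ → S × A, M.estimate π θ (T, ω) = ∑ t ∈ Finset.range (T + 1), q ^ t •
        ∑ τ ∈ Finset.range (t + 1), M.reward (ω t) • π.score θ (ω τ).1 (ω τ).2 := fun ω => by
      simp only [estimate, mul_smul, Finset.smul_sum, hq]
    have hiu : ∀ t : ℕ, Integrable (fun ω => q ^ t • ∑ τ ∈ Finset.range (t + 1),
        M.reward (ω t) • π.score θ (ω τ).1 (ω τ).2) (M.trajectory π s θ) := fun t =>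
      (integrable_finsetSum (Finset.range (t + 1)) fun τ _ => hit t τ).smul (q ^ t)
    simp_rw [e]
    rw [integral_finsetSum _ fun t _ => hiu t]
    refine Finset.sum_congr rfl fun t _ => ?_
    rw [integral_smul, integral_finsetSum _ fun τ _ => hit t τ]
  rw [rollout_apply] at hi ⊢
  rw [integral_prod _ hi]
  simp_rw [hinner]
  rw [horizon, integral_geometricMeasure]
  swap
  · rw [Ne, Subtype.ext_iff]
    exact (sub_pos.2 hq1).ne'
  simp only [sub_sub_cancel, ← hq]
  -- The horizon is written T = t + j, and a diagonal is the truncated sum for one value of T. For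
  -- summability, one of the two factors q^t is enough against the linear growth of c t.
  have hsum : Summable fun p : ℕ × ℕ => (q ^ (p.1 + p.2) * (1 - q)) • q ^ p.1 • c p.1 := by
    have hs1 : Summable fun t : ℕ => ((t : ℝ) + 1) * q ^ t * (U * Real.sqrt B) :=
      (summable_succ_mul_pow hq0 hq1).mul_right _
    have hs2 : Summable fun j : ℕ => q ^ j * (1 - q) :=
      (summable_geometric_of_lt_one hq0 hq1).mul_right _
    refine Summable.of_norm_bounded (hs1.mul_of_nonneg hs2 (fun t => by positivity)
      fun j => mul_nonneg (pow_nonneg hq0 j) (sub_pos.2 hq1).le) fun p => ?_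
    rw [norm_smul, norm_smul, Real.norm_of_nonneg (mul_nonneg (pow_nonneg hq0 _)
      (sub_pos.2 hq1).le), Real.norm_of_nonneg (pow_nonneg hq0 _)]
    have h1 : q ^ p.1 ≤ 1 := pow_le_one₀ hq0 hq1.le
    have h2 : 0 ≤ 1 - q := (sub_pos.2 hq1).le
    calc q ^ (p.1 + p.2) * (1 - q) * (q ^ p.1 * ‖c p.1‖)
        ≤ q ^ (p.1 + p.2) * (1 - q) * (1 * (((p.1 : ℝ) + 1) * (U * Real.sqrt B))) := by
          gcongr
          exact hc p.1
      _ = _ := by rw [pow_add]; ring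
  -- The sum over j is P(T ≥ t) = q^t, and q^t · q^t = γ^t.
  have hfib : ∀ t : ℕ, HasSum (fun j : ℕ => (q ^ (t + j) * (1 - q)) • q ^ t • c t)
      (M.γ ^ t • c t) := by
    intro t
    have h1 := ((hasSum_geometric_of_lt_one hq0 hq1).mul_right (1 - q)).smul_const (M.γ ^ t • c t)
    rw [inv_mul_cancel₀ (sub_pos.2 hq1).ne', one_smul] at h1
    refine h1.congr_fun fun j => ?_
    rw [smul_smul, smul_smul, ← hqq, mul_pow, pow_add]
    congr 1
    ring
  have h2 := hasSum_sum_antidiagonal hsum hfib (hasSum_policyGradient h hU0 hU s θ)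
  rw [← h2.tsum_eq]
  refine tsum_congr fun T => ?_
  rw [Finset.smul_sum]
  refine Finset.sum_congr rfl fun t ht => ?_
  rw [Nat.add_sub_cancel' (Nat.lt_succ_iff.1 (Finset.mem_range.1 ht))]

end MDP

end HPG

/-! ### Moments, the ascent inequality and the telescoped bound. -/

namespace HPG

open Filter Topology InnerProductSpace

variable {d : ℕ} {S A : Type*} [MeasurableSpace S] [MeasurableSpace A] {ν : Measure A}
  [SigmaFinite ν]

namespace MDP

variable {M : MDP S A} {π : PolicyFamily d S ν} {B Mh β U : ℝ}

/-- The common bound `max {U² B, U^{1+β} B^{(1+β)/2}, U √B} / (1 - √γ)⁴` of the moments of orders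
`2`, `1 + β` and `1` of the gradient estimate. -/
def momentBound (γ U B β : ℝ) : ℝ :=
  max (U ^ 2 * B) (max (U ^ (1 + β) * B ^ ((1 + β) / 2)) (U * Real.sqrt B)) /
    (1 - Real.sqrt γ) ^ 4

theorem constLJ_eq (γ U B M Blam β : ℝ) :
    constLJ γ U B M Blam β = 2 * (constMJ γ U B M Blam * momentBound γ U B β) := by
  unfold constLJ momentBound
  ring

/-- Jensen from the second moment. The natural denominator (1 − √γ)^{2p} is weakened to the power 4,
so that one constant serves the orders 1, 1 + β and 2. -/
theorem integrable_and_integral_norm_estimate_rpow_le (h : π.RegularScore B Mh β) (hU0 : 0 ≤ U)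
    (hU : ∀ x, |M.reward x| ≤ U) (s : S) (θ : Param d) {p : ℝ} (hp0 : 0 < p) (hp2 : p ≤ 2) :
    Integrable (fun x => ‖M.estimate π θ x‖ ^ p) (M.rollout π s θ) ∧
      ∫ x, ‖M.estimate π θ x‖ ^ p ∂M.rollout π s θ ≤
        U ^ p * B ^ (p / 2) / (1 - Real.sqrt M.γ) ^ 4 := by
  set q := Real.sqrt M.γ
  have hq0 : 0 ≤ q := Real.sqrt_nonneg _
  have hq1 : q < 1 := M.sqrt_γ_lt_one
  have hq2 : 0 < 1 - q := sub_pos.2 hq1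
  have hB := h.B_nonneg
  have hm := M.measurable_estimate_apply π θ
  have hC : U ^ 2 * B / (1 - q) ^ 4 = (U * Real.sqrt B / (1 - q) ^ 2) ^ 2 := by
    rw [div_pow, mul_pow, Real.sq_sqrt hB, ← pow_mul]
  have h1 := lintegral_enorm_rpow_le hm.aestronglyMeasurable (by positivity) hp0 hp2
    (lintegral_estimate_sq_le h hU0 hU s θ)
  have e : ∀ x, ‖‖M.estimate π θ x‖ ^ p‖ₑ = ‖M.estimate π θ x‖ₑ ^ p := fun x => by
    rw [Real.enorm_of_nonneg (by positivity), ← ofReal_norm,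
      ENNReal.ofReal_rpow_of_nonneg (norm_nonneg _) hp0.le]
  simp_rw [← e] at h1
  refine ⟨⟨(hm.norm.pow_const p).aestronglyMeasurable, h1.trans_lt ENNReal.ofReal_lt_top⟩, ?_⟩
  refine (le_abs_self _).trans ((norm_integral_le_of_lintegral_le (by positivity) h1).trans ?_)
  have hq4 : (1 - q) ^ 4 ≤ ((1 - q) ^ 2) ^ p := by
    have h3 : (1 - q) ^ 2 ≤ 1 := pow_le_one₀ hq2.le (by linarith)
    calc (1 - q) ^ 4 = ((1 - q) ^ 2) ^ (2 : ℝ) := by rw [Real.rpow_two, ← pow_mul]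
      _ ≤ _ := Real.rpow_le_rpow_of_exponent_ge (by positivity) h3 hp2
  calc (U ^ 2 * B / (1 - q) ^ 4) ^ (p / 2) = U ^ p * B ^ (p / 2) / ((1 - q) ^ 2) ^ p := by
        rw [hC, ← Real.rpow_two, ← Real.rpow_mul (by positivity), mul_div_cancel₀ _ (two_ne_zero),
          Real.div_rpow (by positivity) (by positivity), Real.mul_rpow hU0 (Real.sqrt_nonneg _),
          Real.sqrt_eq_rpow, ← Real.rpow_mul hB, one_div_mul_eq_div]
    _ ≤ _ := by gcongr

theorem abs_objective_le (hU : ∀ x, |M.reward x| ≤ U) (s₀ : S) (θ : Param d) :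
    |M.objective π s₀ θ| ≤ U / (1 - M.γ) := by
  have hR := M.measurable_reward
  rw [objective_eq π hU, M.integral_occ π θ s₀ hR.stronglyMeasurable (integrable_of_abs_le hR hU)]
  exact M.norm_integral_stateOcc_le π θ s₀ fun s => abs_integral_le_of_abs_le fun a => hU (s, a)

theorem constMJ_nonneg (γ B Mh Blam : ℝ) (hU0 : 0 ≤ U) : 0 ≤ constMJ γ U B Mh Blam :=
  le_max_of_le_right (le_max_of_le_right (by positivity))

theorem momentBound_nonneg {γ : ℝ} (hU0 : 0 ≤ U) : 0 ≤ momentBound γ U B β :=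
  div_nonneg (le_max_of_le_right (le_max_of_le_right (by positivity))) (by positivity)

theorem constLJ_nonneg (γ B Mh Blam β : ℝ) (hU0 : 0 ≤ U) : 0 ≤ constLJ γ U B Mh Blam β := by
  rw [constLJ_eq]
  exact mul_nonneg zero_le_two (mul_nonneg (constMJ_nonneg _ _ _ _ hU0) (momentBound_nonneg hU0))

/-- The ascent inequality for a function with a generalized Hölder gradient. -/
theorem objective_add_ge (h : π.RegularScore B Mh β) (hU0 : 0 ≤ U)
    (hU : ∀ x, |M.reward x| ≤ U) {lam : ℝ} (hlam : 0 ≤ lam) (hBlam : π.scoreBound lam ≠ ∞)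
    (s₀ : S) (θ δ : Param d) :
    M.objective π s₀ θ + ⟪M.policyGradient π s₀ θ, δ⟫_ℝ -
      constMJ M.γ U B Mh (π.scoreBound lam).toReal *
        (‖δ‖ ^ (1 + β) + ‖δ‖ ^ 2 + lam * ‖δ‖) ≤ M.objective π s₀ (θ + δ) := by
  have hMJ := constMJ_nonneg M.γ B Mh (π.scoreBound lam).toReal hU0
  set MJ := constMJ M.γ U B Mh (π.scoreBound lam).toReal
  have hder : ∀ t : ℝ, HasDerivAt (fun t : ℝ => M.objective π s₀ (θ + t • δ))
      ⟪M.policyGradient π s₀ (θ + t • δ), δ⟫_ℝ t := by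
    intro t
    have h1 : HasDerivAt (fun t : ℝ => θ + t • δ) δ t := by
      simpa using ((hasDerivAt_id t).smul_const δ).const_add θ
    have h2 := (hasGradientAt_objective h hU0 hU s₀ (θ + t • δ)).hasFDerivAt.comp_hasDerivAt t h1
    simp only [toDual_apply_apply] at h2
    exact h2
  -- The mean value theorem suffices, since the constants leave room for the factors 1/(1 + β) and
  -- 1/2 that integration along the segment would gain.
  obtain ⟨c, hc, hc'⟩ := exists_hasDerivAt_eq_slope (fun t : ℝ => M.objective π s₀ (θ + t • δ))
    (fun t => ⟪M.policyGradient π s₀ (θ + t • δ), δ⟫_ℝ) one_pos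
    (fun t _ => (hder t).continuousAt.continuousWithinAt) fun t _ => hder t
  simp only [one_smul, zero_smul, add_zero, sub_zero, div_one] at hc'
  have hn : ‖c • δ‖ ≤ ‖δ‖ := by
    rw [norm_smul, Real.norm_of_nonneg hc.1.le]
    exact mul_le_of_le_one_left (norm_nonneg _) hc.2.le
  have hg := norm_policyGradient_sub_le (M := M) h hU0 hU hlam hBlam s₀ θ (θ + c • δ)
  rw [add_sub_cancel_left] at hg
  have hg2 : ‖M.policyGradient π s₀ (θ + c • δ) - M.policyGradient π s₀ θ‖ ≤
      MJ * (‖δ‖ ^ β + ‖δ‖ + lam) := by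
    refine hg.trans (mul_le_mul_of_nonneg_left ?_ hMJ)
    have := Real.rpow_le_rpow (norm_nonneg _) hn h.β_pos.le
    linarith
  have hin := (abs_le.1 (abs_real_inner_le_norm
    (M.policyGradient π s₀ (θ + c • δ) - M.policyGradient π s₀ θ) δ)).1
  rw [inner_sub_left, hc'] at hin
  have hlast := mul_le_mul_of_nonneg_right hg2 (norm_nonneg δ)
  have hpow : ‖δ‖ ^ (1 + β) = ‖δ‖ ^ β * ‖δ‖ := by
    rw [add_comm, Real.rpow_add_one' (norm_nonneg _) (by linarith [h.β_pos])]
  rw [hpow]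
  nlinarith

/-- Product of two bounds for ‖∇J‖. A unit step along the gradient changes J by at most 2U/(1 − γ) ≤
M_J, so the ascent inequality gives ‖∇J‖ ≤ M_J(3 + λ). The direct bound is U√B/(1 − γ)² ≤
`momentBound`. As L_J is twice M_J times `momentBound`, 3 + λ ≤ 2(2 + λ) finishes. The factor L_J
makes the bound usable when L_J = 0 and for steps larger than 1. -/
theorem norm_policyGradient_sq_le (h : π.RegularScore B Mh β) (hU0 : 0 ≤ U)
    (hU : ∀ x, |M.reward x| ≤ U) {lam : ℝ} (hlam : 0 ≤ lam) (hBlam : π.scoreBound lam ≠ ∞)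
    (s₀ : S) (θ : Param d) :
    ‖M.policyGradient π s₀ θ‖ ^ 2 ≤
      constLJ M.γ U B Mh (π.scoreBound lam).toReal β * (2 + lam) := by
  have hγ := M.one_sub_γ_pos
  have hMJ := constMJ_nonneg M.γ B Mh (π.scoreBound lam).toReal hU0
  have hMJ3 : 2 * U / (1 - M.γ) ^ 2 ≤ constMJ M.γ U B Mh (π.scoreBound lam).toReal :=
    (le_max_right _ _).trans (le_max_right _ _)
  have hasc := objective_add_ge (M := M) h hU0 hU hlam hBlam s₀ θ
  rw [constLJ_eq]
  set MJ := constMJ M.γ U B Mh (π.scoreBound lam).toReal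
  have hg0 := norm_nonneg (M.policyGradient π s₀ θ)
  have h1 : ‖M.policyGradient π s₀ θ‖ ≤ MJ * (3 + lam) := by
    rcases hg0.eq_or_lt with h0 | h0
    · rw [← h0]; positivity
    · set g := M.policyGradient π s₀ θ
      have hδ : ‖‖g‖⁻¹ • g‖ = 1 := by
        rw [norm_smul, norm_inv, norm_norm, inv_mul_cancel₀ h0.ne']
      have h2 := hasc (‖g‖⁻¹ • g)
      rw [hδ, real_inner_smul_right, real_inner_self_eq_norm_mul_norm, inv_mul_cancel_left₀ h0.ne',
        Real.one_rpow] at h2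
      have h3 := (abs_le.1 (abs_objective_le (π := π) hU s₀ θ)).1
      have h4 := (abs_le.1 (abs_objective_le (π := π) hU s₀ (θ + ‖g‖⁻¹ • g))).2
      have h5 : U / (1 - M.γ) ≤ U / (1 - M.γ) ^ 2 := by
        have : (1 - M.γ) ^ 2 ≤ 1 - M.γ := by
          rw [sq]; exact mul_le_of_le_one_left hγ.le (by linarith [M.γ_nonneg])
        gcongr
      have h6 : 2 * U / (1 - M.γ) ^ 2 = 2 * (U / (1 - M.γ) ^ 2) := by ring
      nlinarith
  have h2 : ‖M.policyGradient π s₀ θ‖ ≤ momentBound M.γ U B β := by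
    refine (norm_policyGradient_le h hU0 hU s₀ θ).trans ?_
    set q := Real.sqrt M.γ with hq
    have hq0 : 0 ≤ q := Real.sqrt_nonneg _
    have hq1 : q < 1 := M.sqrt_γ_lt_one
    have hqq : q * q = M.γ := Real.mul_self_sqrt M.γ_nonneg
    have hq2 : 0 < 1 - q := sub_pos.2 hq1
    have hle : (1 - q) ^ 4 ≤ (1 - M.γ) ^ 2 := by
      have : (1 - q) ^ 2 ≤ 1 - M.γ := by rw [← hqq]; nlinarith
      calc (1 - q) ^ 4 = ((1 - q) ^ 2) ^ 2 := by ring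
        _ ≤ _ := by gcongr
    rw [momentBound, ← hq]
    gcongr
    exact (le_max_right _ _).trans (le_max_right _ _)
  calc ‖M.policyGradient π s₀ θ‖ ^ 2 = ‖M.policyGradient π s₀ θ‖ * ‖M.policyGradient π s₀ θ‖ :=
        sq _
    _ ≤ MJ * (3 + lam) * momentBound M.γ U B β := by gcongr
    _ ≤ _ := by
        have := mul_nonneg hMJ (momentBound_nonneg (γ := M.γ) (B := B) (β := β) hU0)
        nlinarith

instance isMarkovKernel_update (M : MDP S A) (π : PolicyFamily d S ν) (s : S) (η : ℝ) :
    IsMarkovKernel (M.update π s η) := by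
  unfold update
  exact Kernel.IsMarkovKernel.map _ (M.measurable_update_map π η)

theorem update_apply (M : MDP S A) (π : PolicyFamily d S ν) (s : S) (η : ℝ) (θ : Param d) :
    M.update π s η θ = (M.rollout π s θ).map fun x => θ + η • M.estimate π θ x := by
  have hm := M.measurable_update_map π η
  refine Measure.ext_of_lintegral _ fun f hf => ?_
  have hm' : Measurable fun x : ℕ × (ℕ → S × A) => θ + η • M.estimate π θ x :=
    hm.comp measurable_prodMk_left
  rw [update, Kernel.map_apply _ hm, lintegral_map hf hm, lintegral_map hf hm',
    Kernel.lintegral_id_prod]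
  exact hf.comp hm

instance isProbabilityMeasure_iterateLaw (M : MDP S A) (π : PolicyFamily d S ν) (s : S) (η : ℝ)
    (θ₀ : Param d) (k : ℕ) : IsProbabilityMeasure (M.iterateLaw π s η θ₀ k) := by
  induction k with
  | zero => exact Measure.dirac.isProbabilityMeasure
  | succ k ih =>
    exact inferInstanceAs (IsProbabilityMeasure ((M.iterateLaw π s η θ₀ k).bind (M.update π s η)))

theorem integral_iterateLaw_succ (M : MDP S A) (π : PolicyFamily d S ν) (s : S) (η : ℝ)
    (θ₀ : Param d) (k : ℕ) {f : Param d → ℝ} (hf : Measurable f) {b : ℝ} (hb : ∀ θ, |f θ| ≤ b) :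
    ∫ θ, f θ ∂M.iterateLaw π s η θ₀ (k + 1) =
      ∫ θ, ∫ θ', f θ' ∂M.update π s η θ ∂M.iterateLaw π s η θ₀ k := by
  have hi : Integrable f (M.iterateLaw π s η θ₀ (k + 1)) := integrable_of_abs_le hf hb
  have e : M.iterateLaw π s η θ₀ (k + 1) =
      (M.update π s η ∘ₖ Kernel.const Unit (M.iterateLaw π s η θ₀ k)) () :=
    Measure.comp_eq_comp_const_apply
  rw [e] at hi ⊢
  rw [Kernel.integral_comp hi, Kernel.const_apply]

/-- Needed for an initial optimality gap of zero, where the step size in (b) vanishes. -/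
theorem iterateLaw_zero_step (M : MDP S A) (π : PolicyFamily d S ν) (s : S) (θ₀ : Param d)
    (k : ℕ) : M.iterateLaw π s 0 θ₀ k = Measure.dirac θ₀ := by
  induction k with
  | zero => rfl
  | succ k ih =>
    change (M.iterateLaw π s 0 θ₀ k).bind (M.update π s 0) = _
    rw [ih, Measure.dirac_bind (M.update π s 0).measurable, update_apply]
    simp

/-- The expected gain of one update. -/
theorem integral_objective_update_ge (h : π.RegularScore B Mh β) (hU0 : 0 ≤ U)
    (hU : ∀ x, |M.reward x| ≤ U) {lam : ℝ} (hlam : 0 ≤ lam) (hBlam : π.scoreBound lam ≠ ∞)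
    (s₀ : S) {η : ℝ} (hη : 0 ≤ η) (θ : Param d) :
    M.objective π s₀ θ + η * ‖M.policyGradient π s₀ θ‖ ^ 2 -
      constLJ M.γ U B Mh (π.scoreBound lam).toReal β / 2 * (η ^ (1 + β) + η ^ 2 + lam * η) ≤
        ∫ θ', M.objective π s₀ θ' ∂M.update π s₀ η θ := by
  have hdiff : Differentiable ℝ (M.objective π s₀) := fun θ =>
    (hasGradientAt_objective h hU0 hU s₀ θ).differentiableAt
  have hJm : Measurable (M.objective π s₀) := hdiff.continuous.measurable
  have hMJ := constMJ_nonneg M.γ B Mh (π.scoreBound lam).toReal hU0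
  have hm := M.measurable_estimate_apply π θ
  have hm' : Measurable fun x : ℕ × (ℕ → S × A) => θ + η • M.estimate π θ x :=
    (M.measurable_update_map π η).comp measurable_prodMk_left
  have hi := integrable_estimate h hU0 hU s₀ θ
  have m1 := integrable_and_integral_norm_estimate_rpow_le h hU0 hU s₀ θ (p := 1) one_pos
    one_le_two
  have m2 := integrable_and_integral_norm_estimate_rpow_le h hU0 hU s₀ θ (p := 2) two_pos le_rfl
  have m3 := integrable_and_integral_norm_estimate_rpow_le h hU0 hU s₀ θ (p := 1 + β)
    (by linarith [h.β_pos]) (by linarith [h.β_le_one])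
  simp only [Real.rpow_one, Real.rpow_two, div_self (two_ne_zero (α := ℝ)),
    ← Real.sqrt_eq_rpow] at m1 m2
  have hden : 0 ≤ (1 - Real.sqrt M.γ) ^ 4 := by positivity
  have b1 : ∫ x, ‖M.estimate π θ x‖ ∂M.rollout π s₀ θ ≤ momentBound M.γ U B β :=
    m1.2.trans (div_le_div_of_nonneg_right ((le_max_right _ _).trans (le_max_right _ _)) hden)
  have b2 : ∫ x, ‖M.estimate π θ x‖ ^ 2 ∂M.rollout π s₀ θ ≤ momentBound M.γ U B β :=
    m2.2.trans (div_le_div_of_nonneg_right (le_max_left _ _) hden)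
  have b3 : ∫ x, ‖M.estimate π θ x‖ ^ (1 + β) ∂M.rollout π s₀ θ ≤ momentBound M.γ U B β :=
    m3.2.trans (div_le_div_of_nonneg_right ((le_max_left _ _).trans (le_max_right _ _)) hden)
  rw [constLJ_eq, update_apply, integral_map hm'.aemeasurable hJm.aestronglyMeasurable]
  set MJ := constMJ M.γ U B Mh (π.scoreBound lam).toReal
  set G := M.policyGradient π s₀ θ
  -- The ascent inequality with δ = ηĝ. In the mean the inner product becomes ‖G‖² by unbiasedness,
  -- and the three powers of ‖ĝ‖ are each at most `momentBound`.
  have hlow : ∀ x, M.objective π s₀ θ + η * ⟪G, M.estimate π θ x⟫_ℝ -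
      MJ * (η ^ (1 + β) * ‖M.estimate π θ x‖ ^ (1 + β) + η ^ 2 * ‖M.estimate π θ x‖ ^ 2 +
        lam * η * ‖M.estimate π θ x‖) ≤ M.objective π s₀ (θ + η • M.estimate π θ x) := by
    intro x
    have := objective_add_ge (M := M) h hU0 hU hlam hBlam s₀ θ (η • M.estimate π θ x)
    rw [norm_smul, Real.norm_of_nonneg hη, Real.mul_rpow hη (norm_nonneg _), mul_pow,
      real_inner_smul_right, ← mul_assoc lam] at this
    exact this
  have hin : Integrable (fun x => ⟪G, M.estimate π θ x⟫_ℝ) (M.rollout π s₀ θ) := hi.const_inner G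
  have i1 : Integrable (fun x => M.objective π s₀ θ + η * ⟪G, M.estimate π θ x⟫_ℝ)
      (M.rollout π s₀ θ) := (integrable_const _).add (hin.const_mul η)
  have i2 : Integrable (fun x => η ^ (1 + β) * ‖M.estimate π θ x‖ ^ (1 + β) +
      η ^ 2 * ‖M.estimate π θ x‖ ^ 2) (M.rollout π s₀ θ) :=
    (m3.1.const_mul _).add (m2.1.const_mul _)
  have i3 : Integrable (fun x => η ^ (1 + β) * ‖M.estimate π θ x‖ ^ (1 + β) +
      η ^ 2 * ‖M.estimate π θ x‖ ^ 2 + lam * η * ‖M.estimate π θ x‖) (M.rollout π s₀ θ) :=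
    i2.add (m1.1.const_mul _)
  have hJi : Integrable (fun x => M.objective π s₀ (θ + η • M.estimate π θ x))
      (M.rollout π s₀ θ) :=
    integrable_of_abs_le (hJm.comp hm') fun x => abs_objective_le hU s₀ _
  refine le_trans ?_ (integral_mono (i1.sub (i3.const_mul MJ)) hJi hlow)
  simp only [Pi.sub_apply]
  rw [integral_sub i1 (i3.const_mul MJ), integral_const_mul,
    integral_add (integrable_const _) (hin.const_mul η), integral_const_mul, integral_inner hi,
    integral_estimate h hU0 hU s₀ θ, integral_add i2 (m1.1.const_mul _),
    integral_add (m3.1.const_mul _) (m2.1.const_mul _), integral_const_mul, integral_const_mul,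
    integral_const_mul, integral_const, real_inner_self_eq_norm_sq]
  simp only [probReal_univ, smul_eq_mul, one_mul]
  have hη1 : 0 ≤ η ^ (1 + β) := Real.rpow_nonneg hη _
  have hsum : η ^ (1 + β) * ∫ x, ‖M.estimate π θ x‖ ^ (1 + β) ∂M.rollout π s₀ θ +
      η ^ 2 * ∫ x, ‖M.estimate π θ x‖ ^ 2 ∂M.rollout π s₀ θ +
      lam * η * ∫ x, ‖M.estimate π θ x‖ ∂M.rollout π s₀ θ ≤
      (η ^ (1 + β) + η ^ 2 + lam * η) * momentBound M.γ U B β := by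
    rw [add_mul, add_mul]
    gcongr
  have := mul_le_mul_of_nonneg_left hsum hMJ
  linarith

theorem measurable_norm_policyGradient_sq (h : π.RegularScore B Mh β) (hU0 : 0 ≤ U)
    (hU : ∀ x, |M.reward x| ≤ U) (s₀ : S) :
    Measurable fun θ => ‖M.policyGradient π s₀ θ‖ ^ 2 := by
  have e : ∀ θ, ‖M.policyGradient π s₀ θ‖ = ‖fderiv ℝ (M.objective π s₀) θ‖ := fun θ => by
    rw [(hasGradientAt_objective h hU0 hU s₀ θ).hasFDerivAt.fderiv, LinearIsometryEquiv.norm_map]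
  simp_rw [e]
  exact (measurable_fderiv ℝ (M.objective π s₀)).norm.pow_const 2

theorem integrable_norm_policyGradient_sq (h : π.RegularScore B Mh β) (hU0 : 0 ≤ U)
    (hU : ∀ x, |M.reward x| ≤ U) (s₀ : S) (μ : Measure (Param d)) [IsProbabilityMeasure μ] :
    Integrable (fun θ => ‖M.policyGradient π s₀ θ‖ ^ 2) μ := by
  refine integrable_of_abs_le (measurable_norm_policyGradient_sq h hU0 hU s₀)
    (b := (U * Real.sqrt B / (1 - M.γ) ^ 2) ^ 2) fun θ => ?_
  rw [abs_of_nonneg (by positivity)]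
  gcongr
  exact norm_policyGradient_le h hU0 hU s₀ θ

theorem meanSqGradNorm_eq (h : π.RegularScore B Mh β) (hU0 : 0 ≤ U)
    (hU : ∀ x, |M.reward x| ≤ U) (s₀ : S) (η : ℝ) (θ₀ : Param d) (K : ℕ) :
    M.meanSqGradNorm π s₀ η θ₀ K = 1 / (K : ℝ) * ∑ k ∈ Finset.range K,
      ∫ θ, ‖M.policyGradient π s₀ θ‖ ^ 2 ∂M.iterateLaw π s₀ η θ₀ k := by
  simp only [meanSqGradNorm, (hasGradientAt_objective h hU0 hU s₀ _).gradient]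

theorem meanSqGradNorm_le_of_forall (h : π.RegularScore B Mh β) (hU0 : 0 ≤ U)
    (hU : ∀ x, |M.reward x| ≤ U) (s₀ : S) (η : ℝ) (θ₀ : Param d) {K : ℕ} (hK : 0 < K) {b : ℝ}
    (hb : ∀ θ, ‖M.policyGradient π s₀ θ‖ ^ 2 ≤ b) : M.meanSqGradNorm π s₀ η θ₀ K ≤ b := by
  have hK' : (0 : ℝ) < K := Nat.cast_pos.2 hK
  rw [meanSqGradNorm_eq h hU0 hU, one_div_mul_eq_div, div_le_iff₀ hK', mul_comm, ← nsmul_eq_mul]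
  conv_rhs => rw [← Finset.card_range K]
  refine Finset.sum_le_card_nsmul _ _ _ fun k _ => ?_
  calc _ ≤ ∫ _, b ∂M.iterateLaw π s₀ η θ₀ k :=
        integral_mono (integrable_norm_policyGradient_sq h hU0 hU s₀ _) (integrable_const b) hb
    _ = b := by simp

theorem meanSqGradNorm_le (h : π.RegularScore B Mh β) (hU0 : 0 ≤ U)
    (hU : ∀ x, |M.reward x| ≤ U) {lam : ℝ} (hlam : 0 ≤ lam) (hBlam : π.scoreBound lam ≠ ∞)
    (s₀ : S) (θ₀ : Param d) {Jstar : ℝ} (hJ : ∀ θ, M.objective π s₀ θ ≤ Jstar)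
    {η : ℝ} (hη : 0 < η) {K : ℕ} (hK : 0 < K) :
    M.meanSqGradNorm π s₀ η θ₀ K ≤ (Jstar - M.objective π s₀ θ₀) / (K * η) +
      constLJ M.γ U B Mh (π.scoreBound lam).toReal β / 2 * (η ^ β + η + lam) := by
  have hdiff : Differentiable ℝ (M.objective π s₀) := fun θ =>
    (hasGradientAt_objective h hU0 hU s₀ θ).differentiableAt
  have hJm : Measurable (M.objective π s₀) := hdiff.continuous.measurable
  have hJb := abs_objective_le (M := M) (π := π) hU s₀
  have hstep := integral_objective_update_ge h hU0 hU hlam hBlam s₀ hη.le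
  rw [meanSqGradNorm_eq h hU0 hU]
  set L := constLJ M.γ U B Mh (π.scoreBound lam).toReal β
  set c := L / 2 * (η ^ (1 + β) + η ^ 2 + lam * η) with hc
  set μ := M.iterateLaw π s₀ η θ₀
  have hJi : ∀ k, Integrable (M.objective π s₀) (μ k) := fun k => integrable_of_abs_le hJm hJb
  have hGi : ∀ k, Integrable (fun θ => ‖M.policyGradient π s₀ θ‖ ^ 2) (μ k) := fun k =>
    integrable_norm_policyGradient_sq h hU0 hU s₀ _
  have hsucc : ∀ k, ∫ θ, M.objective π s₀ θ ∂μ k +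
      η * ∫ θ, ‖M.policyGradient π s₀ θ‖ ^ 2 ∂μ k - c ≤ ∫ θ, M.objective π s₀ θ ∂μ (k + 1) := by
    intro k
    have i1 : Integrable (fun θ => M.objective π s₀ θ + η * ‖M.policyGradient π s₀ θ‖ ^ 2) (μ k) :=
      (hJi k).add ((hGi k).const_mul η)
    have i2 : Integrable (fun θ => ∫ θ', M.objective π s₀ θ' ∂M.update π s₀ η θ) (μ k) :=
      integrable_of_abs_le (hJm.stronglyMeasurable.integral_kernel).measurable
        fun θ => abs_integral_le_of_abs_le hJb
    have := integral_mono (i1.sub (integrable_const c)) i2 hstep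
    rw [M.integral_iterateLaw_succ π s₀ η θ₀ k hJm hJb]
    refine le_of_eq_of_le ?_ this
    simp only [Pi.sub_apply]
    rw [integral_sub i1 (integrable_const c), integral_add (hJi k) ((hGi k).const_mul η),
      integral_const_mul, integral_const, probReal_univ, one_smul]
  -- The one-step gains telescope; at n = K the mean of J is at most J*, and division by Kη gives
  -- the claim.
  have hsum : ∀ n : ℕ, η * ∑ k ∈ Finset.range n, ∫ θ, ‖M.policyGradient π s₀ θ‖ ^ 2 ∂μ k ≤
      ∫ θ, M.objective π s₀ θ ∂μ n - M.objective π s₀ θ₀ + n * c := by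
    intro n
    induction n with
    | zero =>
      have : ∫ θ, M.objective π s₀ θ ∂μ 0 = M.objective π s₀ θ₀ :=
        integral_dirac' _ _ hJm.stronglyMeasurable
      simp [this]
    | succ n ih =>
      rw [Finset.sum_range_succ, mul_add]
      push_cast
      linarith [hsucc n]
  have hK' : (0 : ℝ) < K := Nat.cast_pos.2 hK
  have hlast : ∫ θ, M.objective π s₀ θ ∂μ K ≤ Jstar := by
    calc _ ≤ ∫ _, Jstar ∂μ K := integral_mono (hJi K) (integrable_const _) hJ
      _ = Jstar := by simp [μ]
  have hpow : η ^ (1 + β) = η * η ^ β := by rw [Real.rpow_add hη, Real.rpow_one]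
  have hall := hsum K
  set X := ∑ k ∈ Finset.range K, ∫ θ, ‖M.policyGradient π s₀ θ‖ ^ 2 ∂μ k
  have e : 1 / (K : ℝ) * X = η * X / (K * η) := by field_simp
  have e' : (Jstar - M.objective π s₀ θ₀) / (K * η) + L / 2 * (η ^ β + η + lam) =
      (Jstar - M.objective π s₀ θ₀ + K * c) / (K * η) := by
    rw [hc, hpow]; field_simp
  rw [e, e']
  gcongr
  linarith

end MDP

end HPG

/-! ### The two step sizes and the final rates. -/

namespace HPG

open Filter Topology InnerProductSpace

variable {d : ℕ} {S A : Type*} [MeasurableSpace S] [MeasurableSpace A] {ν : Measure A}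
  [SigmaFinite ν]

namespace MDP

variable {M : MDP S A} {π : PolicyFamily d S ν} {B Mh β U : ℝ}

/-- The rate with step size `1 / K^{1/(1+β)}`. -/
theorem meanSqGradNorm_le_of_step_eq (h : π.RegularScore B Mh β) (hU0 : 0 ≤ U)
    (hU : ∀ x, |M.reward x| ≤ U) {lam : ℝ} (hlam : 0 ≤ lam) (hBlam : π.scoreBound lam ≠ ∞)
    (s₀ : S) (θ₀ : Param d) {Jstar : ℝ} (hJ : ∀ θ, M.objective π s₀ θ ≤ Jstar)
    {K : ℕ} (hK : 0 < K) :
    M.meanSqGradNorm π s₀ (1 / (K : ℝ) ^ (1 / (1 + β))) θ₀ K ≤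
      (Jstar - M.objective π s₀ θ₀ + 2 * constLJ M.γ U B Mh (π.scoreBound lam).toReal β) /
        (K : ℝ) ^ (β / (1 + β)) + constLJ M.γ U B Mh (π.scoreBound lam).toReal β * lam := by
  have hK' : (0 : ℝ) < K := Nat.cast_pos.2 hK
  have hβ := h.β_pos
  have hp : 0 < 1 / (1 + β) := by positivity
  have hη : 0 < 1 / (K : ℝ) ^ (1 / (1 + β)) := by positivity
  have hη1 : 1 / (K : ℝ) ^ (1 / (1 + β)) ≤ 1 := by
    rw [div_le_one (by positivity)]
    exact Real.one_le_rpow (Nat.one_le_cast.2 hK) hp.le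
  have hmain := meanSqGradNorm_le h hU0 hU hlam hBlam s₀ θ₀ hJ hη hK
  have hL := constLJ_nonneg M.γ B Mh (π.scoreBound lam).toReal β hU0
  set L := constLJ M.γ U B Mh (π.scoreBound lam).toReal β
  have e1 : (1 / (K : ℝ) ^ (1 / (1 + β))) ^ β = 1 / (K : ℝ) ^ (β / (1 + β)) := by
    rw [Real.div_rpow zero_le_one (by positivity), Real.one_rpow, ← Real.rpow_mul hK'.le,
      one_div_mul_eq_div]
  have e2 : (K : ℝ) * (1 / (K : ℝ) ^ (1 / (1 + β))) = (K : ℝ) ^ (β / (1 + β)) := by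
    have : β / (1 + β) = 1 - 1 / (1 + β) := by field_simp; ring
    rw [this, Real.rpow_sub hK', Real.rpow_one, mul_one_div]
  -- This is η ≤ η^β, by η ≤ 1 and β ≤ 1. With y = η^β = 1/(Kη), the general bound becomes at most D
  -- y + L y + Lλ/2, where D is the initial gap.
  have hle : 1 / (K : ℝ) ^ (1 / (1 + β)) ≤ 1 / (K : ℝ) ^ (β / (1 + β)) := by
    rw [← e1]
    simpa using Real.rpow_le_rpow_of_exponent_ge hη hη1 h.β_le_one
  rw [e1, e2] at hmain
  set x := 1 / (K : ℝ) ^ (1 / (1 + β))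
  have hy : 0 < (K : ℝ) ^ (β / (1 + β)) := by positivity
  rw [add_div, ← mul_one_div (2 * L)]
  set y := 1 / (K : ℝ) ^ (β / (1 + β))
  have hy0 : 0 ≤ y := by positivity
  nlinarith [mul_nonneg hL hlam, mul_nonneg hL hy0, mul_le_mul_of_nonneg_left hle hL]

/-- The rate with step size `(D / (2 β L))^{1/(1+β)} / K^{1/(1+β)}`, where `D` is the initial
optimality gap. -/
theorem meanSqGradNorm_le_of_optimal_step (h : π.RegularScore B Mh β) (hU0 : 0 ≤ U)
    (hU : ∀ x, |M.reward x| ≤ U) {lam : ℝ} (hlam : 0 ≤ lam) (hBlam : π.scoreBound lam ≠ ∞)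
    (s₀ : S) (θ₀ : Param d) {Jstar : ℝ} (hJ : ∀ θ, M.objective π s₀ θ ≤ Jstar)
    {K : ℕ} (hK : 0 < K) {D L : ℝ} (hD : D = Jstar - M.objective π s₀ θ₀)
    (hL : L = constLJ M.γ U B Mh (π.scoreBound lam).toReal β) :
    M.meanSqGradNorm π s₀ ((D / (2 * β * L)) ^ (1 / (1 + β)) / (K : ℝ) ^ (1 / (1 + β))) θ₀ K ≤
      (1 + β) / β ^ (β / (1 + β)) * ((2 * L) ^ (1 / (1 + β)) * D ^ (β / (1 + β))) /
        (K : ℝ) ^ (β / (1 + β)) + L * lam := by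
  have hK' : (0 : ℝ) < K := Nat.cast_pos.2 hK
  have hβ := h.β_pos
  have hD0 : 0 ≤ D := hD ▸ sub_nonneg.2 (hJ θ₀)
  have hL0 : 0 ≤ L := hL ▸ constLJ_nonneg M.γ B Mh (π.scoreBound lam).toReal β hU0
  have hpt := norm_policyGradient_sq_le (M := M) h hU0 hU hlam hBlam s₀
  have hmain := fun η (hη : 0 < η) =>
    meanSqGradNorm_le (η := η) h hU0 hU hlam hBlam s₀ θ₀ hJ hη hK
  rw [← hL] at hpt
  rw [← hL, ← hD] at hmain
  have hptK := fun η => meanSqGradNorm_le_of_forall h hU0 hU s₀ η θ₀ hK hpt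
  rcases hL0.eq_or_lt with hL1 | hL1
  -- If L = 0, the pointwise bound makes the gradient vanish everywhere, whatever the step size.
  · refine (hptK _).trans ?_
    rw [← hL1, zero_mul]
    positivity
  rcases hD0.eq_or_lt with hD1 | hD1
  -- If D = 0, θ₀ is a global maximizer and the step size is 0, so every iterate stays at this
  -- critical point.
  · have hmax : IsLocalMax (M.objective π s₀) θ₀ :=
      Eventually.of_forall fun θ => (hJ θ).trans (by linarith)
    have hzero : M.policyGradient π s₀ θ₀ = 0 := by
      have := (hasGradientAt_objective h hU0 hU s₀ θ₀).hasFDerivAt.fderiv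
      rwa [hmax.fderiv_eq_zero, eq_comm, LinearIsometryEquiv.map_eq_zero_iff] at this
    have hp : 1 / (1 + β) ≠ 0 := by positivity
    rw [← hD1, zero_div, Real.zero_rpow hp, zero_div, meanSqGradNorm_eq h hU0 hU]
    simp only [iterateLaw_zero_step, integral_dirac' _ _
      (measurable_norm_policyGradient_sq h hU0 hU s₀).stronglyMeasurable, hzero]
    simp only [norm_zero, ne_eq, OfNat.ofNat_ne_zero, not_false_eq_true, zero_pow,
      Finset.sum_const_zero, mul_zero]
    positivity
  set w := D / (2 * β * L) with hw
  have hw0 : 0 < w := by positivity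
  set η := w ^ (1 / (1 + β)) / (K : ℝ) ^ (1 / (1 + β)) with hη
  have hη0 : 0 < η := by positivity
  have e1 : η ^ β = w ^ (β / (1 + β)) / (K : ℝ) ^ (β / (1 + β)) := by
    rw [hη, Real.div_rpow (by positivity) (by positivity), ← Real.rpow_mul hw0.le,
      ← Real.rpow_mul hK'.le, one_div_mul_eq_div]
  have e2 : η * η ^ β = w / K := by
    rw [← Real.rpow_one_add' hη0.le (by positivity), hη, ← Real.div_rpow hw0.le hK'.le,
      ← Real.rpow_mul (by positivity), one_div_mul_cancel (by positivity), Real.rpow_one]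
  -- From η^{1+β} = w/K, the target and the term D/(Kη) are both multiples of L η^β, namely 2(1 + β)
  -- and 2β times it. This leaves 2L η^β for the smoothness terms.
  have e3 : (1 + β) / β ^ (β / (1 + β)) * ((2 * L) ^ (1 / (1 + β)) * D ^ (β / (1 + β))) /
      (K : ℝ) ^ (β / (1 + β)) = 2 * L * (1 + β) * η ^ β := by
    have hpq : 1 / (1 + β) = 1 - β / (1 + β) := by field_simp; ring
    rw [e1, hw, Real.div_rpow hD0 (by positivity), show 2 * β * L = β * (2 * L) by ring,
      Real.mul_rpow hβ.le (by positivity), hpq, Real.rpow_sub (by positivity), Real.rpow_one]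
    field_simp
  have e4 : D / (K * η) = 2 * β * L * η ^ β := by
    rw [div_eq_iff (by positivity)]
    have : D = w * (2 * β * L) := by rw [hw]; field_simp
    rw [this, show w = η * η ^ β * K by rw [e2]; field_simp]
    ring
  have hηβ : 0 < η ^ β := by positivity
  have hLlam := mul_nonneg hL0 hlam
  have hLβ := mul_nonneg hL0 hβ.le
  rw [e3]
  rcases le_total η 1 with h1 | h1
  -- For η ≤ 1 the smoothness terms are at most L η^β + Lλ/2.
  · have hle : η ≤ η ^ β := by
      simpa using Real.rpow_le_rpow_of_exponent_ge hη0 h1 h.β_le_one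
    have := hmain η hη0
    rw [e4] at this
    have h2 := mul_le_mul_of_nonneg_left hle hL0
    have h3 := mul_nonneg hL0 hηβ.le
    refine this.trans ?_
    linarith
  -- For η ≥ 1 the target is at least 2L + Lλ, which is the pointwise bound.
  · have hge : 1 ≤ η ^ β := Real.one_le_rpow h1 hβ.le
    have h2 := mul_le_mul_of_nonneg_left hge hL0
    have h3 := mul_nonneg hLβ hηβ.le
    refine (hptK η).trans ?_
    linarith

end MDP

end HPG

end

theorem theorem1 {d : ℕ} {S A : Type*} [MeasurableSpace S] [MeasurableSpace A]
    (ν : Measure A) [SigmaFinite ν]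
    (M : HPG.MDP S A) (π : HPG.PolicyFamily d S ν) (s₀ : S) (θ₀ : HPG.Param d)
    (U B Mh β α lam Jstar : ℝ)
    -- bounded rewards
    (hU : ∀ x, |M.reward x| ≤ U)
    -- second moment of the score function
    (hB0 : 0 ≤ B)
    (hB : ∀ θ s, ∫⁻ a, ‖π.score θ s a‖ₑ ^ 2 * ENNReal.ofReal (π.dens θ s a) ∂ν
      ≤ ENNReal.ofReal B)
    -- Hölder continuity of the score function
    (hMh : 0 < Mh) (hβ0 : 0 < β) (hβ1 : β ≤ 1)
    (hHolder : ∀ θ₁ θ₂ s a, ‖π.score θ₁ s a - π.score θ₂ s a‖ ≤ Mh * ‖θ₁ - θ₂‖ ^ β)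
    -- the exponent is bounded by the tail index
    (hα : β ≤ α - 1)
    -- the exploration tolerance
    (hlam : 0 ≤ lam) (hBlam : π.scoreBound lam ≠ ∞)
    -- the objective is bounded above
    (hJ : ∀ θ, M.objective π s₀ θ ≤ Jstar) :
    let J : HPG.Param d → ℝ := M.objective π s₀
    let L : ℝ := HPG.constLJ M.γ U B Mh (π.scoreBound lam).toReal β
    let D : ℝ := Jstar - J θ₀
    -- the gradient exists, and the expectations below are meaningful
    Differentiable ℝ J ∧
    (∀ (η : ℝ) (k : ℕ), IsProbabilityMeasure (M.iterateLaw π s₀ η θ₀ k) ∧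
      Integrable (fun θ => ‖gradient J θ‖ ^ 2) (M.iterateLaw π s₀ η θ₀ k)) ∧
    ∀ K : ℕ, 0 < K →
      -- step size `1 / K^{1/(1+β)}`
      M.meanSqGradNorm π s₀ (1 / (K : ℝ) ^ (1 / (1 + β))) θ₀ K
        ≤ (D + 2 * L) / (K : ℝ) ^ (β / (1 + β)) + L * lam ∧
      -- step size `c_β / K^{1/(1+β)}` with `c_β = (D / (2 β L))^{1/(1+β)}`
      M.meanSqGradNorm π s₀ ((D / (2 * β * L)) ^ (1 / (1 + β)) / (K : ℝ) ^ (1 / (1 + β))) θ₀ K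
        ≤ (1 + β) / β ^ (β / (1 + β)) * ((2 * L) ^ (1 / (1 + β)) * D ^ (β / (1 + β)))
            / (K : ℝ) ^ (β / (1 + β)) + L * lam := by
  intro J L D
  have h : π.RegularScore B Mh β := ⟨hB0, hB, hMh, hβ0, hβ1, hHolder⟩
  have hU0 : 0 ≤ U := HPG.MDP.nonneg_of_abs_reward_le π s₀ hU
  have hgrad := HPG.MDP.hasGradientAt_objective (M := M) h hU0 hU s₀
  refine ⟨fun θ => (hgrad θ).differentiableAt, fun η k => ⟨inferInstance, ?_⟩, fun K hK => ⟨?_, ?_⟩⟩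
  · simp only [J, (hgrad _).gradient]
    exact HPG.MDP.integrable_norm_policyGradient_sq h hU0 hU s₀ _
  · exact HPG.MDP.meanSqGradNorm_le_of_step_eq h hU0 hU hlam hBlam s₀ θ₀ hJ hK
  · exact HPG.MDP.meanSqGradNorm_le_of_optimal_step h hU0 hU hlam hBlam s₀ θ₀ hJ hK rfl rfl
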